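/- Let $m\ge 0$. For $k=(k_0,\mathbf k)\in\mathbb R\times\mathbb R^3=\mathbb R^4$ put $k^2=k_0^2-|\mathbf k|^2$ and $\omega_{\mathbf k}=\sqrt{|\mathbf k|^2+m^2}$. Define tempered distributions on $\mathbb R^4$ by $$\hat\Delta_+(k)=\frac1{2\pi}\,\theta(k_0)\,\delta(k^2-m^2),\qquad\text{i.e.}\qquad \hat\Delta_+(f)=\frac1{2\pi}\int_{\mathbb R^3}\frac{d^3\mathbf l}{2\omega_{\mathbf l}}\,f(\omega_{\mathbf l},\mathbf l),$$ $$\hat\Delta_R(k)=\frac{1}{(2\pi)^2}\,\frac{-1}{k^2-m^2+i0\,k_0},\qquad\text{i.e.}\qquad \hat\Delta_R(f)=\lim_{\epsilon\downarrow0}\frac1{(2\pi)^2}\int_{\mathbb R^4} d^4k\,\frac{f(k)}{2\omega_{\mathbf k}}\left(\frac1{k_0+\omega_{\mathbf k}+i\epsilon}-\frac1{k_0-\omega_{\mathbf k}+i\epsilon}\right),$$ for Schwartz functions $f$. Let $U=\{k\in\mathbb R^4 : k^2\notin\{0,4m^2\}\}$. Then, for either choice of the sign $\pm$: (1) For every $k\in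 U$ the product $\hat\Delta_+(\cdot)\,\hat\Delta_R(k\pm\cdot)$ is well defined, in the sense of Hörmander, as a tempered distribution. That is, there are no $l\in\mathbb R^4$ and $\xi\neq0$ with $(l,\xi)$ in the wave front set of $\hat\Delta_+(\cdot)$ and $(l,-\xi)$ in that of $\hat\Delta_R(k\pm\cdot)$, and there is exactly one $w\in\mathcal S'(\mathbb R^4)$ such that every point of $\mathbb R^4$ has a neighbourhood $V$ such that, for all $\chi\in C_c^\infty(\mathbb R^4)$ with support in $V$, the Fourier transform of $\chi^2 w$ is the everywhere absolutely convergent convolution of the Fourier transforms (normalised as $\int e^{-2\pi i\langle x,\xi\rangle}g(x)\,dx$) of $\chi\,\hat\Delta_+(\cdot)$ and $\chi\,\hat\Delta_R(k\pm\cdot)$. (2) The map $U\to\mathcal S'(\mathbb R^4)$, $k\mapsto\hat\Delta_+(\cdot)\,\hat\Delta_R(k\pm\cdot)$, is smooth, i.e. has continuous directional derivatives of all orders, with respect to the strong topology of $\mathcal S'(\mathbb R^4)$. -/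

import Mathlib

open scoped SchwartzMap FourierTransform Topology LineDeriv

noncomputable section

/-- Momentum space `ℝ⁴`; the coordinate `0` is the energy, the coordinates `1, 2, 3` form the
spatial momentum. -/
abbrev Momentum : Type := EuclideanSpace ℝ (Fin 4)

/-- The space `𝓢'(ℝ⁴)` of tempered distributions, with the strong dual topology (uniform
convergence on bounded sets of Schwartz functions). Mathlib's `𝓢'(ℝ⁴, ℂ)` has the same elements,
but carries the weaker topology of pointwise convergence. -/
abbrev TemperedDist : Type := 𝓢(Momentum, ℂ) →L[ℂ] ℂ

/-- The Minkowski square `k² = k₀² - k₁² - k₂² - k₃²`. -/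
def minkowskiSq (k : Momentum) : ℝ := k 0 ^ 2 - ∑ i : Fin 3, k i.succ ^ 2

/-- The set `{k ∈ ℝ⁴ | k² ∉ {0, 4m²}}`. -/
def nonexceptionalMomenta (m : ℝ) : Set Momentum :=
  {k | minkowskiSq k ∉ ({0, 4 * m ^ 2} : Set ℝ)}

/-- The energy `ω_p = √(|p|² + m²)` of a particle of mass `m` and spatial momentum `p`. -/
def shellEnergy (m : ℝ) (p : EuclideanSpace ℝ (Fin 3)) : ℝ := √(‖p‖ ^ 2 + m ^ 2)

/-- The point `(ω_p, p)` of the positive mass shell. -/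
def onShell (m : ℝ) (p : EuclideanSpace ℝ (Fin 3)) : Momentum :=
  WithLp.toLp 2 (Fin.cons (shellEnergy m p) (fun i => p i))

/-- The spatial part of a four-momentum. -/
def spatialPart (k : Momentum) : EuclideanSpace ℝ (Fin 3) := WithLp.toLp 2 (fun i => k i.succ)

/-! ### The two-point function -/

lemma continuous_shellEnergy (m : ℝ) : Continuous (shellEnergy m) := by
  unfold shellEnergy; fun_prop

lemma continuous_onShell (m : ℝ) : Continuous (onShell m) := by
  unfold onShell
  refine (PiLp.continuous_toLp 2 _).comp (continuous_pi fun i => ?_)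
  refine Fin.cases ?_ (fun j => ?_) i
  · simpa using continuous_shellEnergy m
  · simp only [Fin.cons_succ]; fun_prop

lemma norm_le_shellEnergy (m : ℝ) (p : EuclideanSpace ℝ (Fin 3)) : ‖p‖ ≤ shellEnergy m p :=
  Real.le_sqrt_of_sq_le (by nlinarith [sq_nonneg m])

lemma norm_le_norm_onShell (m : ℝ) (p : EuclideanSpace ℝ (Fin 3)) : ‖p‖ ≤ ‖onShell m p‖ := by
  rw [EuclideanSpace.norm_eq, EuclideanSpace.norm_eq]
  apply Real.sqrt_le_sqrt
  rw [Fin.sum_univ_succ (n := 3)]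
  simp [onShell]
  positivity

lemma integrable_shellWeight :
    MeasureTheory.Integrable
      (fun p : EuclideanSpace ℝ (Fin 3) => ((1 + ‖p‖) ^ 4)⁻¹ * ‖p‖⁻¹) := by
  have key := MeasureTheory.integrable_fun_norm_addHaar
    (E := EuclideanSpace ℝ (Fin 3)) (F := ℝ) MeasureTheory.volume
    (f := fun r : ℝ => ((1 + r) ^ 4)⁻¹ * r⁻¹)
  rw [key]
  simp only [finrank_euclideanSpace, Fintype.card_fin, smul_eq_mul]
  have hint : MeasureTheory.IntegrableOn (fun y : ℝ => (1 + y ^ 2)⁻¹) (Set.Ioi 0) :=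
    integrable_inv_one_add_sq.integrableOn
  refine MeasureTheory.Integrable.mono' hint ?_ ?_
  · exact Measurable.aestronglyMeasurable (by fun_prop)
  · refine (MeasureTheory.ae_restrict_iff' measurableSet_Ioi).2 (.of_forall fun y hy => ?_)
    have hy : 0 < y := hy
    rw [Real.norm_of_nonneg (by positivity)]
    have h1 : y ^ (3 - 1) * (((1 + y) ^ 4)⁻¹ * y⁻¹) = y / (1 + y) ^ 4 := by
      field_simp
    rw [h1, div_le_iff₀ (by positivity), ← div_eq_inv_mul, le_div_iff₀ (by positivity)]
    nlinarith [pow_pos hy 2, pow_pos hy 3, pow_pos hy 4]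

lemma norm_twoPoint_integrand_le (m : ℝ) (f : 𝓢(Momentum, ℂ)) {p : EuclideanSpace ℝ (Fin 3)}
    (hp : p ≠ 0) :
    ‖f (onShell m p) / (2 * shellEnergy m p : ℝ)‖ ≤
      (2 ^ 4 * ((Finset.Iic (4, 0)).sup (schwartzSeminormFamily ℂ Momentum ℂ)) f) *
        (((1 + ‖p‖) ^ 4)⁻¹ * ‖p‖⁻¹) := by
  set S := ((Finset.Iic (4, 0)).sup (schwartzSeminormFamily ℂ Momentum ℂ)) f with hS
  have hS0 : 0 ≤ S := apply_nonneg _ _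
  have hω := norm_le_shellEnergy m p
  have hp0 : 0 < ‖p‖ := norm_pos_iff.2 hp
  have hb := SchwartzMap.one_add_le_sup_seminorm_apply (𝕜 := ℂ) (m := (4, 0)) (k := 4) (n := 0)
    le_rfl le_rfl f (onShell m p)
  simp only [norm_iteratedFDeriv_zero] at hb
  have h4 : (1 + ‖p‖) ^ 4 * ‖f (onShell m p)‖ ≤ 2 ^ 4 * S := by
    refine le_trans ?_ hb
    gcongr
    exact norm_le_norm_onShell m p
  have h5 : ‖f (onShell m p)‖ ≤ 2 ^ 4 * S * ((1 + ‖p‖) ^ 4)⁻¹ := by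
    rw [← div_eq_mul_inv, le_div_iff₀ (by positivity)]; linarith
  rw [norm_div, div_eq_mul_inv, ← mul_assoc]
  refine mul_le_mul h5 ?_ (by positivity) (by positivity)
  rw [Complex.norm_real, Real.norm_of_nonneg (by linarith)]
  exact inv_anti₀ hp0 (by linarith)

lemma ae_ne_zero_spatial : ∀ᵐ p : EuclideanSpace ℝ (Fin 3), p ≠ 0 := by
  simp [MeasureTheory.ae_iff]

lemma integrable_twoPoint_integrand (m : ℝ) (f : 𝓢(Momentum, ℂ)) :
    MeasureTheory.Integrable
      (fun p : EuclideanSpace ℝ (Fin 3) => f (onShell m p) / (2 * shellEnergy m p : ℝ)) := by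
  refine MeasureTheory.Integrable.mono' (integrable_shellWeight.const_mul
    (2 ^ 4 * ((Finset.Iic (4, 0)).sup (schwartzSeminormFamily ℂ Momentum ℂ)) f)) ?_ ?_
  · have h1 : Measurable (fun p => f (onShell m p)) :=
      (f.continuous.comp (continuous_onShell m)).measurable
    have h2 : Measurable (fun p => ((2 * shellEnergy m p : ℝ) : ℂ)) :=
      (Complex.continuous_ofReal.comp
        (continuous_const.mul (continuous_shellEnergy m))).measurable
    exact (h1.div h2).aestronglyMeasurable
  · filter_upwards [ae_ne_zero_spatial] with p hp using norm_twoPoint_integrand_le m f hp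

/-- The free two-point function in momentum space,
`Δ̂₊(k) = (2π)⁻¹ θ(k₀) δ(k² - m²)`, i.e. `f ↦ (2π)⁻¹ ∫ f(ω_p, p) d³p / (2 ω_p)`. -/
def twoPointHat (m : ℝ) : TemperedDist :=
  SchwartzMap.mkCLMtoNormedSpace
    (fun f => (2 * Real.pi : ℂ)⁻¹ *
      ∫ p : EuclideanSpace ℝ (Fin 3), f (onShell m p) / (2 * shellEnergy m p : ℝ))
    (fun f g => by
      rw [← mul_add, ← MeasureTheory.integral_add (integrable_twoPoint_integrand m f)
        (integrable_twoPoint_integrand m g)]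
      simp only [add_div, add_apply])
    (fun a f => by
      simp only [smul_apply, smul_eq_mul, RingHom.id_apply, mul_div_assoc]
      rw [MeasureTheory.integral_const_mul]
      ring)
    (by
      refine ⟨Finset.Iic (4, 0), ‖(2 * Real.pi : ℂ)⁻¹‖ * (2 ^ 4 *
        ∫ p : EuclideanSpace ℝ (Fin 3), ((1 + ‖p‖) ^ 4)⁻¹ * ‖p‖⁻¹), ?_, fun f => ?_⟩
      · exact mul_nonneg (norm_nonneg _) (mul_nonneg (by norm_num)
          (MeasureTheory.integral_nonneg fun p => by positivity))
      · rw [norm_mul, mul_assoc]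
        refine mul_le_mul_of_nonneg_left ?_ (norm_nonneg _)
        have h := MeasureTheory.norm_integral_le_of_norm_le (integrable_shellWeight.const_mul
          (2 ^ 4 * ((Finset.Iic (4, 0)).sup (schwartzSeminormFamily ℂ Momentum ℂ)) f))
          (f := fun p => f (onShell m p) / (2 * shellEnergy m p : ℝ))
          (by filter_upwards [ae_ne_zero_spatial] with p hp using
                norm_twoPoint_integrand_le m f hp)
        rw [MeasureTheory.integral_const_mul] at h
        linarith)

/-! ### The retarded propagator -/

/-- The function `(2π)⁻² (2ω)⁻¹ ((k₀ + ω + iε)⁻¹ - (k₀ - ω + iε)⁻¹)` with `ω = √(|𝐤|² + m²)`, which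
is `-(2π)⁻² ((k₀ + iε)² - |𝐤|² - m²)⁻¹` for `ω ≠ 0`. -/
def retardedKernel (m ε : ℝ) (k : Momentum) : ℂ :=
  (2 * Real.pi : ℂ)⁻¹ ^ 2 * ((2 * shellEnergy m (spatialPart k) : ℂ)⁻¹ *
    ((k 0 + shellEnergy m (spatialPart k) + Complex.I * ε)⁻¹ -
      (k 0 - shellEnergy m (spatialPart k) + Complex.I * ε)⁻¹))

lemma continuous_spatialPart : Continuous spatialPart := by
  unfold spatialPart; fun_prop

/-- The phase `e^{i k₀ t} sin(ω t) / ω`. -/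
def retardedPhase (m : ℝ) (t : ℝ) (k : Momentum) : ℂ :=
  Complex.exp (Complex.I * k 0 * t) * (t * Real.sinc (shellEnergy m (spatialPart k) * t) : ℝ)

lemma continuous_retardedPhase (m : ℝ) :
    Continuous (fun q : Momentum × ℝ => retardedPhase m q.2 q.1) := by
  unfold retardedPhase
  have h1 : Continuous fun q : Momentum × ℝ => shellEnergy m (spatialPart q.1) :=
    (continuous_shellEnergy m).comp (continuous_spatialPart.comp continuous_fst)
  have h2 : Continuous fun q : Momentum × ℝ =>
      Real.sinc (shellEnergy m (spatialPart q.1) * q.2) :=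
    Real.continuous_sinc.comp (h1.mul continuous_snd)
  have h3 : Continuous fun q : Momentum × ℝ => q.1 0 := by fun_prop
  fun_prop

lemma norm_retardedPhase_le (m : ℝ) {t : ℝ} (ht : 0 ≤ t) (k : Momentum) :
    ‖retardedPhase m t k‖ ≤ t := by
  unfold retardedPhase
  have h1 : ‖Complex.exp (Complex.I * k 0 * t)‖ = 1 := by
    rw [show Complex.I * k 0 * t = ((k 0 * t : ℝ) : ℂ) * Complex.I by push_cast; ring]
    exact Complex.norm_exp_ofReal_mul_I _
  rw [norm_mul, h1, one_mul, Complex.norm_real, norm_mul, Real.norm_of_nonneg ht]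
  exact mul_le_of_le_one_right ht (Real.abs_sinc_le_one _)

lemma integral_retardedPhase (m : ℝ) {ε : ℝ} (hε : 0 < ε) {k : Momentum}
    (hk : shellEnergy m (spatialPart k) ≠ 0) :
    (2 * Real.pi : ℂ)⁻¹ ^ 2 * ∫ t in Set.Ioi (0 : ℝ),
      Real.exp (-ε * t) * retardedPhase m t k = retardedKernel m ε k := by
  set ω := shellEnergy m (spatialPart k) with hω
  have hωc : (ω : ℂ) ≠ 0 := by exact_mod_cast hk
  have hI := Complex.I_ne_zero
  unfold retardedKernel
  rw [← hω]
  congr 1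
  set a : ℂ := Complex.I * (k 0 + ω + Complex.I * ε) with ha
  set b : ℂ := Complex.I * (k 0 - ω + Complex.I * ε) with hb
  have hare : a.re < 0 := by simp [ha]; exact hε
  have hbre : b.re < 0 := by simp [hb]; exact hε
  have ha0 : (k 0 + ω + Complex.I * ε : ℂ) ≠ 0 := by
    intro h; rw [ha, h] at hare; simp at hare
  have hb0 : (k 0 - ω + Complex.I * ε : ℂ) ≠ 0 := by
    intro h; rw [hb, h] at hbre; simp at hbre
  have hint : ∀ t ∈ Set.Ioi (0 : ℝ), Real.exp (-ε * t) * retardedPhase m t k =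
      (2 * Complex.I * ω)⁻¹ * (Complex.exp (a * t) - Complex.exp (b * t)) := by
    intro t ht
    have ht : 0 < t := ht
    have hs : ((t * Real.sinc (ω * t) : ℝ) : ℂ) =
        (2 * Complex.I * ω)⁻¹ *
          (Complex.exp (Complex.I * ω * t) - Complex.exp (-(Complex.I * ω * t))) := by
      rw [Real.sinc_of_ne_zero (mul_ne_zero hk ht.ne')]
      have : (t * (Real.sin (ω * t) / (ω * t)) : ℝ) = Real.sin (ω * t) / ω := by
        field_simp
      rw [this]
      push_cast
      rw [Complex.sin, show -((ω : ℂ) * t) * Complex.I = -(Complex.I * ω * t) by ring,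
        show ((ω : ℂ) * t) * Complex.I = Complex.I * ω * t by ring]
      field_simp
      rw [Complex.I_sq]
      ring
    unfold retardedPhase
    rw [← hω, hs]
    have e1 : Complex.exp (a * t) = Complex.exp (-ε * t) *
        (Complex.exp (Complex.I * k 0 * t) * Complex.exp (Complex.I * ω * t)) := by
      rw [← Complex.exp_add, ← Complex.exp_add]
      congr 1
      rw [ha]
      linear_combination ε * t * Complex.I_sq
    have e2 : Complex.exp (b * t) = Complex.exp (-ε * t) *
        (Complex.exp (Complex.I * k 0 * t) * Complex.exp (-(Complex.I * ω * t))) := by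
      rw [← Complex.exp_add, ← Complex.exp_add]
      congr 1
      rw [hb]
      linear_combination ε * t * Complex.I_sq
    rw [e1, e2]
    push_cast
    ring
  rw [MeasureTheory.setIntegral_congr_fun measurableSet_Ioi hint,
    MeasureTheory.integral_const_mul,
    MeasureTheory.integral_sub (integrableOn_exp_mul_complex_Ioi hare 0)
      (integrableOn_exp_mul_complex_Ioi hbre 0),
    integral_exp_mul_complex_Ioi hare, integral_exp_mul_complex_Ioi hbre]
  simp only [Complex.ofReal_zero, mul_zero, Complex.exp_zero]
  rw [ha, hb]
  field_simp
  rw [Complex.I_sq]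
  ring

lemma ae_shellEnergy_ne_zero (m : ℝ) :
    ∀ᵐ k : Momentum, shellEnergy m (spatialPart k) ≠ 0 := by
  set L : Momentum →ₗ[ℝ] ℝ :=
    (EuclideanSpace.proj (1 : Fin 4) : StrongDual ℝ Momentum).toLinearMap with hL
  have hne : LinearMap.ker L ≠ ⊤ := by
    intro h
    have : EuclideanSpace.single (1 : Fin 4) (1 : ℝ) ∈ LinearMap.ker L := h ▸ Submodule.mem_top
    simp [hL] at this
  have h0 := MeasureTheory.Measure.addHaar_submodule MeasureTheory.volume (LinearMap.ker L) hne
  rw [MeasureTheory.ae_iff]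
  refine MeasureTheory.measure_mono_null (fun k hk => ?_) h0
  simp only [Set.mem_ofPred_eq, not_not] at hk
  have h1 : ‖spatialPart k‖ = 0 :=
    le_antisymm ((norm_le_shellEnergy m _).trans hk.le) (norm_nonneg _)
  have h2 : spatialPart k = 0 := norm_eq_zero.1 h1
  have h3 := congrArg (fun v : EuclideanSpace ℝ (Fin 3) => v 0) h2
  simpa [spatialPart, hL] using h3

/-- The function `t ↦ ∫ f(k) e^{i k₀ t} sin(ω t) / ω d⁴k`. -/
def retardedProfile (m : ℝ) (f : 𝓢(Momentum, ℂ)) (t : ℝ) : ℂ :=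
  ∫ k : Momentum, f k * retardedPhase m t k

lemma integrable_mul_retardedPhase (m : ℝ) (f : 𝓢(Momentum, ℂ)) {t : ℝ} (ht : 0 ≤ t) :
    MeasureTheory.Integrable (fun k : Momentum => f k * retardedPhase m t k) := by
  have hc : Continuous (fun k : Momentum => retardedPhase m t k) :=
    (continuous_retardedPhase m).comp (Continuous.prodMk_left t)
  refine f.integrable.mul_bdd (c := t) hc.aestronglyMeasurable
    (.of_forall fun k => norm_retardedPhase_le m ht k)

lemma norm_retardedProfile_le (m : ℝ) (f : 𝓢(Momentum, ℂ)) {t : ℝ} (ht : 0 ≤ t) :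
    ‖retardedProfile m f t‖ ≤ t * ∫ k, ‖f k‖ := by
  rw [← MeasureTheory.integral_const_mul]
  refine MeasureTheory.norm_integral_le_of_norm_le (f.integrable.norm.const_mul t)
    (.of_forall fun k => ?_)
  rw [norm_mul, mul_comm]
  exact mul_le_mul_of_nonneg_right (norm_retardedPhase_le m ht k) (norm_nonneg _)

lemma spatialPart_add_energy (k : Momentum) (s : ℝ) :
    spatialPart (k + s • EuclideanSpace.single (0 : Fin 4) (1 : ℝ)) = spatialPart k := by
  ext i
  simp [spatialPart]

lemma retardedProfile_lineDeriv (m : ℝ) (f : 𝓢(Momentum, ℂ)) {t : ℝ} (ht : 0 ≤ t) :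
    retardedProfile m (∂_{EuclideanSpace.single (0 : Fin 4) (1 : ℝ)} f) t =
      -(Complex.I * t) * retardedProfile m f t := by
  set v : Momentum := EuclideanSpace.single (0 : Fin 4) (1 : ℝ) with hv
  have hphase : ∀ k, HasLineDerivAt ℝ (retardedPhase m t)
      (Complex.I * t * retardedPhase m t k) k v := by
    intro k
    unfold HasLineDerivAt retardedPhase
    simp only [hv, spatialPart_add_energy]
    have h1 : HasDerivAt (fun s : ℝ => Complex.I * ((k 0 + s : ℝ) : ℂ) * t)
        (Complex.I * (1 : ℝ) * t) 0 :=
      ((((hasDerivAt_id (0 : ℝ)).const_add (k 0)).ofReal_comp).const_mul Complex.I).mul_const _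
    have h2 := (h1.cexp).mul_const
      ((t * Real.sinc (shellEnergy m (spatialPart k) * t) : ℝ) : ℂ)
    refine HasDerivAt.congr_deriv (f' := _) (h2.congr_of_eventuallyEq (.of_forall fun s => ?_)) ?_
    · simp
    · simp only [add_zero]
      push_cast
      ring
  have hf : ∀ k, HasLineDerivAt ℝ f ((∂_{v} f) k) k v := by
    intro k
    rw [SchwartzMap.lineDerivOp_apply_eq_fderiv]
    exact (f.hasFDerivAt k).hasLineDerivAt v
  have h := integral_bilinear_hasLineDerivAt_right_eq_neg_left_of_integrable
    (μ := MeasureTheory.volume) (B := ContinuousLinearMap.mul ℝ ℂ)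
    (f := retardedPhase m t) (f' := fun k => Complex.I * t * retardedPhase m t k)
    (g := f) (g' := (∂_{v} f : 𝓢(Momentum, ℂ))) (v := v)
    (by
      simp only [ContinuousLinearMap.mul_apply']
      refine ((integrable_mul_retardedPhase m f ht).const_mul (Complex.I * t)).congr
        (.of_forall fun k => ?_)
      simp only; ring)
    (by
      simp only [ContinuousLinearMap.mul_apply']
      exact (integrable_mul_retardedPhase m (∂_{v} f) ht).congr
        (.of_forall fun k => mul_comm _ _))
    (by
      simp only [ContinuousLinearMap.mul_apply']
      exact (integrable_mul_retardedPhase m f ht).congr (.of_forall fun k => mul_comm _ _))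
    (fun k _ => hphase k) (fun k _ => hf k)
  simp only [ContinuousLinearMap.mul_apply'] at h
  unfold retardedProfile
  rw [← MeasureTheory.integral_const_mul]
  calc ∫ k, (∂_{v} f) k * retardedPhase m t k = ∫ k, retardedPhase m t k * (∂_{v} f : 𝓢(Momentum, ℂ)) k := by
        simp only [mul_comm]
    _ = _ := h
    _ = _ := by
        rw [← MeasureTheory.integral_neg]
        congr 1; ext k; ring

/-- The `L¹` norms of `f` and of its third energy derivative. -/
def retardedBound (f : 𝓢(Momentum, ℂ)) : ℝ :=
  (∫ k, ‖f k‖) + ∫ k, ‖(∂_{EuclideanSpace.single (0 : Fin 4) (1 : ℝ)}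
    (∂_{EuclideanSpace.single (0 : Fin 4) (1 : ℝ)}
      (∂_{EuclideanSpace.single (0 : Fin 4) (1 : ℝ)} f))) k‖

lemma norm_retardedProfile_le_inv (m : ℝ) (f : 𝓢(Momentum, ℂ)) {t : ℝ} (ht : 0 ≤ t) :
    ‖retardedProfile m f t‖ ≤ 2 * retardedBound f * (1 + t ^ 2)⁻¹ := by
  have h1 := norm_retardedProfile_le m f ht
  have h2 := norm_retardedProfile_le m (∂_{EuclideanSpace.single (0 : Fin 4) (1 : ℝ)}
    (∂_{EuclideanSpace.single (0 : Fin 4) (1 : ℝ)}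
      (∂_{EuclideanSpace.single (0 : Fin 4) (1 : ℝ)} f))) ht
  rw [retardedProfile_lineDeriv m _ ht, retardedProfile_lineDeriv m _ ht,
    retardedProfile_lineDeriv m _ ht] at h2
  simp only [norm_mul, norm_neg, Complex.norm_I, one_mul, Complex.norm_real,
    Real.norm_of_nonneg ht] at h2
  have hA : 0 ≤ ∫ k, ‖f k‖ := MeasureTheory.integral_nonneg fun _ => norm_nonneg _
  unfold retardedBound
  set A := ∫ k, ‖f k‖
  have hB : 0 ≤ ∫ k, ‖(∂_{EuclideanSpace.single (0 : Fin 4) (1 : ℝ)}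
    (∂_{EuclideanSpace.single (0 : Fin 4) (1 : ℝ)}
      (∂_{EuclideanSpace.single (0 : Fin 4) (1 : ℝ)} f))) k‖ :=
    MeasureTheory.integral_nonneg fun _ => norm_nonneg _
  set B := ∫ k, ‖(∂_{EuclideanSpace.single (0 : Fin 4) (1 : ℝ)}
    (∂_{EuclideanSpace.single (0 : Fin 4) (1 : ℝ)}
      (∂_{EuclideanSpace.single (0 : Fin 4) (1 : ℝ)} f))) k‖
  set G := ‖retardedProfile m f t‖ with hG
  have hG0 : 0 ≤ G := norm_nonneg _
  rw [← div_eq_mul_inv, le_div_iff₀ (by positivity)]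
  have h3 : G * (1 + t ^ 3) ≤ t * (A + B) := by nlinarith
  have h4 : t * (1 + t ^ 2) ≤ 2 * (1 + t ^ 3) := by
    nlinarith [sq_nonneg (t - 1), mul_nonneg ht (sq_nonneg (t - 1))]
  have h5 : 0 < 1 + t ^ 3 := by positivity
  refine le_of_mul_le_mul_right ?_ h5
  calc G * (1 + t ^ 2) * (1 + t ^ 3) = (G * (1 + t ^ 3)) * (1 + t ^ 2) := by ring
    _ ≤ (t * (A + B)) * (1 + t ^ 2) := mul_le_mul_of_nonneg_right h3 (by positivity)
    _ = (A + B) * (t * (1 + t ^ 2)) := by ring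
    _ ≤ (A + B) * (2 * (1 + t ^ 3)) := mul_le_mul_of_nonneg_left h4 (by positivity)
    _ = 2 * (A + B) * (1 + t ^ 3) := by ring

lemma integrable_uncurry_retarded (m : ℝ) (f : 𝓢(Momentum, ℂ)) {ε : ℝ} (hε : 0 < ε) :
    MeasureTheory.Integrable
      (fun q : Momentum × ℝ => f q.1 * (Real.exp (-ε * q.2) * retardedPhase m q.2 q.1))
      (MeasureTheory.volume.prod (MeasureTheory.volume.restrict (Set.Ioi (0 : ℝ)))) := by
  have hexp : MeasureTheory.Integrable (fun t : ℝ => t * Real.exp (-ε * t))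
      (MeasureTheory.volume.restrict (Set.Ioi (0 : ℝ))) := by
    have := integrableOn_rpow_mul_exp_neg_mul_rpow (s := 1) (p := 1) (b := ε) (by norm_num)
      (by norm_num) hε
    simpa [MeasureTheory.IntegrableOn] using this
  refine MeasureTheory.Integrable.mono' (f.integrable.norm.mul_prod hexp) ?_ ?_
  · have h1 := continuous_retardedPhase m
    have h2 : Continuous fun q : Momentum × ℝ => f q.1 := f.continuous.comp continuous_fst
    exact Continuous.aestronglyMeasurable (by fun_prop)
  · have hset : ∀ᵐ q : Momentum × ℝ ∂(MeasureTheory.volume.prod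
        (MeasureTheory.volume.restrict (Set.Ioi (0 : ℝ)))), q.2 ∈ Set.Ioi (0 : ℝ) :=
      MeasureTheory.Measure.quasiMeasurePreserving_snd.ae
        (MeasureTheory.ae_restrict_mem measurableSet_Ioi)
    filter_upwards [hset] with q hq
    have hq : 0 < q.2 := hq
    rw [norm_mul, norm_mul, Complex.norm_real, Real.norm_of_nonneg (Real.exp_pos _).le]
    have := norm_retardedPhase_le m hq.le q.1
    have h2 := (Real.exp_pos (-ε * q.2)).le
    rw [mul_comm q.2]
    gcongr

lemma integral_mul_retardedKernel (m : ℝ) (f : 𝓢(Momentum, ℂ)) {ε : ℝ} (hε : 0 < ε) :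
    ∫ k, f k * retardedKernel m ε k = (2 * Real.pi : ℂ)⁻¹ ^ 2 *
      ∫ t in Set.Ioi (0 : ℝ), Real.exp (-ε * t) * retardedProfile m f t := by
  have h1 : ∫ k, f k * retardedKernel m ε k = ∫ k, (2 * Real.pi : ℂ)⁻¹ ^ 2 *
      ∫ t in Set.Ioi (0 : ℝ), f k * (Real.exp (-ε * t) * retardedPhase m t k) := by
    refine MeasureTheory.integral_congr_ae ?_
    filter_upwards [ae_shellEnergy_ne_zero m] with k hk
    rw [← integral_retardedPhase m hε hk, MeasureTheory.integral_const_mul]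
    ring
  rw [h1, MeasureTheory.integral_const_mul,
    MeasureTheory.integral_integral_swap (integrable_uncurry_retarded m f hε)]
  congr 2
  ext t
  unfold retardedProfile
  rw [← MeasureTheory.integral_const_mul]
  congr 1; ext k; ring

lemma aestronglyMeasurable_retardedProfile (m : ℝ) (f : 𝓢(Momentum, ℂ)) :
    MeasureTheory.StronglyMeasurable (retardedProfile m f) := by
  have h1 := continuous_retardedPhase m
  have h2 : Continuous fun q : Momentum × ℝ => f q.1 := f.continuous.comp continuous_fst
  have h3 : Continuous fun q : ℝ × Momentum => f q.2 * retardedPhase m q.1 q.2 :=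
    (h2.mul h1).comp continuous_swap
  exact h3.stronglyMeasurable.integral_prod_right (f := fun t k => f k * retardedPhase m t k)

/-- The regularised integrals defining the retarded propagator converge as `ε ↓ 0`. -/
lemma tendsto_integral_mul_retardedKernel (m : ℝ) (f : 𝓢(Momentum, ℂ)) :
    Filter.Tendsto (fun ε : ℝ => ∫ k, f k * retardedKernel m ε k) (𝓝[>] 0)
      (𝓝 ((2 * Real.pi : ℂ)⁻¹ ^ 2 * ∫ t in Set.Ioi (0 : ℝ), retardedProfile m f t)) := by
  have h : Filter.Tendsto (fun ε : ℝ =>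
      ∫ t in Set.Ioi (0 : ℝ), Real.exp (-ε * t) * retardedProfile m f t) (𝓝[>] 0)
      (𝓝 (∫ t in Set.Ioi (0 : ℝ), retardedProfile m f t)) := by
    refine MeasureTheory.tendsto_integral_filter_of_dominated_convergence
      (fun t => 2 * retardedBound f * (1 + t ^ 2)⁻¹) ?_ ?_ ?_ ?_
    · refine .of_forall fun ε => ?_
      exact (Continuous.aestronglyMeasurable (by fun_prop)).mul
        (aestronglyMeasurable_retardedProfile m f).aestronglyMeasurable
    · filter_upwards [self_mem_nhdsWithin] with ε hε
      refine (MeasureTheory.ae_restrict_iff' measurableSet_Ioi).2 (.of_forall fun t ht => ?_)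
      have hε : 0 < ε := hε
      have ht : 0 < t := ht
      rw [norm_mul, Complex.norm_real, Real.norm_of_nonneg (Real.exp_pos _).le]
      refine (mul_le_of_le_one_left (norm_nonneg _) ?_).trans
        (norm_retardedProfile_le_inv m f ht.le)
      rw [Real.exp_le_one_iff]; nlinarith
    · exact (integrable_inv_one_add_sq.const_mul _).integrableOn
    · refine .of_forall fun t => ?_
      have hc : Continuous fun ε : ℝ => (Real.exp (-ε * t) : ℂ) * retardedProfile m f t := by
        fun_prop
      have := (hc.tendsto 0).mono_left (nhdsWithin_le_nhds (s := Set.Ioi 0))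
      simpa using this
  refine (h.const_mul _).congr' ?_
  filter_upwards [self_mem_nhdsWithin] with ε hε
  exact (integral_mul_retardedKernel m f hε).symm

lemma integrable_mul_retardedKernel (m : ℝ) (f : 𝓢(Momentum, ℂ)) {ε : ℝ} (hε : 0 < ε) :
    MeasureTheory.Integrable (fun k => f k * retardedKernel m ε k) := by
  have h := ((integrable_uncurry_retarded m f hε).integral_prod_left).const_mul
    ((2 * Real.pi : ℂ)⁻¹ ^ 2)
  refine h.congr ?_
  filter_upwards [ae_shellEnergy_ne_zero m] with k hk
  rw [← integral_retardedPhase m hε hk, MeasureTheory.integral_const_mul]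
  ring

/-- The linear functional `f ↦ lim_{ε ↓ 0} ∫ f(k) retardedKernel m ε k d⁴k`. -/
def retardedLinear (m : ℝ) : 𝓢(Momentum, ℂ) →ₗ[ℂ] ℂ where
  toFun f := Filter.limUnder (𝓝[>] (0 : ℝ)) fun ε => ∫ k, f k * retardedKernel m ε k
  map_add' f g := by
    refine Filter.Tendsto.limUnder_eq ?_
    have hf := tendsto_integral_mul_retardedKernel m f
    have hg := tendsto_integral_mul_retardedKernel m g
    rw [hf.limUnder_eq, hg.limUnder_eq]
    refine (hf.add hg).congr' ?_
    filter_upwards [self_mem_nhdsWithin] with ε hε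
    rw [← MeasureTheory.integral_add (integrable_mul_retardedKernel m f hε)
      (integrable_mul_retardedKernel m g hε)]
    simp only [add_apply, add_mul]
  map_smul' a f := by
    refine Filter.Tendsto.limUnder_eq ?_
    have hf := tendsto_integral_mul_retardedKernel m f
    rw [hf.limUnder_eq]
    refine (hf.const_mul a).congr fun ε => ?_
    rw [← MeasureTheory.integral_const_mul]
    simp only [smul_apply, smul_eq_mul, mul_assoc]

lemma norm_retardedLinear_le (m : ℝ) (f : 𝓢(Momentum, ℂ)) :
    ‖retardedLinear m f‖ ≤ ‖(2 * Real.pi : ℂ)⁻¹ ^ 2‖ *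
      ((∫ t in Set.Ioi (0 : ℝ), (1 + t ^ 2)⁻¹) * 2) * retardedBound f := by
  have h : retardedLinear m f = _ := (tendsto_integral_mul_retardedKernel m f).limUnder_eq
  rw [h, norm_mul, mul_assoc]
  refine mul_le_mul_of_nonneg_left ?_ (norm_nonneg _)
  have h2 := MeasureTheory.norm_integral_le_of_norm_le
    (μ := MeasureTheory.volume.restrict (Set.Ioi (0 : ℝ)))
    (f := retardedProfile m f) (g := fun t => 2 * retardedBound f * (1 + t ^ 2)⁻¹)
    (integrable_inv_one_add_sq.const_mul _).integrableOn
    ((MeasureTheory.ae_restrict_iff' measurableSet_Ioi).2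
      (.of_forall fun t ht => norm_retardedProfile_le_inv m f (le_of_lt ht)))
  rw [MeasureTheory.integral_const_mul] at h2
  linarith

lemma continuous_retardedBound : Continuous retardedBound := by
  have h1 : Continuous fun f : 𝓢(Momentum, ℂ) => ∫ k, ‖f k‖ := by
    have : Continuous fun f : 𝓢(Momentum, ℂ) => ‖f.toLp 1‖ := by
      exact continuous_norm.comp (SchwartzMap.toLpCLM ℂ ℂ 1 MeasureTheory.volume).continuous
    simpa only [SchwartzMap.norm_toLp_one] using this
  have hd : Continuous fun f : 𝓢(Momentum, ℂ) =>
      ∂_{EuclideanSpace.single (0 : Fin 4) (1 : ℝ)} f :=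
    (LineDeriv.lineDerivOpCLM ℂ 𝓢(Momentum, ℂ)
      (EuclideanSpace.single (0 : Fin 4) (1 : ℝ))).continuous
  exact h1.add (h1.comp (hd.comp (hd.comp hd)))

/-- The retarded propagator in momentum space: the tempered distribution
`Δ̂_R(k) = (2π)⁻² (2ω)⁻¹ ((k₀ + ω + i0)⁻¹ - (k₀ - ω + i0)⁻¹)`, the limit being taken after
integration against a Schwartz function. -/
def retardedHat (m : ℝ) : TemperedDist where
  toLinearMap := retardedLinear m
  cont := by
    refine continuous_of_continuousAt_zero (retardedLinear m) ?_
    have hz : retardedLinear m 0 = 0 := map_zero _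
    rw [ContinuousAt, hz]
    refine squeeze_zero_norm (norm_retardedLinear_le m) ?_
    have hc : Continuous fun f => ‖(2 * Real.pi : ℂ)⁻¹ ^ 2‖ *
      ((∫ t in Set.Ioi (0 : ℝ), (1 + t ^ 2)⁻¹) * 2) * retardedBound f :=
      continuous_const.mul continuous_retardedBound
    have := hc.tendsto 0
    simpa [retardedBound] using this

lemma tendsto_retardedHat (m : ℝ) (f : 𝓢(Momentum, ℂ)) :
    Filter.Tendsto (fun ε : ℝ => ∫ k, f k * retardedKernel m ε k) (𝓝[>] 0)
      (𝓝 (retardedHat m f)) := by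
  have h := tendsto_integral_mul_retardedKernel m f
  have h2 : retardedHat m f = _ := h.limUnder_eq
  rwa [h2]

/-! ### Translation and reflection -/

lemma hasTemperateGrowth_signedShift (s : ℤˣ) (k : Momentum) :
    Function.HasTemperateGrowth (fun l : Momentum => ((s : ℤ) : ℝ) • (l - k)) := by
  fun_prop

lemma antilipschitz_signedShift (s : ℤˣ) (k : Momentum) :
    AntilipschitzWith 1 (fun l : Momentum => ((s : ℤ) : ℝ) • (l - k)) := by
  refine AntilipschitzWith.of_le_mul_dist fun x y => ?_
  rcases Int.units_eq_one_or s with rfl | rfl <;> simp [dist_eq_norm, norm_sub_rev]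

/-- For a sign `s = ±1` and `u ∈ 𝓢'(ℝ⁴)`, the distribution `l ↦ u(k + s l)`, i.e. the
pull-back of `u` along `l ↦ k + s l`, whose inverse is `l ↦ s (l - k)`. -/
def signedShift (s : ℤˣ) (k : Momentum) (u : TemperedDist) : TemperedDist :=
  u ∘L SchwartzMap.compCLMOfAntilipschitz ℂ (hasTemperateGrowth_signedShift s k)
    (antilipschitz_signedShift s k)

/-! ### Wave front sets and products of distributions -/

lemma hasTemperateGrowth_circle :
    Function.HasTemperateGrowth (fun t : ℝ => (𝐞 (-t) : ℂ)) := by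
  have h : (fun t : ℝ => (𝐞 (-t) : ℂ)) =
      fun t : ℝ => Complex.exp ((-(2 * Real.pi) * Complex.I : ℂ) * t) := by
    ext t
    rw [Real.fourierChar_apply]
    congr 1
    push_cast
    ring
  have hd : ∀ (n : ℕ), iteratedDeriv n
      (fun t : ℝ => Complex.exp ((-(2 * Real.pi) * Complex.I : ℂ) * t)) =
      fun t : ℝ => (-(2 * Real.pi) * Complex.I : ℂ) ^ n *
        Complex.exp ((-(2 * Real.pi) * Complex.I : ℂ) * t) := by
    intro n
    induction n with
    | zero => simp
    | succ n ih =>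
      rw [iteratedDeriv_succ, ih]
      ext t
      have h1 : HasDerivAt (fun t : ℝ => (-(2 * Real.pi) * Complex.I : ℂ) * (t : ℂ))
          ((-(2 * Real.pi) * Complex.I : ℂ) * 1) t :=
        (Complex.ofRealCLM.hasDerivAt (x := t)).const_mul _
      rw [((h1.cexp).const_mul _).deriv]
      ring
  rw [h]
  refine ⟨(contDiff_const.mul Complex.ofRealCLM.contDiff).cexp, fun n => ⟨0, ‖(-(2 * Real.pi) * Complex.I : ℂ)‖ ^ n, fun t => ?_⟩⟩
  rw [norm_iteratedFDeriv_eq_norm_iteratedDeriv, hd, norm_mul, norm_pow, pow_zero,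
    show (-(2 * Real.pi) * Complex.I : ℂ) * t = ((-(2 * Real.pi) * t : ℝ) : ℂ) * Complex.I by
      push_cast; ring, Complex.norm_exp_ofReal_mul_I]

lemma hasTemperateGrowth_char (ξ : Momentum) :
    Function.HasTemperateGrowth (fun x : Momentum => (𝐞 (-inner ℝ x ξ) : ℂ)) :=
  hasTemperateGrowth_circle.comp (Function.hasTemperateGrowth_inner_left ξ)

/-- The Schwartz function `x ↦ e^{-2πi⟨x, ξ⟩} χ(x)`. -/
def modulate (ξ : Momentum) (χ : 𝓢(Momentum, ℂ)) : 𝓢(Momentum, ℂ) :=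
  SchwartzMap.smulLeftCLM ℂ (fun x : Momentum => (𝐞 (-inner ℝ x ξ) : ℂ)) χ

lemma modulate_apply (ξ : Momentum) (χ : 𝓢(Momentum, ℂ)) (x : Momentum) :
    modulate ξ χ x = (𝐞 (-inner ℝ x ξ) : ℂ) * χ x := by
  simp [modulate, SchwartzMap.smulLeftCLM_apply_apply (hasTemperateGrowth_char ξ)]

/-- The Fourier transform `ξ ↦ u(e^{-2πi⟨·, ξ⟩} χ)` of the localised distribution `χ u`. -/
def localFourier (u : TemperedDist) (χ : 𝓢(Momentum, ℂ)) (ξ : Momentum) : ℂ :=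
  u (modulate ξ χ)

/-- The wave front set of a distribution: `(x, ξ)` with `ξ ≠ 0` does *not* belong to it if and only
if there are a test function `χ` with compact support and `χ(x) ≠ 0`, and an open cone containing
`ξ` on which the Fourier transform of `χ u` is rapidly decreasing. Covectors are identified with
vectors by the Euclidean inner product. -/
def waveFrontSet (u : TemperedDist) : Set (Momentum × Momentum) :=
  {p | p.2 ≠ 0 ∧ ¬ ∃ χ : 𝓢(Momentum, ℂ), HasCompactSupport χ ∧ χ p.1 ≠ 0 ∧
    ∃ Γ : Set Momentum, IsOpen Γ ∧ p.2 ∈ Γ ∧ (∀ t : ℝ, 0 < t → ∀ ξ ∈ Γ, t • ξ ∈ Γ) ∧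
      ∀ N : ℕ, ∃ C : ℝ, ∀ ξ ∈ Γ, (1 + ‖ξ‖) ^ N * ‖localFourier u χ ξ‖ ≤ C}

/-- `w` is the product of `u` and `v` in the sense of Hörmander: the wave front sets of `u` and `v`
contain no opposite covectors over the same point, and locally the Fourier transform of `w` is the
convolution of those of `u` and `v`, given by an absolutely convergent integral: each point has a
neighbourhood `V` such that, for all test functions `χ` supported in `V`, the Fourier transform of
`χ² w = (χ u) (χ v)` is the convolution of the Fourier transforms of `χ u` and `χ v`. -/
def IsHormanderProduct (u v w : TemperedDist) : Prop :=
  (∀ x ξ : Momentum, (x, ξ) ∈ waveFrontSet u → (x, -ξ) ∉ waveFrontSet v) ∧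
  ∀ x : Momentum, ∃ V ∈ 𝓝 x, ∀ χ : 𝓢(Momentum, ℂ), HasCompactSupport χ → tsupport χ ⊆ V →
    ∀ ξ : Momentum,
      MeasureTheory.Integrable
        (fun η : Momentum => localFourier u χ η * localFourier v χ (ξ - η)) ∧
      localFourier w (SchwartzMap.smulLeftCLM ℂ χ χ) ξ =
        ∫ η : Momentum, localFourier u χ η * localFourier v χ (ξ - η)

/-! ### Smooth maps into the space of tempered distributions -/

/-- `P` is `n` times continuously differentiable on the open set `U`, as a map into a topological
vector space: it is continuous, and each directional derivative exists (as a limit of difference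
quotients in the topology of the target) and is `n - 1` times continuously differentiable. -/
def IsContDiffOn {F : Type*} [AddCommGroup F] [Module ℝ F] [TopologicalSpace F] :
    ℕ → (Momentum → F) → Set Momentum → Prop
  | 0, P, U => ContinuousOn P U
  | n + 1, P, U => ContinuousOn P U ∧ ∀ v : Momentum, ∃ P' : Momentum → F,
      (∀ k ∈ U, Filter.Tendsto (fun t : ℝ => t⁻¹ • (P (k + t • v) - P k)) (𝓝[≠] 0) (𝓝 (P' k))) ∧
      IsContDiffOn n P' U

end

/-!
Write `h(l) = (k + s l)² - m²` for the denominator of the shifted retarded propagator, with `k`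
replaced by `k + iε e₀`. The product of the two distributions is, up to a constant, the limit as
`ε ↓ 0` of the integral of `f / h` over the mass shell with respect to its invariant measure.

*Existence and smoothness of the limit.* The Lorentz fields `g_μ l_μ ∂_ν - g_ν l_ν ∂_μ` preserve the
invariant measure (`shellIntegral_lorentzField`). On the mass shell the squares of the derivatives
of `h` along these fields combine to `h² - 2k² h + k² (k² - 4m²)` (`sum_lorentzDenominator_sq`). So,
where `k²` is neither `0` nor `4m²`, an integration by parts bounds the integrals of `f φ'(h)` by
those of functions times `φ(h)` and `h φ'(h)` (`UniformlyBounded.of_primitive`). Starting with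
`φ(w) = w log(-w) - w`, whose integrals are bounded trivially, this gives bounds for the integrals
with `h⁻ʲ`, for every `j`, by a continuous seminorm of `f`, uniformly for `k` near a given point and
for small `ε > 0` (`uniformlyBounded_inv_pow`). Differentiation in `k` or `ε` replaces `h⁻ʲ` by
`h⁻ʲ⁻¹` times a polynomial; hence the integrals are Lipschitz in `ε`, their limits
(`resolvedShell`) exist, and a Taylor expansion uniform in `ε` shows that the limits depend smoothly
on `k` in the strong topology (`isContDiffOn_resolvedShell`).

*Wave front sets.* If a vector field annihilates a functional, then repeated integration by parts
shows that the localised Fourier transform of the functional decays rapidly in each direction in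
which the symbol of the field is nonzero (`rapidDecay_of_symbol`). The boosts annihilate the
invariant measure of the mass shell; the boosts around `-s k` and the fields `h ∂_ν` annihilate the
integral against `1 / h`, and the bounds for the latter are uniform in `ε`. If none of these fields
yields decay of the first factor in the direction `ζ` at `x`, or of the second one in the direction
`-ζ`, then `x` and `k + s x` are linearly dependent vectors with Minkowski square `m²`, which forces
`k² ∈ {0, 4m²}` (`rapidDecay_or`).

*The convolution.* By compactness of the unit sphere, the products of the two localised Fourier
transforms are dominated by an integrable function, uniformly in `ε` (`exists_convolution_bound`).
For `ε > 0` the factor `1 / h` is smooth and the convolution formula is Fourier inversion; dominated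
convergence carries it to the limit (`isHormanderProduct_shellProduct`). Uniqueness holds because a
distribution annihilating the squares of all test functions of small support vanishes, by
polarisation and localisation (`eq_zero_of_locally_annihilates_squares`).
-/

noncomputable section

/-! ### Test functions: multiplication, density, localisation -/

/-- Pointwise multiplication by a Schwartz function. -/
lemma smulLeftCLM_schwartz_apply (χ f : 𝓢(Momentum, ℂ)) (x : Momentum) :
    SchwartzMap.smulLeftCLM ℂ χ f x = χ x * f x := by
  simp [SchwartzMap.smulLeftCLM_apply_apply χ.hasTemperateGrowth]

/-- The smooth bump function `B` as a complex-valued Schwartz function. -/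
def bumpSchwartz {c : Momentum} (B : ContDiffBump c) : 𝓢(Momentum, ℂ) :=
  HasCompactSupport.toSchwartzMap (f := fun x => ((B x : ℝ) : ℂ))
    (B.hasCompactSupport.comp_left Complex.ofReal_zero)
    (Complex.ofRealCLM.contDiff.comp B.contDiff)

lemma bumpSchwartz_apply {c : Momentum} (B : ContDiffBump c) (x : Momentum) :
    bumpSchwartz B x = ((B x : ℝ) : ℂ) := rfl

lemma hasCompactSupport_bumpSchwartz {c : Momentum} (B : ContDiffBump c) :
    HasCompactSupport (bumpSchwartz B) :=
  B.hasCompactSupport.comp_left (g := Complex.ofReal) Complex.ofReal_zero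

lemma tsupport_bumpSchwartz_subset {c : Momentum} (B : ContDiffBump c) :
    tsupport (bumpSchwartz B) ⊆ Metric.closedBall c B.rOut :=
  (tsupport_comp_subset (g := Complex.ofReal) Complex.ofReal_zero B).trans B.tsupport_eq.subset

/-- The derivatives of a dilate of a Schwartz function by a factor in `[0, 1]` are bounded
independently of the factor. -/
lemma norm_iteratedFDeriv_dilate_le (Θ : 𝓢(Momentum, ℂ)) {a : ℝ} (ha : 0 ≤ a) (ha1 : a ≤ 1)
    (i : ℕ) (x : Momentum) :
    ‖iteratedFDeriv ℝ i (fun y => Θ (a • y)) x‖ ≤ SchwartzMap.seminorm ℝ 0 i Θ := by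
  rw [iteratedFDeriv_comp_const_smul (i := i) a (Θ.smooth i)]
  rw [norm_smul, norm_pow, Real.norm_of_nonneg ha]
  exact (mul_le_of_le_one_left (norm_nonneg _) (pow_le_one₀ ha ha1)).trans
    (SchwartzMap.norm_iteratedFDeriv_le_seminorm ℝ Θ i _)

/-- Schwartz functions of compact support are sequentially dense: the functions `Θ(x / n) f(x)`,
with `Θ` a cutoff function, converge to `f`. -/
lemma exists_tendsto_hasCompactSupport (f : 𝓢(Momentum, ℂ)) :
    ∃ F : ℕ → 𝓢(Momentum, ℂ), (∀ n, HasCompactSupport (F n)) ∧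
      Filter.Tendsto F Filter.atTop (𝓝 f) := by
  set B : ContDiffBump (0 : Momentum) := ⟨1, 2, one_pos, one_lt_two⟩ with hB
  set Θ := bumpSchwartz B with hΘ
  have hpos : ∀ n : ℕ, 0 < ((n : ℝ) + 1)⁻¹ := fun n => by positivity
  have hle : ∀ n : ℕ, ((n : ℝ) + 1)⁻¹ ≤ 1 := fun n =>
    inv_le_one_of_one_le₀ (by linarith [(Nat.cast_nonneg n : (0 : ℝ) ≤ n)])
  have hcs : ∀ n : ℕ, HasCompactSupport (fun y : Momentum => Θ (((n : ℝ) + 1)⁻¹ • y)) := fun n =>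
    (hasCompactSupport_bumpSchwartz B).comp_smul (hpos n).ne'
  have hsm : ∀ n : ℕ, ContDiff ℝ (⊤ : ℕ∞) (fun y : Momentum => Θ (((n : ℝ) + 1)⁻¹ • y)) :=
    fun n => (Θ.smooth ⊤).comp (contDiff_const_smul _)
  set T : ℕ → 𝓢(Momentum, ℂ) := fun n => (hcs n).toSchwartzMap (hsm n) with hT
  refine ⟨fun n => SchwartzMap.smulLeftCLM ℂ (T n) f, fun n => ?_, ?_⟩
  · have : ⇑(SchwartzMap.smulLeftCLM ℂ (T n) f) = fun x => T n x * f x :=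
      funext fun x => smulLeftCLM_schwartz_apply _ _ _
    rw [this]
    exact (hcs n).mul_right
  · rw [(schwartz_withSeminorms ℝ Momentum ℂ).tendsto_nhds]
    rintro ⟨k, j⟩ ε hε
    set C : ℝ := SchwartzMap.seminorm ℝ (k + 1) j f + ∑ i ∈ Finset.range (j + 1),
      (j.choose i : ℝ) * SchwartzMap.seminorm ℝ 0 i Θ * SchwartzMap.seminorm ℝ (k + 1) (j - i) f
      with hC
    have hC0 : 0 ≤ C := add_nonneg (apply_nonneg _ _) (Finset.sum_nonneg fun i _ =>
      mul_nonneg (mul_nonneg (Nat.cast_nonneg _) (apply_nonneg _ _)) (apply_nonneg _ _))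
    have hlim : Filter.Tendsto (fun n : ℕ => ((n : ℝ) + 1)⁻¹ * C) Filter.atTop (𝓝 0) := by
      have := tendsto_one_div_add_atTop_nhds_zero_nat (𝕜 := ℝ)
      simpa using this.mul_const C
    filter_upwards [hlim.eventually (gt_mem_nhds hε)] with n hn
    refine lt_of_le_of_lt ?_ hn
    change SchwartzMap.seminorm ℝ k j _ ≤ _
    refine SchwartzMap.seminorm_le_bound ℝ k j _ (mul_nonneg (hpos n).le hC0) fun x => ?_
    have hcoe : ⇑(SchwartzMap.smulLeftCLM ℂ (T n) f - f) =
        fun y => Θ (((n : ℝ) + 1)⁻¹ • y) * f y - f y := by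
      funext y
      rw [sub_apply, smulLeftCLM_schwartz_apply]
      rfl
    rw [hcoe]
    rcases lt_or_ge ‖x‖ ((n : ℝ) + 1) with hx | hx
    · -- near such `x` the cutoff equals `1`
      have hz : (fun y => Θ (((n : ℝ) + 1)⁻¹ • y) * f y - f y) =ᶠ[𝓝 x] fun _ => 0 := by
        filter_upwards [continuous_norm.continuousAt.eventually (gt_mem_nhds hx)] with y hy
        have h1 : Θ (((n : ℝ) + 1)⁻¹ • y) = 1 := by
          rw [hΘ, bumpSchwartz_apply, B.one_of_mem_closedBall, Complex.ofReal_one]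
          rw [mem_closedBall_zero_iff, norm_smul, Real.norm_of_nonneg (hpos n).le,
            inv_mul_le_iff₀ (by positivity)]
          simpa [hB] using hy.le
        rw [h1, one_mul, sub_self]
      rw [(hz.iteratedFDeriv ℝ j).eq_of_nhds]
      have : iteratedFDeriv ℝ j (fun _ : Momentum => (0 : ℂ)) x = 0 := by
        simp
      rw [this, norm_zero, mul_zero]
      exact mul_nonneg (hpos n).le hC0
    · have hd1 : iteratedFDeriv ℝ j (fun y => Θ (((n : ℝ) + 1)⁻¹ • y) * f y - f y) x =
          iteratedFDeriv ℝ j (fun y => Θ (((n : ℝ) + 1)⁻¹ • y) * f y) x -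
            iteratedFDeriv ℝ j f x := by
        have h1 : ContDiff ℝ j (fun y => Θ (((n : ℝ) + 1)⁻¹ • y) * f y) :=
          ((hsm n).of_le (mod_cast le_top)).mul (f.smooth j)
        exact iteratedFDeriv_sub_apply h1.contDiffAt (f.smooth j).contDiffAt
      have hx0 : (0 : ℝ) < n + 1 := by positivity
      have key : ∀ i, ‖x‖ ^ k * ‖iteratedFDeriv ℝ i f x‖ ≤
          ((n : ℝ) + 1)⁻¹ * SchwartzMap.seminorm ℝ (k + 1) i f := by
        intro i
        rw [le_inv_mul_iff₀ hx0]
        refine le_trans ?_ (SchwartzMap.le_seminorm ℝ (k + 1) i f x)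
        rw [pow_succ, ← mul_assoc, mul_comm ((n : ℝ) + 1), mul_assoc, mul_assoc]
        refine mul_le_mul_of_nonneg_left ?_ (by positivity)
        exact mul_le_mul_of_nonneg_right hx (norm_nonneg _)
      have hmul := norm_iteratedFDeriv_mul_le (n := j) (N := ((⊤ : ℕ∞) : WithTop ℕ∞))
        (hsm n) (f.smooth ⊤) (x := x)
        (mod_cast le_top)
      rw [hd1]
      calc ‖x‖ ^ k * ‖iteratedFDeriv ℝ j (fun y => Θ (((n : ℝ) + 1)⁻¹ • y) * f y) x -
            iteratedFDeriv ℝ j f x‖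
          ≤ ‖x‖ ^ k * (‖iteratedFDeriv ℝ j f x‖ + ∑ i ∈ Finset.range (j + 1), (j.choose i : ℝ) *
            ‖iteratedFDeriv ℝ i (fun y => Θ (((n : ℝ) + 1)⁻¹ • y)) x‖ *
              ‖iteratedFDeriv ℝ (j - i) f x‖) := by
            refine mul_le_mul_of_nonneg_left ?_ (by positivity)
            exact (norm_sub_le _ _).trans ((add_le_add_left hmul _).trans (add_comm _ _).le)
        _ = ‖x‖ ^ k * ‖iteratedFDeriv ℝ j f x‖ + ∑ i ∈ Finset.range (j + 1), (j.choose i : ℝ) *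
            ‖iteratedFDeriv ℝ i (fun y => Θ (((n : ℝ) + 1)⁻¹ • y)) x‖ *
              (‖x‖ ^ k * ‖iteratedFDeriv ℝ (j - i) f x‖) := by
            rw [mul_add, Finset.mul_sum]
            congr 1
            exact Finset.sum_congr rfl fun i _ => by ring
        _ ≤ ((n : ℝ) + 1)⁻¹ * SchwartzMap.seminorm ℝ (k + 1) j f +
            ∑ i ∈ Finset.range (j + 1), (j.choose i : ℝ) * SchwartzMap.seminorm ℝ 0 i Θ *
              (((n : ℝ) + 1)⁻¹ * SchwartzMap.seminorm ℝ (k + 1) (j - i) f) := by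
            refine add_le_add (key j) (Finset.sum_le_sum fun i _ => ?_)
            refine mul_le_mul (mul_le_mul_of_nonneg_left ?_ (Nat.cast_nonneg _)) (key _)
              (by positivity) (mul_nonneg (Nat.cast_nonneg _) (apply_nonneg _ _))
            exact norm_iteratedFDeriv_dilate_le Θ (hpos n).le (hle n) i x
        _ = ((n : ℝ) + 1)⁻¹ * C := by
            rw [hC, mul_add, Finset.mul_sum]
            congr 1
            exact Finset.sum_congr rfl fun i _ => by ring

/-- A continuous functional which vanishes on compactly supported functions vanishes. -/
lemma eq_zero_of_forall_hasCompactSupport {d : TemperedDist}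
    (h : ∀ f : 𝓢(Momentum, ℂ), HasCompactSupport f → d f = 0) : d = 0 := by
  ext f
  obtain ⟨F, hF, hlim⟩ := exists_tendsto_hasCompactSupport f
  have h1 := (d.continuous.tendsto f).comp hlim
  have h2 : (fun n => d (F n)) = fun _ => 0 := funext fun n => h _ (hF n)
  exact tendsto_nhds_unique h1 (by simp [Function.comp_def, h2])

/-- A distribution which near each point annihilates all squares of test functions vanishes: by
polarisation it annihilates `χ₁ χ₂`, hence every test function of small support, and a finite
family of bump functions passes from small supports to compact ones. -/
lemma eq_zero_of_locally_annihilates_squares {d : TemperedDist}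
    (h : ∀ x : Momentum, ∃ V ∈ 𝓝 x, ∀ χ : 𝓢(Momentum, ℂ), HasCompactSupport χ →
      tsupport χ ⊆ V → d (SchwartzMap.smulLeftCLM ℂ χ χ) = 0) : d = 0 := by
  have hloc : ∀ x : Momentum, ∃ B : ContDiffBump x, ∀ g : 𝓢(Momentum, ℂ),
      d (SchwartzMap.smulLeftCLM ℂ (bumpSchwartz B) g) = 0 := by
    intro x
    obtain ⟨V, hV, hd⟩ := h x
    obtain ⟨r, hr, hrV⟩ := Metric.nhds_basis_closedBall.mem_iff.1 hV
    set B : ContDiffBump x := ⟨r / 4, r / 2, by positivity, by linarith⟩ with hB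
    set B' : ContDiffBump x := ⟨r / 2, r, by positivity, by linarith⟩ with hB'
    refine ⟨B, fun g => ?_⟩
    set χ₁ := SchwartzMap.smulLeftCLM ℂ (bumpSchwartz B) g with hχ₁
    set χ₂ := bumpSchwartz B' with hχ₂
    have hcoe : ⇑χ₁ = fun y => bumpSchwartz B y * g y :=
      funext fun y => smulLeftCLM_schwartz_apply _ _ _
    have hc₁ : HasCompactSupport χ₁ := by
      rw [hcoe]; exact (hasCompactSupport_bumpSchwartz B).mul_right
    have hc₂ : HasCompactSupport χ₂ := hasCompactSupport_bumpSchwartz B'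
    have ht₁ : tsupport χ₁ ⊆ V := by
      rw [hcoe]
      refine (tsupport_mul_subset_left).trans ((tsupport_bumpSchwartz_subset B).trans
        ((Metric.closedBall_subset_closedBall ?_).trans hrV))
      simp only [hB]; linarith
    have ht₂ : tsupport χ₂ ⊆ V := (tsupport_bumpSchwartz_subset B').trans hrV
    have h₁₂ := hd (χ₁ + χ₂) (by simpa using hc₁.add hc₂) (by
      have : tsupport (⇑(χ₁ + χ₂)) ⊆ tsupport χ₁ ∪ tsupport χ₂ := by
        rw [show ⇑(χ₁ + χ₂) = ⇑χ₁ + ⇑χ₂ from funext fun y => add_apply χ₁ χ₂ y]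
        exact tsupport_add _ _
      exact this.trans (Set.union_subset ht₁ ht₂))
    have hprod : χ₁ = SchwartzMap.smulLeftCLM ℂ χ₁ χ₂ := by
      ext y
      rw [smulLeftCLM_schwartz_apply χ₁ χ₂ y, congrFun hcoe y]
      by_cases hy : y ∈ Metric.closedBall x (r / 2)
      · have : χ₂ y = 1 := by
          rw [hχ₂, bumpSchwartz_apply, B'.one_of_mem_closedBall hy, Complex.ofReal_one]
        rw [this, mul_one]
      · have : bumpSchwartz B y = 0 := by
          rw [bumpSchwartz_apply, B.zero_of_le_dist, Complex.ofReal_zero]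
          rw [Metric.mem_closedBall, not_le] at hy
          exact hy.le
        rw [this, zero_mul, zero_mul]
    have hexp : SchwartzMap.smulLeftCLM ℂ (⇑(χ₁ + χ₂)) (χ₁ + χ₂) =
        SchwartzMap.smulLeftCLM ℂ χ₁ χ₁ + SchwartzMap.smulLeftCLM ℂ χ₂ χ₂ + (χ₁ + χ₁) := by
      nth_rewrite 5 6 [hprod]
      ext y
      simp only [smulLeftCLM_schwartz_apply, add_apply]
      ring
    rw [hexp, map_add, map_add, hd χ₁ hc₁ ht₁, hd χ₂ hc₂ ht₂, map_add, zero_add, zero_add,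
      ← two_mul] at h₁₂
    simpa using h₁₂
  refine eq_zero_of_forall_hasCompactSupport fun f hf => ?_
  choose B hBd using hloc
  obtain ⟨t, -, ht⟩ := (show IsCompact (tsupport f) from hf).elim_nhds_subcover
    (fun x => Metric.ball x (B x).rIn)
    (fun x _ => Metric.ball_mem_nhds x (B x).rIn_pos)
  have hind : ∀ t : Finset Momentum, ∃ g : 𝓢(Momentum, ℂ),
      (∀ y, g y = f y * ∏ x ∈ t, (1 - bumpSchwartz (B x) y)) ∧ d g = d f := by
    classical
    intro t
    induction t using Finset.induction_on with
    | empty => exact ⟨f, by simp, rfl⟩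
    | insert x t hx ih =>
      obtain ⟨g, hg, hdg⟩ := ih
      refine ⟨g - SchwartzMap.smulLeftCLM ℂ (bumpSchwartz (B x)) g, fun y => ?_, ?_⟩
      · rw [sub_apply, smulLeftCLM_schwartz_apply, hg, Finset.prod_insert hx]
        ring
      · rw [map_sub, hBd, sub_zero, hdg]
  obtain ⟨g, hg, hdg⟩ := hind t
  have hg0 : g = 0 := by
    ext y
    rw [hg, zero_apply]
    by_cases hy : y ∈ tsupport f
    · obtain ⟨x, hx, hyx⟩ := Set.mem_iUnion₂.1 (ht hy)
      rw [Finset.prod_eq_zero hx, mul_zero]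
      rw [bumpSchwartz_apply, (B x).one_of_mem_closedBall (Metric.ball_subset_closedBall hyx)]
      simp
    · rw [image_eq_zero_of_notMem_tsupport hy, zero_mul]
  rw [← hdg, hg0, map_zero]

/-- The product in the sense of Hörmander is unique. -/
lemma IsHormanderProduct.unique {u v w w' : TemperedDist} (h : IsHormanderProduct u v w)
    (h' : IsHormanderProduct u v w') : w = w' := by
  rw [← sub_eq_zero]
  refine eq_zero_of_locally_annihilates_squares fun x => ?_
  obtain ⟨V, hV, hw⟩ := h.2 x
  obtain ⟨V', hV', hw'⟩ := h'.2 x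
  refine ⟨V ∩ V', Filter.inter_mem hV hV', fun χ hχ hs => ?_⟩
  have h1 := (hw χ hχ (hs.trans Set.inter_subset_left) 0).2
  have h2 := (hw' χ hχ (hs.trans Set.inter_subset_right) 0).2
  have hm : modulate 0 (SchwartzMap.smulLeftCLM ℂ χ χ) = SchwartzMap.smulLeftCLM ℂ χ χ := by
    ext y
    simp [modulate_apply]
  rw [localFourier, hm] at h1 h2
  rw [sub_apply, h1, h2, sub_self]

/-! ### The strong topology and smooth maps -/

/-- Convergence in the strong topology follows from a bound by one continuous seminorm with a
factor tending to zero. -/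
lemma tendsto_temperedDist_of_norm_le {ι : Type*} {l : Filter ι} {T : ι → TemperedDist}
    {T₀ : TemperedDist} {p : Seminorm ℂ 𝓢(Momentum, ℂ)} (hp : Continuous p) {δ : ι → ℝ}
    (hδ : Filter.Tendsto δ l (𝓝 0)) (h : ∀ᶠ i in l, ∀ f, ‖T i f - T₀ f‖ ≤ δ i * p f) :
    Filter.Tendsto T l (𝓝 T₀) := by
  rw [← tendsto_sub_nhds_zero_iff, (ContinuousLinearMap.hasBasis_nhds_zero_of_basis
    Metric.nhds_basis_ball).tendsto_right_iff]
  rintro ⟨S, ε⟩ ⟨hS, hε⟩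
  have hball : p.ball 0 1 ∈ 𝓝 (0 : 𝓢(Momentum, ℂ)) := by
    rw [Seminorm.ball_zero_eq]
    exact (isOpen_lt hp continuous_const).mem_nhds (by simp)
  obtain ⟨r, hr, hrS⟩ := (hS hball).exists_pos
  have hbd : ∀ f ∈ S, p f ≤ r := by
    intro f hf
    obtain ⟨g, hg, rfl⟩ := hrS (r : ℂ) (by simp [abs_of_pos hr]) hf
    rw [Seminorm.mem_ball_zero] at hg
    simp only [map_smul_eq_mul, Complex.norm_real, Real.norm_of_nonneg hr.le]
    nlinarith
  have h1 : ∀ᶠ i in l, |δ i| * r < ε := by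
    have := (hδ.abs.mul_const r)
    rw [abs_zero, zero_mul] at this
    exact this.eventually (gt_mem_nhds hε)
  filter_upwards [h, h1] with i hi hi1 f hf
  rw [mem_ball_zero_iff]
  refine lt_of_le_of_lt (hi f) (lt_of_le_of_lt ?_ hi1)
  exact mul_le_mul (le_abs_self _) (hbd f hf) (apply_nonneg _ _) (abs_nonneg _)

/-- Real scalars act on distributions through complex ones. -/
instance continuousSMul_real_temperedDist : ContinuousSMul ℝ TemperedDist where
  continuous_smul := by
    have h : Continuous fun q : ℝ × TemperedDist => (q.1 : ℂ) • q.2 :=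
      (Complex.continuous_ofReal.comp continuous_fst).smul continuous_snd
    exact h

section ContDiffOn

variable {F : Type*} [AddCommGroup F] [Module ℝ F] [TopologicalSpace F]

lemma IsContDiffOn.of_succ {n : ℕ} {P : Momentum → F} {U : Set Momentum}
    (h : IsContDiffOn (n + 1) P U) : IsContDiffOn n P U := by
  induction n generalizing P with
  | zero => exact h.1
  | succ n ih =>
    refine ⟨h.1, fun v => ?_⟩
    obtain ⟨P', hP', hP'n⟩ := h.2 v
    exact ⟨P', hP', ih hP'n⟩

lemma IsContDiffOn.add [ContinuousAdd F] {n : ℕ} {P Q : Momentum → F} {U : Set Momentum}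
    (hP : IsContDiffOn n P U) (hQ : IsContDiffOn n Q U) :
    IsContDiffOn n (fun k => P k + Q k) U := by
  induction n generalizing P Q with
  | zero => exact ContinuousOn.add hP hQ
  | succ n ih =>
    refine ⟨hP.1.add hQ.1, fun v => ?_⟩
    obtain ⟨P', hP', hP'n⟩ := hP.2 v
    obtain ⟨Q', hQ', hQ'n⟩ := hQ.2 v
    refine ⟨fun k => P' k + Q' k, fun k hk => ?_, ih hP'n hQ'n⟩
    refine ((hP' k hk).add (hQ' k hk)).congr fun t => ?_
    rw [← smul_add, add_sub_add_comm]

lemma IsContDiffOn.const_smul [ContinuousSMul ℝ F] (c : ℝ) {n : ℕ} {P : Momentum → F}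
    {U : Set Momentum} (hP : IsContDiffOn n P U) : IsContDiffOn n (fun k => c • P k) U := by
  induction n generalizing P with
  | zero => exact ContinuousOn.const_smul (g := P) hP c
  | succ n ih =>
    refine ⟨hP.1.const_smul c, fun v => ?_⟩
    obtain ⟨P', hP', hP'n⟩ := hP.2 v
    refine ⟨fun k => c • P' k, fun k hk => ?_, ih hP'n⟩
    refine ((hP' k hk).const_smul c).congr fun t => ?_
    rw [smul_comm, smul_sub]

lemma IsContDiffOn.coord_smul [ContinuousAdd F] [ContinuousSMul ℝ F] (μ : Fin 4) {n : ℕ}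
    {P : Momentum → F} {U : Set Momentum} (hU : IsOpen U) (hP : IsContDiffOn n P U) :
    IsContDiffOn n (fun k => k μ • P k) U := by
  have hc : Continuous fun k : Momentum => k μ := by fun_prop
  induction n generalizing P with
  | zero => exact hc.continuousOn.smul hP
  | succ n ih =>
    refine ⟨hc.continuousOn.smul hP.1, fun v => ?_⟩
    obtain ⟨P', hP', hP'n⟩ := hP.2 v
    refine ⟨fun k => v μ • P k + k μ • P' k, fun k hk => ?_,
      (hP.of_succ.const_smul (v μ)).add (ih hP'n)⟩
    have hline : Filter.Tendsto (fun t : ℝ => k + t • v) (𝓝[≠] 0) (𝓝 k) := by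
      have : Continuous fun t : ℝ => k + t • v := by fun_prop
      simpa using (this.tendsto 0).mono_left (nhdsWithin_le_nhds (s := {0}ᶜ))
    have h1 : Filter.Tendsto (fun t : ℝ => P (k + t • v)) (𝓝[≠] 0) (𝓝 (P k)) :=
      ((hP.1.continuousAt (hU.mem_nhds hk)).tendsto).comp hline
    refine ((h1.const_smul (v μ)).add ((hP' k hk).const_smul (k μ))).congr' ?_
    filter_upwards [self_mem_nhdsWithin] with t ht
    have ht : t ≠ 0 := ht
    have e : (k + t • v) μ = k μ + t * v μ := by simp
    rw [e, add_smul, smul_sub, smul_sub, smul_sub, smul_add, mul_smul, inv_smul_smul₀ ht,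
      smul_comm (k μ) t⁻¹, smul_comm (k μ) t⁻¹]
    abel

lemma IsContDiffOn.sum [ContinuousAdd F] {ι : Type*} (t : Finset ι) (ht : t.Nonempty) {n : ℕ}
    {P : ι → Momentum → F} {U : Set Momentum} (hP : ∀ i ∈ t, IsContDiffOn n (P i) U) :
    IsContDiffOn n (fun k => ∑ i ∈ t, P i k) U := by
  classical
  induction ht using Finset.Nonempty.cons_induction with
  | singleton i => simpa using hP i (by simp)
  | cons i t hi ht ih =>
    simp only [Finset.sum_cons]
    exact (hP i (by simp)).add (ih fun j hj => hP j (by simp [hj]))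

end ContDiffOn

/-! ### The mass shell and its Lorentz invariance -/

/-- The diagonal entries `1, -1, -1, -1` of the Minkowski metric. -/
def metricSign : Fin 4 → ℝ := Fin.cons 1 fun _ => -1

@[simp] lemma metricSign_zero : metricSign 0 = 1 := rfl

@[simp] lemma metricSign_succ (i : Fin 3) : metricSign i.succ = -1 := rfl

lemma norm_metricSign (μ : Fin 4) : ‖(metricSign μ : ℂ)‖ = 1 := by
  refine Fin.cases ?_ (fun i => ?_) μ <;> simp

lemma norm_ofReal_of_sq_eq_one {σ : ℝ} (hσ : σ ^ 2 = 1) : ‖(σ : ℂ)‖ = 1 := by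
  rw [Complex.norm_real, Real.norm_eq_abs, ← sq_eq_sq₀ (abs_nonneg _) zero_le_one, sq_abs, hσ,
    one_pow]

/-- Multiplication of Schwartz functions by the coordinate `l μ`. -/
def coordMul (μ : Fin 4) : 𝓢(Momentum, ℂ) →L[ℂ] 𝓢(Momentum, ℂ) :=
  SchwartzMap.smulLeftCLM ℂ (fun l : Momentum => ((l μ : ℝ) : ℂ))

/-- The partial derivative of Schwartz functions in the direction of the coordinate `l μ`. -/
def partialD (μ : Fin 4) : 𝓢(Momentum, ℂ) →L[ℂ] 𝓢(Momentum, ℂ) :=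
  LineDeriv.lineDerivOpCLM ℂ 𝓢(Momentum, ℂ) (EuclideanSpace.single μ (1 : ℝ))

/-- The generator `g_μ l_μ ∂_ν - g_ν l_ν ∂_μ` of the Lorentz group, acting on Schwartz
functions. -/
def lorentzField (μ ν : Fin 4) : 𝓢(Momentum, ℂ) →L[ℂ] 𝓢(Momentum, ℂ) :=
  (metricSign μ : ℂ) • (coordMul μ ∘L partialD ν) - (metricSign ν : ℂ) • (coordMul ν ∘L partialD μ)

/-- The integral of `F` against the invariant measure `d³p / (2 ω_p)` on the mass shell. -/
def shellIntegral (m : ℝ) (F : Momentum → ℂ) : ℂ :=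
  ∫ p : EuclideanSpace ℝ (Fin 3), F (onShell m p) / (2 * shellEnergy m p : ℝ)

lemma twoPointHat_apply (m : ℝ) (f : 𝓢(Momentum, ℂ)) :
    twoPointHat m f = (2 * Real.pi : ℂ)⁻¹ * shellIntegral m f := rfl

lemma coordMul_apply (μ : Fin 4) (f : 𝓢(Momentum, ℂ)) (l : Momentum) :
    coordMul μ f l = (l μ : ℂ) * f l := by
  have h : Function.HasTemperateGrowth (fun l : Momentum => ((l μ : ℝ) : ℂ)) :=
    (Complex.ofRealCLM.comp (EuclideanSpace.proj μ : Momentum →L[ℝ] ℝ)).hasTemperateGrowth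
  simp [coordMul, SchwartzMap.smulLeftCLM_apply_apply h]

lemma partialD_apply (μ : Fin 4) (f : 𝓢(Momentum, ℂ)) (l : Momentum) :
    partialD μ f l = fderiv ℝ f l (EuclideanSpace.single μ (1 : ℝ)) := by
  simp [partialD, SchwartzMap.lineDerivOp_apply_eq_fderiv]

lemma lorentzField_apply (μ ν : Fin 4) (f : 𝓢(Momentum, ℂ)) (l : Momentum) :
    lorentzField μ ν f l = metricSign μ * (l μ * partialD ν f l) -
      metricSign ν * (l ν * partialD μ f l) := by
  simp [lorentzField, coordMul_apply]

lemma partialD_coordMul (μ ν : Fin 4) (f : 𝓢(Momentum, ℂ)) :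
    partialD ν (coordMul μ f) = (if μ = ν then f else 0) + coordMul μ (partialD ν f) := by
  ext l
  have h1 : HasFDerivAt (fun l : Momentum => ((l μ : ℝ) : ℂ))
      (Complex.ofRealCLM.comp (EuclideanSpace.proj μ : Momentum →L[ℝ] ℝ)) l :=
    (Complex.ofRealCLM.comp (EuclideanSpace.proj μ : Momentum →L[ℝ] ℝ)).hasFDerivAt
  have h2 : ⇑(coordMul μ f) = fun l => (l μ : ℂ) * f l := funext fun l => coordMul_apply μ f l
  rw [partialD_apply, h2, (h1.fun_mul (f.hasFDerivAt l)).fderiv]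
  simp only [add_apply, coordMul_apply, partialD_apply, FunLike.coe_smul, Pi.smul_apply,
    ContinuousLinearMap.comp_apply, Complex.ofRealCLM_apply, PiLp.proj_apply, smul_eq_mul]
  rw [add_comm]
  congr 1
  by_cases h : μ = ν <;> simp [h]

lemma partialD_comm (μ ν : Fin 4) (f : 𝓢(Momentum, ℂ)) :
    partialD μ (partialD ν f) = partialD ν (partialD μ f) := by
  ext l
  have hc : ∀ μ ν : Fin 4, partialD μ (partialD ν f) l =
      fderiv ℝ (fderiv ℝ f) l (EuclideanSpace.single μ (1 : ℝ))
        (EuclideanSpace.single ν (1 : ℝ)) := by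
    intro μ ν
    have h1 : ⇑(partialD ν f) = fun l => fderiv ℝ f l (EuclideanSpace.single ν (1 : ℝ)) :=
      funext fun l => partialD_apply ν f l
    have h2 : DifferentiableAt ℝ (fderiv ℝ f) l :=
      ((f.smooth 2).fderiv_right (m := 1) (by norm_num)).differentiable (by norm_num) l
    rw [partialD_apply, h1, fderiv_clm_apply h2 (differentiableAt_const _)]
    simp
  rw [hc, hc]
  exact ((f.smooth 2).contDiffAt.isSymmSndFDerivAt (by simp)) _ _

lemma onShell_zero (m : ℝ) (p : EuclideanSpace ℝ (Fin 3)) : onShell m p 0 = shellEnergy m p := rfl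

lemma onShell_succ (m : ℝ) (p : EuclideanSpace ℝ (Fin 3)) (i : Fin 3) :
    onShell m p i.succ = p i := rfl

lemma integrable_shell (m : ℝ) (f : 𝓢(Momentum, ℂ)) : MeasureTheory.Integrable
    (fun p : EuclideanSpace ℝ (Fin 3) => f (onShell m p) / (2 * shellEnergy m p : ℝ)) :=
  integrable_twoPoint_integrand m f

lemma shellIntegral_add (m : ℝ) (f g : 𝓢(Momentum, ℂ)) :
    shellIntegral m (⇑(f + g)) = shellIntegral m f + shellIntegral m g := by
  unfold shellIntegral
  rw [← MeasureTheory.integral_add (integrable_shell m f) (integrable_shell m g)]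
  simp only [add_apply, add_div]

lemma shellEnergy_pos_of_mass {m : ℝ} (hm : 0 < m) (p : EuclideanSpace ℝ (Fin 3)) :
    0 < shellEnergy m p := Real.sqrt_pos.2 (by positivity)

lemma shellEnergy_pos_of_ne_zero (m : ℝ) {p : EuclideanSpace ℝ (Fin 3)} (hp : p ≠ 0) :
    0 < shellEnergy m p := (norm_pos_iff.2 hp).trans_le (norm_le_shellEnergy m p)

/-- The restriction to the mass shell of a smooth function has the line derivative
`(l₀ ∂_i f + l_i ∂₀ f) / l₀` in the direction of the spatial coordinate `i`. -/
lemma hasLineDerivAt_comp_onShell {m : ℝ} (hm : 0 < m) (f : 𝓢(Momentum, ℂ)) (i : Fin 3)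
    (p : EuclideanSpace ℝ (Fin 3)) :
    HasLineDerivAt ℝ (fun p => f (onShell m p))
      ((coordMul 0 (partialD i.succ f) + coordMul i.succ (partialD 0 f)) (onShell m p) /
        (shellEnergy m p : ℝ)) p (EuclideanSpace.single i (1 : ℝ)) := by
  set v : EuclideanSpace ℝ (Fin 3) := EuclideanSpace.single i (1 : ℝ) with hv
  have hω := shellEnergy_pos_of_mass hm p
  have hE : HasDerivAt (fun t : ℝ => shellEnergy m (p + t • v)) (p i / shellEnergy m p) 0 := by
    unfold shellEnergy
    have h1 : HasDerivAt (fun t : ℝ => p + t • v) v 0 := by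
      simpa using ((hasDerivAt_id (0 : ℝ)).smul_const v).const_add p
    have h2 : HasDerivAt (fun t : ℝ => ‖p + t • v‖ ^ 2 + m ^ 2) (2 * inner ℝ p v) 0 := by
      have := (h1.norm_sq).add_const (m ^ 2)
      simpa using this
    have h3 := h2.sqrt (by simp; positivity)
    convert h3 using 1
    simp only [zero_smul, add_zero, hv, EuclideanSpace.inner_single_right]
    rw [mul_div_mul_left _ _ (two_ne_zero)]
    simp
  have hS : HasDerivAt (fun t : ℝ => onShell m (p + t • v))
      ((p i / shellEnergy m p) • EuclideanSpace.single (0 : Fin 4) (1 : ℝ) +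
        EuclideanSpace.single i.succ (1 : ℝ)) 0 := by
    suffices hpi : HasDerivAt (fun (t : ℝ) (j : Fin 4) => onShell m (p + t • v) j)
        (fun j => ((p i / shellEnergy m p) • EuclideanSpace.single (0 : Fin 4) (1 : ℝ) +
          EuclideanSpace.single i.succ (1 : ℝ) : Momentum) j) 0 from
      (PiLp.continuousLinearEquiv 2 ℝ (fun _ : Fin 4 => ℝ)).symm.hasFDerivAt.comp_hasDerivAt
        (0 : ℝ) hpi
    rw [hasDerivAt_pi]
    intro j
    refine Fin.cases ?_ (fun j => ?_) j
    · simpa [onShell_zero] using hE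
    · change HasDerivAt (fun t : ℝ => p j + t * v j) _ 0
      have h1 : HasDerivAt (fun t : ℝ => p j + t * v j) (v j) 0 := by
        simpa using ((hasDerivAt_id (0 : ℝ)).mul_const (v j)).const_add (p j)
      convert h1 using 1
      simp [hv, Fin.succ_inj]
  have h0 : HasFDerivAt f (fderiv ℝ f (onShell m p)) (onShell m (p + (0 : ℝ) • v)) := by
    simpa using f.hasFDerivAt (onShell m p)
  have h := h0.comp_hasDerivAt (0 : ℝ) hS
  unfold HasLineDerivAt
  refine h.congr_deriv ?_
  have hωc : (shellEnergy m p : ℂ) ≠ 0 := by exact_mod_cast hω.ne'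
  simp only [map_add, map_smul, add_apply, coordMul_apply, partialD_apply, onShell_zero,
    onShell_succ, Complex.real_smul]
  push_cast
  field_simp
  ring

/-- Boost invariance of the positive mass shell, for positive mass. -/
lemma shellIntegral_boost_of_pos {m : ℝ} (hm : 0 < m) (i : Fin 3) (f : 𝓢(Momentum, ℂ)) :
    shellIntegral m (⇑(coordMul 0 (partialD i.succ f) + coordMul i.succ (partialD 0 f))) = 0 := by
  set G := coordMul 0 (partialD i.succ f) + coordMul i.succ (partialD 0 f) with hG
  have hne : ∀ p, (shellEnergy m p : ℂ) ≠ 0 := fun p => by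
    exact_mod_cast (shellEnergy_pos_of_mass hm p).ne'
  have hi0 : MeasureTheory.Integrable (fun p : EuclideanSpace ℝ (Fin 3) => f (onShell m p)) := by
    refine ((integrable_shell m (coordMul 0 f)).const_mul 2).congr (.of_forall fun p => ?_)
    have := hne p
    simp only [coordMul_apply, onShell_zero]
    push_cast
    field_simp
  have hi1 : MeasureTheory.Integrable (fun p : EuclideanSpace ℝ (Fin 3) =>
      G (onShell m p) / (shellEnergy m p : ℝ)) := by
    refine ((integrable_shell m G).const_mul 2).congr (.of_forall fun p => ?_)
    have := hne p
    push_cast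
    field_simp
  have h := integral_bilinear_hasLineDerivAt_right_eq_neg_left_of_integrable
    (μ := MeasureTheory.volume) (B := ContinuousLinearMap.mul ℝ ℂ)
    (f := fun _ : EuclideanSpace ℝ (Fin 3) => (1 : ℂ)) (f' := fun _ => 0)
    (g := fun p => f (onShell m p)) (g' := fun p => G (onShell m p) / (shellEnergy m p : ℝ))
    (v := EuclideanSpace.single i (1 : ℝ)) (by simp) (by simpa using hi1) (by simpa using hi0)
    (fun p _ => by
      unfold HasLineDerivAt
      exact hasDerivAt_const _ _)
    (fun p _ => hasLineDerivAt_comp_onShell hm f i p)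
  simp only [ContinuousLinearMap.mul_apply', one_mul, zero_mul, MeasureTheory.integral_zero,
    neg_zero] at h
  unfold shellIntegral
  have h2 : (fun p : EuclideanSpace ℝ (Fin 3) => G (onShell m p) / (2 * shellEnergy m p : ℝ)) =
      fun p => (2 : ℂ)⁻¹ * (G (onShell m p) / (shellEnergy m p : ℝ)) := by
    funext p
    have := hne p
    push_cast
    field_simp
  rw [h2, MeasureTheory.integral_const_mul, h, mul_zero]

/-- The shell integral depends continuously on the mass, also at mass zero. -/
lemma tendsto_shellIntegral_zero (f : 𝓢(Momentum, ℂ)) :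
    Filter.Tendsto (fun m : ℝ => shellIntegral m f) (𝓝[>] 0) (𝓝 (shellIntegral 0 f)) := by
  refine MeasureTheory.tendsto_integral_filter_of_dominated_convergence
    (fun p => (2 ^ 4 * ((Finset.Iic (4, 0)).sup (schwartzSeminormFamily ℂ Momentum ℂ)) f) *
        (((1 + ‖p‖) ^ 4)⁻¹ * ‖p‖⁻¹)) ?_ ?_ (integrable_shellWeight.const_mul _) ?_
  · exact .of_forall fun m => (integrable_shell m f).aestronglyMeasurable
  · exact .of_forall fun m => by
      filter_upwards [ae_ne_zero_spatial] with p hp using norm_twoPoint_integrand_le m f hp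
  · filter_upwards [ae_ne_zero_spatial] with p hp
    have hE : Continuous fun m : ℝ => shellEnergy m p := by unfold shellEnergy; fun_prop
    have hS : Continuous fun m : ℝ => onShell m p := by
      unfold onShell
      refine (PiLp.continuous_toLp 2 _).comp (continuous_pi fun i => ?_)
      refine Fin.cases ?_ (fun j => ?_) i
      · simpa using hE
      · simp only [Fin.cons_succ]; fun_prop
    have h1 : ContinuousAt (fun m : ℝ => f (onShell m p) / (2 * shellEnergy m p : ℝ)) 0 := by
      refine (f.continuous.comp hS).continuousAt.div
        (Complex.continuous_ofReal.comp (continuous_const.mul hE)).continuousAt ?_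
      have := (shellEnergy_pos_of_ne_zero 0 hp).ne'
      simpa using this
    exact h1.tendsto.mono_left nhdsWithin_le_nhds

/-- Boost invariance for all masses; the massless case is a limit, since there the energy is not
differentiable at the origin. -/
lemma shellIntegral_boost {m : ℝ} (hm : 0 ≤ m) (i : Fin 3) (f : 𝓢(Momentum, ℂ)) :
    shellIntegral m (⇑(coordMul 0 (partialD i.succ f) + coordMul i.succ (partialD 0 f))) = 0 := by
  rcases hm.eq_or_lt with rfl | hm
  · refine tendsto_nhds_unique (tendsto_shellIntegral_zero _)
      ((tendsto_const_nhds (x := (0 : ℂ))).congr' ?_)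
    filter_upwards [self_mem_nhdsWithin] with m hm
    exact (shellIntegral_boost_of_pos hm i f).symm
  · exact shellIntegral_boost_of_pos hm i f

lemma shellIntegral_smul (m : ℝ) (c : ℂ) (F : Momentum → ℂ) :
    shellIntegral m (fun l => c * F l) = c * shellIntegral m F := by
  unfold shellIntegral
  rw [← MeasureTheory.integral_const_mul]
  simp only [mul_div_assoc]

/-- The commutator of two boosts is a rotation. -/
lemma boost_commutator {i j : Fin 3} (hij : i ≠ j) (f : 𝓢(Momentum, ℂ)) :
    (let g := coordMul 0 (partialD j.succ f) + coordMul j.succ (partialD 0 f)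
     coordMul 0 (partialD i.succ g) + coordMul i.succ (partialD 0 g)) -
    (let g := coordMul 0 (partialD i.succ f) + coordMul i.succ (partialD 0 f)
     coordMul 0 (partialD j.succ g) + coordMul j.succ (partialD 0 g)) =
    coordMul i.succ (partialD j.succ f) - coordMul j.succ (partialD i.succ f) := by
  have h1 : i.succ ≠ j.succ := fun h => hij (Fin.succ_injective _ h)
  have h2 : (0 : Fin 4) ≠ i.succ := (Fin.succ_ne_zero i).symm
  have h3 : (0 : Fin 4) ≠ j.succ := (Fin.succ_ne_zero j).symm
  simp only [map_add, partialD_coordMul, h1, h1.symm, h2, h3, h2.symm, h3.symm, if_false, if_true,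
    zero_add]
  rw [partialD_comm j.succ i.succ, partialD_comm 0 i.succ, partialD_comm 0 j.succ]
  ext l
  simp only [sub_apply, add_apply, coordMul_apply]
  ring

/-- The measure `d³p / (2 ω_p)` on the mass shell is Lorentz invariant. -/
lemma shellIntegral_lorentzField {m : ℝ} (hm : 0 ≤ m) (μ ν : Fin 4) (f : 𝓢(Momentum, ℂ)) :
    shellIntegral m (lorentzField μ ν f) = 0 := by
  have hneg : ∀ g : 𝓢(Momentum, ℂ), shellIntegral m g = 0 → shellIntegral m (⇑(-g)) = 0 := by
    intro g hg
    have : ⇑(-g) = fun l => (-1 : ℂ) * g l := by ext l; simp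
    rw [this, shellIntegral_smul, hg, mul_zero]
  have hb := fun i => shellIntegral_boost hm i
  refine Fin.cases ?_ (fun i => ?_) μ <;> refine Fin.cases ?_ (fun j => ?_) ν
  · have : lorentzField 0 0 f = 0 := by ext l; simp [lorentzField_apply]
    rw [this]
    simp [shellIntegral]
  · rw [← hb j f]
    congr 1
    ext l
    simp [lorentzField_apply, coordMul_apply]
  · have : lorentzField i.succ 0 f =
        -(coordMul 0 (partialD i.succ f) + coordMul i.succ (partialD 0 f)) := by
      ext l
      simp [lorentzField_apply, coordMul_apply]
      ring
    rw [this]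
    exact hneg _ (hb i f)
  · rcases eq_or_ne i j with rfl | hij
    · have : lorentzField i.succ i.succ f = 0 := by ext l; simp [lorentzField_apply]
      rw [this]
      simp [shellIntegral]
    · have : lorentzField i.succ j.succ f = -(coordMul i.succ (partialD j.succ f) -
          coordMul j.succ (partialD i.succ f)) := by
        ext l
        simp [lorentzField_apply, coordMul_apply]
        ring
      rw [this]
      refine hneg _ ?_
      rw [← boost_commutator hij, sub_eq_add_neg, shellIntegral_add, hb, hneg _ (hb j _), add_zero]

/-! ### Bounds by continuous seminorms -/

/-- The function `q` on Schwartz space is dominated by a continuous seminorm. -/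
def SeminormBounded (q : 𝓢(Momentum, ℂ) → ℝ) : Prop :=
  ∃ p : Seminorm ℂ 𝓢(Momentum, ℂ), Continuous p ∧ ∀ f, q f ≤ p f

namespace SeminormBounded

variable {q q' : 𝓢(Momentum, ℂ) → ℝ}

lemma mono (hq : SeminormBounded q) (h : ∀ f, q' f ≤ q f) : SeminormBounded q' :=
  let ⟨p, hp, hpq⟩ := hq
  ⟨p, hp, fun f => (h f).trans (hpq f)⟩

lemma add (hq : SeminormBounded q) (hq' : SeminormBounded q') :
    SeminormBounded fun f => q f + q' f := by
  obtain ⟨p, hp, hpq⟩ := hq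
  obtain ⟨p', hp', hpq'⟩ := hq'
  exact ⟨p + p', by simpa using hp.add hp', fun f => add_le_add (hpq f) (hpq' f)⟩

lemma const_mul (hq : SeminormBounded q) {c : ℝ} (hc : 0 ≤ c) :
    SeminormBounded fun f => c * q f := by
  obtain ⟨p, hp, hpq⟩ := hq
  lift c to NNReal using hc
  exact ⟨c • p, continuous_const.mul hp,
    fun f => mul_le_mul_of_nonneg_left (hpq f) c.coe_nonneg⟩

lemma comp (hq : SeminormBounded q) (A : 𝓢(Momentum, ℂ) →L[ℂ] 𝓢(Momentum, ℂ)) :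
    SeminormBounded fun f => q (A f) := by
  obtain ⟨p, hp, hpq⟩ := hq
  exact ⟨p.comp A.toLinearMap, hp.comp A.continuous, fun f => hpq _⟩

lemma zero : SeminormBounded fun _ => 0 := ⟨0, continuous_const, fun _ => le_rfl⟩

lemma sum {ι : Type*} (t : Finset ι) {q : ι → 𝓢(Momentum, ℂ) → ℝ}
    (hq : ∀ i, SeminormBounded (q i)) : SeminormBounded fun f => ∑ i ∈ t, q i f := by
  classical
  induction t using Finset.induction_on with
  | empty => simpa using zero
  | insert i t hi ih => simpa only [Finset.sum_insert hi] using (hq i).add ih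

end SeminormBounded

/-- The `L¹` norm with respect to the measure `d³p / (2 ω_p)` on the mass shell. -/
def shellNorm (m : ℝ) (f : 𝓢(Momentum, ℂ)) : ℝ :=
  ∫ p : EuclideanSpace ℝ (Fin 3), ‖f (onShell m p) / (2 * shellEnergy m p : ℝ)‖

lemma seminormBounded_shellNorm (m : ℝ) : SeminormBounded (shellNorm m) := by
  have h0 : SeminormBounded fun f =>
      ((Finset.Iic (4, 0)).sup (schwartzSeminormFamily ℂ Momentum ℂ)) f := by
    refine (SeminormBounded.sum (Finset.Iic ((4, 0) : ℕ × ℕ))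
      (q := fun i f => schwartzSeminormFamily ℂ Momentum ℂ i f) fun i =>
        ⟨_, (schwartz_withSeminorms ℂ Momentum ℂ).continuous_seminorm i, fun f => le_rfl⟩).mono
      fun f => ?_
    refine (Seminorm.finset_sup_le_sum (schwartzSeminormFamily ℂ Momentum ℂ) _ f).trans ?_
    rw [← FunLike.coeAddMonoidHom_apply, map_sum, Finset.sum_apply]
    rfl
  refine (h0.const_mul (c := 2 ^ 4 * ∫ p : EuclideanSpace ℝ (Fin 3), ((1 + ‖p‖) ^ 4)⁻¹ * ‖p‖⁻¹)
    (mul_nonneg (by norm_num) (MeasureTheory.integral_nonneg fun p => by positivity))).mono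
    fun f => ?_
  unfold shellNorm
  refine (MeasureTheory.integral_mono_ae (integrable_shell m f).norm
    (integrable_shellWeight.const_mul
      (2 ^ 4 * ((Finset.Iic (4, 0)).sup (schwartzSeminormFamily ℂ Momentum ℂ)) f)) ?_).trans
        (le_of_eq ?_)
  · filter_upwards [ae_ne_zero_spatial] with p hp using norm_twoPoint_integrand_le m f hp
  · rw [MeasureTheory.integral_const_mul]
    ring

lemma norm_shellIntegral_le {m : ℝ} {F : Momentum → ℂ} {f : 𝓢(Momentum, ℂ)}
    (h : ∀ p, ‖F (onShell m p)‖ ≤ ‖f (onShell m p)‖) : ‖shellIntegral m F‖ ≤ shellNorm m f := by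
  refine MeasureTheory.norm_integral_le_of_norm_le (integrable_shell m f).norm
    (.of_forall fun p => ?_)
  rw [norm_div, norm_div]
  exact div_le_div_of_nonneg_right (h p) (norm_nonneg _)

/-! ### The denominator of the retarded propagator -/

/-- The complex momentum `k + iε e₀`. -/
def complexMomentum (k : Momentum) (ε : ℝ) (μ : Fin 4) : ℂ :=
  (k μ : ℂ) + if μ = 0 then Complex.I * ε else 0

lemma complexMomentum_zero (k : Momentum) (μ : Fin 4) : complexMomentum k 0 μ = (k μ : ℂ) := by
  unfold complexMomentum
  split_ifs <;> simp

/-- The complex-bilinear Minkowski product. -/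
def minkowskiProd (κ κ' : Fin 4 → ℂ) : ℂ := ∑ μ, metricSign μ * (κ μ * κ' μ)

/-- The function `l ↦ (κ + σ l)² - m²`; for `κ = k + iε e₀` it is the denominator of the
regularised retarded propagator at `k + σ l`. -/
def denominator (m σ : ℝ) (κ : Fin 4 → ℂ) (l : Momentum) : ℂ :=
  ∑ μ, metricSign μ * (κ μ + σ * l μ) ^ 2 - m ^ 2

lemma ofReal_shellEnergy_sq (m : ℝ) (p : EuclideanSpace ℝ (Fin 3)) :
    ((shellEnergy m p : ℝ) : ℂ) ^ 2 = ((∑ i : Fin 3, p i ^ 2 + m ^ 2 : ℝ) : ℂ) := by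
  rw [← Complex.ofReal_pow]
  congr 1
  unfold shellEnergy
  rw [Real.sq_sqrt (by positivity), EuclideanSpace.norm_sq_eq]
  simp

lemma denominator_complexMomentum (m σ : ℝ) (k : Momentum) (ε : ℝ) (l : Momentum) :
    denominator m σ (complexMomentum k ε) l =
      ((k + σ • l) 0 + Complex.I * ε) ^ 2 -
        ((shellEnergy m (spatialPart (k + σ • l)) : ℝ) : ℂ) ^ 2 := by
  have h1 : ((shellEnergy m (spatialPart (k + σ • l)) : ℝ) : ℂ) ^ 2 =
      ((∑ i : Fin 3, ((k + σ • l) i.succ) ^ 2 + m ^ 2 : ℝ) : ℂ) :=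
    ofReal_shellEnergy_sq m _
  rw [h1]
  unfold denominator complexMomentum
  rw [Fin.sum_univ_succ]
  simp [Fin.succ_ne_zero]
  ring

lemma denominator_complexMomentum_eq_mul (m σ : ℝ) (k : Momentum) (ε : ℝ) (l : Momentum) :
    denominator m σ (complexMomentum k ε) l =
      ((k + σ • l) 0 + shellEnergy m (spatialPart (k + σ • l)) + Complex.I * ε) *
        ((k + σ • l) 0 - shellEnergy m (spatialPart (k + σ • l)) + Complex.I * ε) := by
  rw [denominator_complexMomentum]
  ring

/-- For `ε > 0` the negative of the denominator avoids the branch cut of the logarithm: it is real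
only where `k₀ + σ l₀ = 0`, and there it is positive. -/
lemma neg_denominator_mem_slitPlane (m σ : ℝ) (k : Momentum) {ε : ℝ} (hε : 0 < ε) (l : Momentum) :
    -denominator m σ (complexMomentum k ε) l ∈ Complex.slitPlane := by
  rw [denominator_complexMomentum]
  set a := (k + σ • l) 0
  set ω := shellEnergy m (spatialPart (k + σ • l))
  rw [Complex.mem_slitPlane_iff]
  by_cases ha : a = 0
  · left
    simp [ha, sq]
    nlinarith [sq_nonneg ω, mul_pos hε hε]
  · right
    have h : (-(((a : ℂ) + Complex.I * ε) ^ 2 - (ω : ℂ) ^ 2)).im = -(2 * (a * ε)) := by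
      simp [sq]
      ring
    rw [h, neg_ne_zero]
    exact mul_ne_zero two_ne_zero (mul_ne_zero ha hε.ne')

lemma sq_le_norm_denominator (m σ : ℝ) (k : Momentum) {ε : ℝ} (hε : 0 < ε) (l : Momentum) :
    ε ^ 2 ≤ ‖denominator m σ (complexMomentum k ε) l‖ := by
  rw [denominator_complexMomentum_eq_mul, norm_mul, sq]
  refine mul_le_mul ?_ ?_ hε.le (norm_nonneg _)
  · refine le_trans ?_ (Complex.abs_im_le_norm _)
    simp [abs_of_pos hε]
  · refine le_trans ?_ (Complex.abs_im_le_norm _)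
    simp [abs_of_pos hε]

lemma denominator_ne_zero (m σ : ℝ) (k : Momentum) {ε : ℝ} (hε : 0 < ε) (l : Momentum) :
    denominator m σ (complexMomentum k ε) l ≠ 0 := by
  rw [← norm_pos_iff]
  exact (pow_pos hε 2).trans_le (sq_le_norm_denominator m σ k hε l)

lemma contDiff_denominator (m σ : ℝ) (κ : Fin 4 → ℂ) {n : WithTop ℕ∞} :
    ContDiff ℝ n (denominator m σ κ) := by
  unfold denominator
  have h : ∀ μ : Fin 4, ContDiff ℝ n fun l : Momentum => ((l μ : ℝ) : ℂ) := fun μ =>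
    (Complex.ofRealCLM.comp (EuclideanSpace.proj μ : Momentum →L[ℝ] ℝ)).contDiff
  fun_prop

lemma hasFDerivAt_coord (μ : Fin 4) (l : Momentum) :
    HasFDerivAt (fun l : Momentum => ((l μ : ℝ) : ℂ))
      (Complex.ofRealCLM.comp (EuclideanSpace.proj μ : Momentum →L[ℝ] ℝ)) l :=
  (Complex.ofRealCLM.comp (EuclideanSpace.proj μ : Momentum →L[ℝ] ℝ)).hasFDerivAt

lemma fderiv_denominator (m σ : ℝ) (κ : Fin 4 → ℂ) (l : Momentum) (ν : Fin 4) :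
    fderiv ℝ (denominator m σ κ) l (EuclideanSpace.single ν (1 : ℝ)) =
      2 * σ * metricSign ν * (κ ν + σ * l ν) := by
  have h : HasFDerivAt (denominator m σ κ) (∑ μ, (metricSign μ : ℂ) •
      (((2 : ℕ) • (κ μ + σ * l μ) ^ (2 - 1)) • ((σ : ℂ) •
        (Complex.ofRealCLM.comp (EuclideanSpace.proj μ : Momentum →L[ℝ] ℝ))))) l := by
    unfold denominator
    exact (HasFDerivAt.fun_sum fun μ _ =>
      ((((hasFDerivAt_coord μ l).const_mul (σ : ℂ)).const_add (κ μ)).pow 2).const_mul _).sub_const _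
  rw [h.fderiv]
  simp only [sum_apply, FunLike.coe_smul, Pi.smul_apply,
    ContinuousLinearMap.comp_apply, Complex.ofRealCLM_apply, PiLp.proj_apply, smul_eq_mul]
  rw [Finset.sum_eq_single ν]
  · simp
    ring
  · intro μ _ hμ
    simp [hμ]
  · simp

/-- On the mass shell the denominator is an affine function. -/
lemma denominator_onShell (m : ℝ) {σ : ℝ} (hσ : σ ^ 2 = 1) (κ : Fin 4 → ℂ)
    (p : EuclideanSpace ℝ (Fin 3)) :
    denominator m σ κ (onShell m p) = minkowskiProd κ κ +
      2 * σ * ∑ μ, metricSign μ * (κ μ * onShell m p μ) := by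
  have h1 := ofReal_shellEnergy_sq m p
  have hσc : (σ : ℂ) ^ 2 = 1 := by exact_mod_cast hσ
  unfold denominator minkowskiProd
  simp only [Fin.sum_univ_succ (n := 3), onShell_zero, onShell_succ, metricSign_zero,
    metricSign_succ]
  simp only [Fin.sum_univ_three] at h1 ⊢
  push_cast at h1 ⊢
  linear_combination (σ : ℂ) ^ 2 * h1 + (m : ℂ) ^ 2 * hσc

/-- The mass-shell condition. -/
lemma minkowski_onShell (m : ℝ) (p : EuclideanSpace ℝ (Fin 3)) :
    ∑ μ, (metricSign μ : ℂ) * (onShell m p μ : ℂ) ^ 2 = (m : ℂ) ^ 2 := by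
  have h1 := ofReal_shellEnergy_sq m p
  simp only [Fin.sum_univ_succ (n := 3), onShell_zero, onShell_succ, metricSign_zero,
    metricSign_succ]
  simp only [Fin.sum_univ_three] at h1 ⊢
  push_cast at h1 ⊢
  linear_combination h1

/-- The number `κ² (κ² - 4m²)`, which is `-4` times the Gram determinant of `κ` and any point of
the mass shell where the denominator vanishes; it is nonzero for real `κ` with `κ² ∉ {0, 4m²}`. -/
def gramConstant (m : ℝ) (κ : Fin 4 → ℂ) : ℂ :=
  minkowskiProd κ κ * (minkowskiProd κ κ - 4 * m ^ 2)

/-- The derivative of the denominator along the Lorentz field `g_μ l_μ ∂_ν - g_ν l_ν ∂_μ`. -/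
def lorentzDenominator (σ : ℝ) (κ : Fin 4 → ℂ) (μ ν : Fin 4) (l : Momentum) : ℂ :=
  2 * σ * (metricSign μ * metricSign ν) * (l μ * κ ν - l ν * κ μ)

/-- Gram identity on the mass shell: the squares of the derivatives of the denominator `h` along
the Lorentz fields add up, with the signs of the metric and a factor `-1/2`, to
`h² - 2κ² h + κ² (κ² - 4m²)`. In particular these derivatives do not all vanish where `h = 0`. -/
lemma sum_lorentzDenominator_sq (m : ℝ) {σ : ℝ} (hσ : σ ^ 2 = 1) (κ : Fin 4 → ℂ)
    (p : EuclideanSpace ℝ (Fin 3)) :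
    gramConstant m κ = -(1 / 2) * ∑ μ, ∑ ν, metricSign μ * metricSign ν *
        lorentzDenominator σ κ μ ν (onShell m p) ^ 2 -
      denominator m σ κ (onShell m p) ^ 2 +
      2 * minkowskiProd κ κ * denominator m σ κ (onShell m p) := by
  have hm := minkowski_onShell m p
  have hσc : (σ : ℂ) ^ 2 = 1 := by exact_mod_cast hσ
  rw [denominator_onShell m hσ]
  have hK : minkowskiProd κ κ = ∑ μ, (metricSign μ : ℂ) * (κ μ * κ μ) := rfl
  set K := minkowskiProd κ κ with hKdef
  set B := ∑ μ, (metricSign μ : ℂ) * (κ μ * (onShell m p μ : ℂ)) with hB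
  have hsum : ∑ μ, ∑ ν, (metricSign μ : ℂ) * metricSign ν *
        lorentzDenominator σ κ μ ν (onShell m p) ^ 2 = 8 * σ ^ 2 * (m ^ 2 * K - B ^ 2) := by
    rw [← hm, hK, hB]
    unfold lorentzDenominator
    simp only [Fin.sum_univ_succ (n := 3), metricSign_zero, metricSign_succ]
    simp only [Fin.sum_univ_three]
    push_cast
    ring
  rw [hsum, gramConstant, ← hKdef]
  linear_combination (4 * (m : ℂ) ^ 2 * K) * hσc

/-! ### Uniform bounds for integrals over the mass shell -/

/-- The integral of `f φ(h)` over the mass shell, with `h` the denominator. -/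
def shellPairing (m σ : ℝ) (φ : ℂ → ℂ) (κ : Fin 4 → ℂ) (f : 𝓢(Momentum, ℂ)) : ℂ :=
  shellIntegral m fun l => f l * φ (denominator m σ κ l)

/-- The product of a compactly supported Schwartz function with a smooth function. -/
def mulSmooth (f : 𝓢(Momentum, ℂ)) (hf : HasCompactSupport f) (G : Momentum → ℂ)
    (hG : ContDiff ℝ (⊤ : ℕ∞) G) : 𝓢(Momentum, ℂ) :=
  HasCompactSupport.toSchwartzMap (f := fun l => f l * G l) hf.mul_right ((f.smooth ⊤).mul hG)

lemma mulSmooth_apply (f : 𝓢(Momentum, ℂ)) (hf : HasCompactSupport f) (G : Momentum → ℂ)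
    (hG : ContDiff ℝ (⊤ : ℕ∞) G) (l : Momentum) : mulSmooth f hf G hG l = f l * G l := rfl

lemma partialD_mulSmooth (f : 𝓢(Momentum, ℂ)) (hf : HasCompactSupport f) (G : Momentum → ℂ)
    (hG : ContDiff ℝ (⊤ : ℕ∞) G) (μ : Fin 4) (l : Momentum) :
    partialD μ (mulSmooth f hf G hG) l =
      partialD μ f l * G l + f l * fderiv ℝ G l (EuclideanSpace.single μ (1 : ℝ)) := by
  have h1 : ⇑(mulSmooth f hf G hG) = fun l => f l * G l := rfl
  have h2 : DifferentiableAt ℝ G l := hG.differentiable (by simp) l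
  rw [partialD_apply, partialD_apply, h1, ((f.hasFDerivAt l).fun_mul h2.hasFDerivAt).fderiv]
  simp only [add_apply, FunLike.coe_smul, Pi.smul_apply, smul_eq_mul]
  ring

lemma hasCompactSupport_coordMul {f : 𝓢(Momentum, ℂ)} (hf : HasCompactSupport f) (μ : Fin 4) :
    HasCompactSupport (coordMul μ f) := by
  have : ⇑(coordMul μ f) = fun l => (l μ : ℂ) * f l := funext fun l => coordMul_apply μ f l
  rw [this]
  exact hf.mul_left

lemma hasCompactSupport_partialD {f : 𝓢(Momentum, ℂ)} (hf : HasCompactSupport f) (μ : Fin 4) :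
    HasCompactSupport (partialD μ f) :=
  hf.mono' ((subset_tsupport _).trans (SchwartzMap.tsupport_lineDerivOp_subset _ f))

lemma hasCompactSupport_lorentzField {f : 𝓢(Momentum, ℂ)} (hf : HasCompactSupport f)
    (μ ν : Fin 4) : HasCompactSupport (lorentzField μ ν f) := by
  have : ⇑(lorentzField μ ν f) = (fun l => (metricSign μ : ℂ) * coordMul μ (partialD ν f) l) -
      fun l => (metricSign ν : ℂ) * coordMul ν (partialD μ f) l := by
    ext l; simp [lorentzField]
  rw [this]
  exact ((hasCompactSupport_coordMul (hasCompactSupport_partialD hf ν) μ).mul_left).sub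
    ((hasCompactSupport_coordMul (hasCompactSupport_partialD hf μ) ν).mul_left)

/-- `φ` is smooth with complex derivative `φ'` on the plane slit along the positive axis. -/
def IsSlitPrimitive (φ φ' : ℂ → ℂ) : Prop :=
  ∀ w, -w ∈ Complex.slitPlane → ContDiffAt ℝ (⊤ : ℕ∞) φ w ∧ HasDerivAt φ (φ' w) w

/-- The denominators with parameter in `D` take values in the plane slit along the positive
axis. -/
def AvoidsCut (m σ : ℝ) (D : Set (Fin 4 → ℂ)) : Prop :=
  ∀ κ ∈ D, ∀ l, -denominator m σ κ l ∈ Complex.slitPlane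

lemma IsSlitPrimitive.contDiff_comp {m σ : ℝ} {φ φ' : ℂ → ℂ} (hφ : IsSlitPrimitive φ φ')
    {κ : Fin 4 → ℂ} (hκ : ∀ l, -denominator m σ κ l ∈ Complex.slitPlane) :
    ContDiff ℝ (⊤ : ℕ∞) fun l => φ (denominator m σ κ l) :=
  contDiff_iff_contDiffAt.2 fun l =>
    (hφ _ (hκ l)).1.comp l (contDiff_denominator m σ κ).contDiffAt

lemma IsSlitPrimitive.fderiv_comp {m σ : ℝ} {φ φ' : ℂ → ℂ} (hφ : IsSlitPrimitive φ φ')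
    {κ : Fin 4 → ℂ} (hκ : ∀ l, -denominator m σ κ l ∈ Complex.slitPlane) (l v : Momentum) :
    fderiv ℝ (fun l => φ (denominator m σ κ l)) l v =
      φ' (denominator m σ κ l) * fderiv ℝ (denominator m σ κ) l v := by
  have h1 : HasFDerivAt (denominator m σ κ) (fderiv ℝ (denominator m σ κ) l) l :=
    ((contDiff_denominator m σ κ (n := 1)).differentiable (by simp) l).hasFDerivAt
  have h2 := (hφ _ (hκ l)).2.comp_hasFDerivAt l h1
  change fderiv ℝ (φ ∘ denominator m σ κ) l v = _
  rw [h2.fderiv]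
  simp

/-- Integration by parts on the mass shell along a Lorentz field. -/
lemma shellIntegral_by_parts {m σ : ℝ} (hm : 0 ≤ m) {φ φ' : ℂ → ℂ} (hφ : IsSlitPrimitive φ φ')
    {κ : Fin 4 → ℂ} (hκ : ∀ l, -denominator m σ κ l ∈ Complex.slitPlane) (μ ν : Fin 4)
    {f : 𝓢(Momentum, ℂ)} (hf : HasCompactSupport f) :
    shellPairing m σ φ κ (lorentzField μ ν f) +
      shellIntegral m (fun l => f l * lorentzDenominator σ κ μ ν l *
        φ' (denominator m σ κ l)) = 0 := by
  have hG := hφ.contDiff_comp hκ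
  set F := mulSmooth f hf _ hG with hF
  have h0 := shellIntegral_lorentzField hm μ ν F
  set A := mulSmooth (lorentzField μ ν f) (hasCompactSupport_lorentzField hf μ ν) _ hG with hA
  have hpt : ∀ l, (lorentzField μ ν F - A) l = f l * lorentzDenominator σ κ μ ν l *
        φ' (denominator m σ κ l) := by
    intro l
    rw [sub_apply, lorentzField_apply, hF, hA, mulSmooth_apply, partialD_mulSmooth,
      partialD_mulSmooth, lorentzField_apply, hφ.fderiv_comp hκ, hφ.fderiv_comp hκ,
      fderiv_denominator, fderiv_denominator, lorentzDenominator]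
    ring
  have h1 : shellIntegral m (fun l => f l * lorentzDenominator σ κ μ ν l *
        φ' (denominator m σ κ l)) = shellIntegral m (⇑(lorentzField μ ν F - A)) := by
    congr 1
    exact (funext hpt).symm
  have h2 : shellPairing m σ φ κ (lorentzField μ ν f) = shellIntegral m A := rfl
  rw [h1, h2, ← shellIntegral_add]
  simpa using h0

lemma shellPairing_add {m σ : ℝ} {φ φ' : ℂ → ℂ} (hφ : IsSlitPrimitive φ φ')
    {κ : Fin 4 → ℂ} (hκ : ∀ l, -denominator m σ κ l ∈ Complex.slitPlane)
    {f g : 𝓢(Momentum, ℂ)} (hf : HasCompactSupport f) (hg : HasCompactSupport g) :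
    shellPairing m σ φ κ (f + g) = shellPairing m σ φ κ f + shellPairing m σ φ κ g := by
  have hG := hφ.contDiff_comp hκ
  have h := shellIntegral_add m (mulSmooth f hf _ hG) (mulSmooth g hg _ hG)
  refine Eq.trans ?_ h
  unfold shellPairing
  congr 1
  funext l
  simp only [add_apply, mulSmooth_apply]
  ring

lemma shellPairing_smul (m σ : ℝ) (φ : ℂ → ℂ) (κ : Fin 4 → ℂ) (c : ℂ) (f : 𝓢(Momentum, ℂ)) :
    shellPairing m σ φ κ (c • f) = c * shellPairing m σ φ κ f := by
  unfold shellPairing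
  rw [← shellIntegral_smul]
  congr 1
  funext l
  simp only [smul_apply, smul_eq_mul]
  ring

/-- The functionals `f ↦ ∫ f φ(h)`, for parameters in `D` and test functions `f` of compact
support, are bounded by one continuous seminorm. -/
def UniformlyBounded (m σ : ℝ) (D : Set (Fin 4 → ℂ)) (φ : ℂ → ℂ) : Prop :=
  ∃ q : 𝓢(Momentum, ℂ) → ℝ, SeminormBounded q ∧
    ∀ κ ∈ D, ∀ f : 𝓢(Momentum, ℂ), HasCompactSupport f → ‖shellPairing m σ φ κ f‖ ≤ q f

lemma norm_minkowskiProd_le {R : ℝ} (hR : 0 ≤ R) {κ : Fin 4 → ℂ} (hκ : ∀ μ, ‖κ μ‖ ≤ R) :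
    ‖minkowskiProd κ κ‖ ≤ 4 * R ^ 2 := by
  unfold minkowskiProd
  refine (norm_sum_le_of_le Finset.univ (f := fun μ => (metricSign μ : ℂ) * (κ μ * κ μ))
    (n := fun _ => R ^ 2) fun μ _ => ?_).trans (by simp)
  rw [norm_mul, norm_metricSign, one_mul, norm_mul, sq]
  exact mul_le_mul (hκ μ) (hκ μ) (norm_nonneg _) hR

lemma shellIntegral_congr {m : ℝ} {F G : Momentum → ℂ}
    (h : ∀ p, F (onShell m p) = G (onShell m p)) : shellIntegral m F = shellIntegral m G := by
  unfold shellIntegral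
  simp only [h]

lemma shellIntegral_eq_twoPointHat (m : ℝ) (f : 𝓢(Momentum, ℂ)) :
    shellIntegral m f = (2 * Real.pi : ℂ) * twoPointHat m f := by
  have h : (2 * Real.pi : ℂ) ≠ 0 := by
    exact_mod_cast (mul_pos two_pos Real.pi_pos).ne'
  rw [twoPointHat_apply, mul_inv_cancel_left₀ h]

lemma hasCompactSupport_add_schwartz {f g : 𝓢(Momentum, ℂ)} (hf : HasCompactSupport f)
    (hg : HasCompactSupport g) : HasCompactSupport (⇑(f + g)) := by
  rw [show ⇑(f + g) = ⇑f + ⇑g from funext fun l => add_apply f g l]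
  exact hf.add hg

lemma hasCompactSupport_smul_schwartz {f : 𝓢(Momentum, ℂ)} (c : ℂ) (hf : HasCompactSupport f) :
    HasCompactSupport (⇑(c • f)) := by
  rw [show ⇑(c • f) = fun l => c * f l from funext fun l => by simp]
  exact hf.mul_left

lemma hasCompactSupport_sum_schwartz {ι : Type*} (t : Finset ι) {f : ι → 𝓢(Momentum, ℂ)}
    (hf : ∀ i, HasCompactSupport (f i)) : HasCompactSupport (⇑(∑ i ∈ t, f i)) := by
  classical
  induction t using Finset.induction_on with
  | empty => simpa using! HasCompactSupport.zero
  | insert i t hi ih =>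
    rw [Finset.sum_insert hi]
    exact hasCompactSupport_add_schwartz (hf i) ih

lemma shellPairing_sum {m σ : ℝ} {φ φ' : ℂ → ℂ} (hφ : IsSlitPrimitive φ φ')
    {κ : Fin 4 → ℂ} (hκ : ∀ l, -denominator m σ κ l ∈ Complex.slitPlane) {ι : Type*}
    (t : Finset ι) {f : ι → 𝓢(Momentum, ℂ)} (hf : ∀ i, HasCompactSupport (f i)) :
    shellPairing m σ φ κ (∑ i ∈ t, f i) = ∑ i ∈ t, shellPairing m σ φ κ (f i) := by
  classical
  induction t using Finset.induction_on with
  | empty => simp [shellPairing, shellIntegral]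
  | insert i t hi ih =>
    rw [Finset.sum_insert hi, Finset.sum_insert hi,
      shellPairing_add hφ hκ (hf i) (hasCompactSupport_sum_schwartz t hf), ih]

/-- Multiplication by the derivative of the denominator along a Lorentz field. -/
def mulLorentzDenominator (σ : ℝ) (κ : Fin 4 → ℂ) (μ ν : Fin 4) (f : 𝓢(Momentum, ℂ)) :
    𝓢(Momentum, ℂ) :=
  (2 * σ * (metricSign μ * metricSign ν) * κ ν : ℂ) • coordMul μ f +
    (-(2 * σ * (metricSign μ * metricSign ν) * κ μ) : ℂ) • coordMul ν f

lemma mulLorentzDenominator_apply (σ : ℝ) (κ : Fin 4 → ℂ) (μ ν : Fin 4) (f : 𝓢(Momentum, ℂ))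
    (l : Momentum) :
    mulLorentzDenominator σ κ μ ν f l = f l * lorentzDenominator σ κ μ ν l := by
  simp only [mulLorentzDenominator, lorentzDenominator, add_apply, smul_apply, coordMul_apply,
    smul_eq_mul]
  ring

lemma hasCompactSupport_mulLorentzDenominator (σ : ℝ) (κ : Fin 4 → ℂ) (μ ν : Fin 4)
    {f : 𝓢(Momentum, ℂ)} (hf : HasCompactSupport f) :
    HasCompactSupport (mulLorentzDenominator σ κ μ ν f) :=
  hasCompactSupport_add_schwartz
    (hasCompactSupport_smul_schwartz _ (hasCompactSupport_coordMul hf μ))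
    (hasCompactSupport_smul_schwartz _ (hasCompactSupport_coordMul hf ν))

/-- Multiplication by the affine function which agrees with the denominator on the shell. -/
def mulAffineDenominator (σ : ℝ) (κ : Fin 4 → ℂ) (f : 𝓢(Momentum, ℂ)) : 𝓢(Momentum, ℂ) :=
  minkowskiProd κ κ • f + ∑ μ, (2 * σ * metricSign μ * κ μ : ℂ) • coordMul μ f

lemma mulAffineDenominator_onShell (m : ℝ) {σ : ℝ} (hσ : σ ^ 2 = 1) (κ : Fin 4 → ℂ)
    (f : 𝓢(Momentum, ℂ)) (p : EuclideanSpace ℝ (Fin 3)) :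
    mulAffineDenominator σ κ f (onShell m p) =
      denominator m σ κ (onShell m p) * f (onShell m p) := by
  rw [denominator_onShell m hσ]
  simp only [mulAffineDenominator, add_apply, sum_apply, smul_apply, coordMul_apply, smul_eq_mul]
  rw [add_mul, Finset.mul_sum, Finset.sum_mul]
  congr 1
  exact Finset.sum_congr rfl fun μ _ => by ring

/-- The Gram identity, integrated by parts: it expresses the integrals of `f φ'(h)` through
integrals of `φ(h)` and of `h φ'(h)`. -/
lemma gramConstant_mul_shellPairing {m σ : ℝ} (hm : 0 ≤ m) (hσ : σ ^ 2 = 1) {φ φ' φ'' ψ ψ' : ℂ → ℂ}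
    (hφ : IsSlitPrimitive φ φ') (hφ' : IsSlitPrimitive φ' φ'') (hψ : IsSlitPrimitive ψ ψ')
    (hψφ : ∀ w, -w ∈ Complex.slitPlane → ψ w = w * φ' w)
    {κ : Fin 4 → ℂ} (hκ : ∀ l, -denominator m σ κ l ∈ Complex.slitPlane)
    {f : 𝓢(Momentum, ℂ)} (hf : HasCompactSupport f) :
    gramConstant m κ * shellPairing m σ φ' κ f =
      (1 / 2) * ∑ μ, ∑ ν, metricSign μ * metricSign ν *
        shellPairing m σ φ κ (lorentzField μ ν (mulLorentzDenominator σ κ μ ν f)) -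
      shellPairing m σ ψ κ (mulAffineDenominator σ κ f) +
      2 * minkowskiProd κ κ * shellPairing m σ ψ κ f := by
  have hG' := hφ'.contDiff_comp hκ
  have hGψ := hψ.contDiff_comp hκ
  have hE := fun μ ν => hasCompactSupport_mulLorentzDenominator σ κ μ ν hf
  have hEE := fun μ ν => hasCompactSupport_mulLorentzDenominator σ κ μ ν (hE μ ν)
  have hA : HasCompactSupport (mulAffineDenominator σ κ f) :=
    hasCompactSupport_add_schwartz (hasCompactSupport_smul_schwartz _ hf)
      (hasCompactSupport_sum_schwartz _ fun μ =>
        hasCompactSupport_smul_schwartz _ (hasCompactSupport_coordMul hf μ))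
  have hparts : ∀ μ ν, shellPairing m σ φ κ (lorentzField μ ν (mulLorentzDenominator σ κ μ ν f)) =
      -shellIntegral m (mulSmooth _ (hEE μ ν) _ hG') := by
    intro μ ν
    rw [eq_neg_iff_add_eq_zero, ← shellIntegral_by_parts hm hφ hκ μ ν (hE μ ν)]
    congr 2
    funext l
    rw [mulSmooth_apply, mulLorentzDenominator_apply]
  have hsum : gramConstant m κ * shellPairing m σ φ' κ f =
      shellIntegral m (⇑((-(1 / 2) : ℂ) • ∑ μ, ∑ ν, (metricSign μ * metricSign ν : ℂ) •
        mulSmooth _ (hEE μ ν) _ hG' - mulSmooth _ hA _ hGψ +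
        (2 * minkowskiProd κ κ) • mulSmooth _ hf _ hGψ)) := by
    unfold shellPairing
    rw [← shellIntegral_smul]
    refine shellIntegral_congr fun p => ?_
    simp only [add_apply, sub_apply, smul_apply, sum_apply, smul_eq_mul, mulSmooth_apply,
      mulLorentzDenominator_apply]
    rw [mulAffineDenominator_onShell m hσ, hψφ _ (hκ _), sum_lorentzDenominator_sq m hσ κ p]
    have : ∑ μ, ∑ ν, (metricSign μ * metricSign ν : ℂ) *
        (f (onShell m p) * lorentzDenominator σ κ μ ν (onShell m p) *
          lorentzDenominator σ κ μ ν (onShell m p) * φ' (denominator m σ κ (onShell m p))) =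
        (∑ μ, ∑ ν, (metricSign μ * metricSign ν : ℂ) *
          lorentzDenominator σ κ μ ν (onShell m p) ^ 2) *
          (f (onShell m p) * φ' (denominator m σ κ (onShell m p))) := by
      simp only [Finset.sum_mul]
      exact Finset.sum_congr rfl fun μ _ => Finset.sum_congr rfl fun ν _ => by ring
    rw [this]
    ring
  rw [hsum]
  simp only [hparts, shellIntegral_eq_twoPointHat, map_add, map_sub, map_smul, map_sum, smul_eq_mul]
  have h1 : shellPairing m σ ψ κ (mulAffineDenominator σ κ f) =
      2 * Real.pi * twoPointHat m (mulSmooth _ hA _ hGψ) :=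
    shellIntegral_eq_twoPointHat m (mulSmooth _ hA _ hGψ)
  have h2 : shellPairing m σ ψ κ f = 2 * Real.pi * twoPointHat m (mulSmooth _ hf _ hGψ) :=
    shellIntegral_eq_twoPointHat m (mulSmooth _ hf _ hGψ)
  have h3 : ∑ μ, ∑ ν, (metricSign μ : ℂ) * metricSign ν *
      -(2 * Real.pi * twoPointHat m (mulSmooth _ (hEE μ ν) _ hG')) =
      -(2 * Real.pi) * ∑ μ, ∑ ν, (metricSign μ : ℂ) * metricSign ν *
        twoPointHat m (mulSmooth _ (hEE μ ν) _ hG') := by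
    simp only [Finset.mul_sum]
    exact Finset.sum_congr rfl fun μ _ => Finset.sum_congr rfl fun ν _ => by ring
  rw [h1, h2, h3]
  ring

/-- If the integrals of `φ(h)` and of `h φ'(h)` are uniformly bounded and the Gram constant stays
away from zero, then the integrals of the more singular function `φ'(h)` are uniformly bounded. -/
lemma UniformlyBounded.of_primitive {m σ : ℝ} (hm : 0 ≤ m) (hσ : σ ^ 2 = 1)
    {D : Set (Fin 4 → ℂ)} (hD : AvoidsCut m σ D) {R δ : ℝ} (hR : 0 ≤ R)
    (hDR : ∀ κ ∈ D, ∀ μ, ‖κ μ‖ ≤ R) (hδ : 0 < δ) (hDδ : ∀ κ ∈ D, δ ≤ ‖gramConstant m κ‖)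
    {φ φ' φ'' ψ ψ' : ℂ → ℂ} (hφ : IsSlitPrimitive φ φ') (hφ' : IsSlitPrimitive φ' φ'')
    (hψ : IsSlitPrimitive ψ ψ') (hψφ : ∀ w, -w ∈ Complex.slitPlane → ψ w = w * φ' w)
    (bφ : UniformlyBounded m σ D φ) (bψ : UniformlyBounded m σ D ψ) :
    UniformlyBounded m σ D φ' := by
  obtain ⟨q, hq, hqb⟩ := bφ
  obtain ⟨r, hr, hrb⟩ := bψ
  have hσn := norm_ofReal_of_sq_eq_one hσ
  refine ⟨fun f => δ⁻¹ * ((1 / 2) * (∑ μ, ∑ ν,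
      ((2 * R) * q (lorentzField μ ν (coordMul μ f)) +
        (2 * R) * q (lorentzField μ ν (coordMul ν f)))) +
      ((4 * R ^ 2) * r f + ∑ μ, (2 * R) * r (coordMul μ f)) + (8 * R ^ 2) * r f), ?_, ?_⟩
  · refine SeminormBounded.const_mul (.add (.add (.const_mul (.sum _ fun μ => .sum _ fun ν =>
      .add ?_ ?_) (by norm_num)) (.add (.const_mul hr (by positivity)) (.sum _ fun μ => ?_)))
        (.const_mul hr (by positivity))) (by positivity)
    · exact (hq.comp (lorentzField μ ν ∘L coordMul μ)).const_mul (by positivity)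
    · exact (hq.comp (lorentzField μ ν ∘L coordMul ν)).const_mul (by positivity)
    · exact (hr.comp (coordMul μ)).const_mul (by positivity)
  · intro κ hκD f hf
    have hκ := hD κ hκD
    have hid := gramConstant_mul_shellPairing hm hσ hφ hφ' hψ hψφ hκ hf
    rw [le_inv_mul_iff₀ hδ]
    refine (mul_le_mul_of_nonneg_right (hDδ κ hκD) (norm_nonneg _)).trans ?_
    rw [← norm_mul, hid]
    have hK := norm_minkowskiProd_le hR (hDR κ hκD)
    have hcoef : ∀ μ ν ρ, ‖(2 * σ * (metricSign μ * metricSign ν) * κ ρ : ℂ)‖ ≤ 2 * R := by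
      intro μ ν ρ
      rw [norm_mul, norm_mul, norm_mul, norm_mul, norm_metricSign, norm_metricSign, hσn]
      simpa using hDR κ hκD ρ
    have t1 : ∀ μ ν, ‖(metricSign μ * metricSign ν : ℂ) *
        shellPairing m σ φ κ (lorentzField μ ν (mulLorentzDenominator σ κ μ ν f))‖ ≤
        (2 * R) * q (lorentzField μ ν (coordMul μ f)) +
          (2 * R) * q (lorentzField μ ν (coordMul ν f)) := by
      intro μ ν
      have c1 := hasCompactSupport_lorentzField (hasCompactSupport_coordMul hf μ) μ ν
      have c2 := hasCompactSupport_lorentzField (hasCompactSupport_coordMul hf ν) μ ν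
      rw [norm_mul, norm_mul, norm_metricSign, norm_metricSign, one_mul, one_mul,
        mulLorentzDenominator, map_add, map_smul, map_smul,
        shellPairing_add hφ hκ (hasCompactSupport_smul_schwartz _ c1)
          (hasCompactSupport_smul_schwartz _ c2), shellPairing_smul, shellPairing_smul]
      refine (norm_add_le _ _).trans (add_le_add ?_ ?_)
      · rw [norm_mul]
        exact mul_le_mul (hcoef μ ν ν) (hqb κ hκD _ c1) (norm_nonneg _) (by positivity)
      · rw [norm_mul, norm_neg]
        exact mul_le_mul (hcoef μ ν μ) (hqb κ hκD _ c2) (norm_nonneg _) (by positivity)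
    have t2 : ‖shellPairing m σ ψ κ (mulAffineDenominator σ κ f)‖ ≤
        (4 * R ^ 2) * r f + ∑ μ, (2 * R) * r (coordMul μ f) := by
      have c1 := fun μ => hasCompactSupport_coordMul hf μ
      rw [mulAffineDenominator, shellPairing_add hψ hκ (hasCompactSupport_smul_schwartz _ hf)
        (hasCompactSupport_sum_schwartz _ fun μ => hasCompactSupport_smul_schwartz _ (c1 μ)),
        shellPairing_sum hψ hκ _ fun μ => hasCompactSupport_smul_schwartz _ (c1 μ)]
      refine (norm_add_le _ _).trans (add_le_add ?_ (norm_sum_le_of_le _ fun μ _ => ?_))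
      · rw [shellPairing_smul, norm_mul]
        exact mul_le_mul hK (hrb κ hκD _ hf) (norm_nonneg _) (by positivity)
      · rw [shellPairing_smul, norm_mul]
        refine mul_le_mul ?_ (hrb κ hκD _ (c1 μ)) (norm_nonneg _) (by positivity)
        rw [norm_mul, norm_mul, norm_mul, norm_metricSign, hσn]
        simpa using hDR κ hκD μ
    refine (norm_add_le _ _).trans (add_le_add ((norm_sub_le _ _).trans (add_le_add ?_ t2)) ?_)
    · rw [norm_mul, show ‖(1 / 2 : ℂ)‖ = 1 / 2 by norm_num]
      refine mul_le_mul_of_nonneg_left ?_ (by norm_num)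
      exact norm_sum_le_of_le _ fun μ _ => norm_sum_le_of_le _ fun ν _ => t1 μ ν
    · rw [norm_mul, norm_mul]
      refine mul_le_mul ?_ (hrb κ hκD _ hf) (norm_nonneg _) (by positivity)
      rw [Complex.norm_ofNat]
      linarith

/-- Functions of at most quadratic growth in the denominator give uniformly bounded integrals. -/
lemma uniformlyBounded_of_growth {m σ : ℝ} (hσ : σ ^ 2 = 1) {D : Set (Fin 4 → ℂ)}
    (hD : AvoidsCut m σ D) {R C : ℝ} (hR : 0 ≤ R) (hC : 0 ≤ C)
    (hDR : ∀ κ ∈ D, ∀ μ, ‖κ μ‖ ≤ R) {φ : ℂ → ℂ}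
    (hg : ∀ w, -w ∈ Complex.slitPlane → ‖φ w‖ ≤ C * (1 + ‖w‖ ^ 2)) :
    UniformlyBounded m σ D φ := by
  have hσn := norm_ofReal_of_sq_eq_one hσ
  set N := shellNorm m with hN
  set K : ℝ := C * (1 + 32 * R ^ 4 + 32 * R ^ 2) with hK
  have hK0 : 0 ≤ K := by positivity
  refine ⟨fun f => K * (N f + ∑ μ, N (coordMul μ (coordMul μ f))), ?_, fun κ hκ f hf => ?_⟩
  · exact ((seminormBounded_shellNorm m).add (.sum _ fun μ =>
      (seminormBounded_shellNorm m).comp (coordMul μ ∘L coordMul μ))).const_mul hK0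
  · have hpt : ∀ p : EuclideanSpace ℝ (Fin 3),
        ‖φ (denominator m σ κ (onShell m p))‖ ≤ K * (1 + ∑ μ, (onShell m p μ) ^ 2) := by
      intro p
      refine (hg _ (hD κ hκ _)).trans ?_
      rw [hK, mul_assoc]
      refine mul_le_mul_of_nonneg_left ?_ hC
      rw [denominator_onShell m hσ]
      set l := onShell m p
      have h1 : ‖minkowskiProd κ κ + 2 * σ * ∑ μ, (metricSign μ : ℂ) * (κ μ * (l μ : ℂ))‖ ≤
          4 * R ^ 2 + 2 * (R * ∑ μ, |l μ|) := by
        refine (norm_add_le _ _).trans (add_le_add (norm_minkowskiProd_le hR (hDR κ hκ)) ?_)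
        rw [norm_mul, norm_mul, hσn, mul_one, Complex.norm_ofNat]
        refine mul_le_mul_of_nonneg_left ?_ zero_le_two
        rw [Finset.mul_sum]
        refine norm_sum_le_of_le _ fun μ _ => ?_
        rw [norm_mul, norm_metricSign, one_mul, norm_mul, Complex.norm_real, Real.norm_eq_abs]
        exact mul_le_mul_of_nonneg_right (hDR κ hκ μ) (abs_nonneg _)
      have h2 : (∑ μ, |l μ|) ^ 2 ≤ 4 * ∑ μ, l μ ^ 2 := by
        have := sq_sum_le_card_mul_sum_sq (s := (Finset.univ : Finset (Fin 4)))
          (f := fun μ => |l μ|)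
        simpa using this
      have h3 : 0 ≤ ∑ μ, l μ ^ 2 := Finset.sum_nonneg fun μ _ => sq_nonneg _
      have h4 := pow_le_pow_left₀ (norm_nonneg _) h1 2
      refine (add_le_add_right h4 1).trans ?_
      have h5 : (4 * R ^ 2 + 2 * (R * ∑ μ, |l μ|)) ^ 2 ≤
          2 * (4 * R ^ 2) ^ 2 + 2 * (2 * (R * ∑ μ, |l μ|)) ^ 2 := by
        nlinarith [sq_nonneg (4 * R ^ 2 - 2 * (R * ∑ μ, |l μ|))]
      have h6 : R ^ 2 * (∑ μ, |l μ|) ^ 2 ≤ R ^ 2 * (4 * ∑ μ, l μ ^ 2) :=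
        mul_le_mul_of_nonneg_left h2 (sq_nonneg R)
      nlinarith [mul_nonneg (pow_nonneg hR 4) h3]
    have hint : ∀ g : 𝓢(Momentum, ℂ), MeasureTheory.Integrable fun p : EuclideanSpace ℝ (Fin 3) =>
        ‖g (onShell m p) / (2 * shellEnergy m p : ℝ)‖ := fun g => (integrable_shell m g).norm
    have hle := MeasureTheory.norm_integral_le_of_norm_le
      (f := fun p : EuclideanSpace ℝ (Fin 3) =>
        f (onShell m p) * φ (denominator m σ κ (onShell m p)) / (2 * shellEnergy m p : ℝ))
      (((hint f).add (MeasureTheory.integrable_finsetSum Finset.univ fun μ _ =>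
        hint (coordMul μ (coordMul μ f)))).const_mul K) (.of_forall fun p => ?_)
    · refine hle.trans (le_of_eq ?_)
      rw [MeasureTheory.integral_const_mul]
      congr 1
      simp only [Pi.add_apply]
      rw [MeasureTheory.integral_add (hint f) (MeasureTheory.integrable_finsetSum _ fun μ _ =>
        hint (coordMul μ (coordMul μ f))), MeasureTheory.integral_finsetSum _ fun μ _ =>
        hint (coordMul μ (coordMul μ f))]
      rfl
    · simp only [Pi.add_apply, norm_div, norm_mul, coordMul_apply, Complex.norm_real]
      rw [← Finset.sum_div, ← add_div, ← mul_div_assoc]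
      refine div_le_div_of_nonneg_right ?_ (by positivity)
      refine (mul_le_mul_of_nonneg_left (hpt p) (norm_nonneg _)).trans (le_of_eq ?_)
      have : ∑ μ, ‖onShell m p μ‖ * (‖onShell m p μ‖ * ‖f (onShell m p)‖) =
          (∑ μ, (onShell m p μ) ^ 2) * ‖f (onShell m p)‖ := by
        rw [Finset.sum_mul]
        refine Finset.sum_congr rfl fun μ _ => ?_
        rw [← mul_assoc, Real.norm_eq_abs, abs_mul_abs_self, sq]
      rw [this]
      ring

lemma isSlitPrimitive_log : IsSlitPrimitive (fun w => Complex.log (-w)) (fun w => (w ^ 1)⁻¹) := by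
  intro w hw
  refine ⟨?_, ?_⟩
  · have h : ContDiffAt ℝ (⊤ : ℕ∞) Complex.log (-w) :=
      (Complex.contDiffAt_log (n := (⊤ : ℕ∞)) hw).restrict_scalars ℝ
    exact h.comp w contDiff_neg.contDiffAt
  · have h := (Complex.hasDerivAt_log hw).comp w (hasDerivAt_neg w)
    refine h.congr_deriv ?_
    simp only [pow_one, inv_neg]
    ring

lemma ne_zero_of_neg_mem_slitPlane {w : ℂ} (hw : -w ∈ Complex.slitPlane) : w ≠ 0 :=
  neg_ne_zero.1 (Complex.slitPlane_ne_zero hw)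

lemma isSlitPrimitive_mul_log :
    IsSlitPrimitive (fun w => w * Complex.log (-w)) (fun w => Complex.log (-w) + 1) := by
  intro w hw
  obtain ⟨h1, h2⟩ := isSlitPrimitive_log w hw
  refine ⟨contDiffAt_id.mul h1, ?_⟩
  refine ((hasDerivAt_id w).mul h2).congr_deriv ?_
  have := ne_zero_of_neg_mem_slitPlane hw
  simp only [id]
  field_simp

lemma isSlitPrimitive_mul_log_sub :
    IsSlitPrimitive (fun w => w * Complex.log (-w) - w) (fun w => Complex.log (-w)) := by
  intro w hw
  obtain ⟨h1, h2⟩ := isSlitPrimitive_mul_log w hw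
  exact ⟨h1.sub contDiffAt_id, (h2.sub (hasDerivAt_id w)).congr_deriv (by ring)⟩

lemma isSlitPrimitive_inv_pow (j : ℕ) :
    IsSlitPrimitive (fun w => (w ^ j)⁻¹) (fun w => -j * (w ^ (j + 1))⁻¹) := by
  intro w hw
  have h0 := ne_zero_of_neg_mem_slitPlane hw
  refine ⟨(contDiffAt_id.pow j).inv (pow_ne_zero j h0), ?_⟩
  refine ((hasDerivAt_pow j w).inv (pow_ne_zero j h0)).congr_deriv ?_
  rcases j with _ | j
  · simp
  · rw [Nat.add_sub_cancel]
    field_simp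
    ring

lemma isSlitPrimitive_inv_pow_succ (j : ℕ) (hj : j ≠ 0) :
    IsSlitPrimitive (fun w => -(j : ℂ)⁻¹ * (w ^ j)⁻¹) (fun w => (w ^ (j + 1))⁻¹) := by
  intro w hw
  obtain ⟨h1, h2⟩ := isSlitPrimitive_inv_pow j w hw
  refine ⟨contDiffAt_const.mul h1, (h2.const_mul _).congr_deriv ?_⟩
  have : (j : ℂ) ≠ 0 := by exact_mod_cast hj
  field_simp

lemma isSlitPrimitive_const (c : ℂ) : IsSlitPrimitive (fun _ => c) (fun _ => 0) :=
  fun w _ => ⟨contDiffAt_const, hasDerivAt_const w c⟩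

lemma norm_mul_log_le {w : ℂ} (hw : w ≠ 0) : ‖w * Complex.log (-w)‖ ≤ 5 * (1 + ‖w‖ ^ 2) := by
  have hw0 : 0 < ‖w‖ := norm_pos_iff.2 hw
  have h1 : ‖Complex.log (-w)‖ ≤ |Real.log ‖w‖| + Real.pi := by
    refine (Complex.norm_le_abs_re_add_abs_im _).trans (add_le_add ?_ ?_)
    · rw [Complex.log_re, norm_neg]
    · rw [Complex.log_im]
      exact Complex.abs_arg_le_pi _
  have h2 : ‖w‖ * |Real.log ‖w‖| ≤ 1 + ‖w‖ ^ 2 := by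
    have a1 := Real.log_le_sub_one_of_pos hw0
    have a2 := Real.one_sub_inv_le_log_of_pos hw0
    have a3 : ‖w‖ * ‖w‖⁻¹ = 1 := mul_inv_cancel₀ hw0.ne'
    rcases abs_cases (Real.log ‖w‖) with ⟨h, _⟩ | ⟨h, _⟩ <;> rw [h] <;> nlinarith
  rw [norm_mul]
  nlinarith [mul_le_mul_of_nonneg_left h1 hw0.le, Real.pi_lt_four, sq_nonneg (‖w‖ - 1)]

/-- Uniform bounds for all negative powers of the denominator. The start is the function
`w log(-w) - w`, which has moderate growth; its iterated derivatives are `log(-w)` and, up to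
constants, the negative powers of `w`. -/
lemma uniformlyBounded_inv_pow {m σ : ℝ} (hm : 0 ≤ m) (hσ : σ ^ 2 = 1)
    {D : Set (Fin 4 → ℂ)} (hD : AvoidsCut m σ D) {R δ : ℝ} (hR : 0 ≤ R)
    (hDR : ∀ κ ∈ D, ∀ μ, ‖κ μ‖ ≤ R) (hδ : 0 < δ) (hDδ : ∀ κ ∈ D, δ ≤ ‖gramConstant m κ‖)
    (j : ℕ) : UniformlyBounded m σ D fun w => (w ^ j)⁻¹ := by
  have b1 : UniformlyBounded m σ D fun w => w * Complex.log (-w) :=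
    uniformlyBounded_of_growth hσ hD hR (by norm_num : (0 : ℝ) ≤ 5) hDR
      fun w hw => norm_mul_log_le (ne_zero_of_neg_mem_slitPlane hw)
  have b2 : UniformlyBounded m σ D fun w => w * Complex.log (-w) - w :=
    uniformlyBounded_of_growth hσ hD hR (by norm_num : (0 : ℝ) ≤ 6) hDR fun w hw => by
        have h := norm_mul_log_le (ne_zero_of_neg_mem_slitPlane hw)
        refine (norm_sub_le _ _).trans ?_
        nlinarith [sq_nonneg (‖w‖ - 1)]
  have b3 : UniformlyBounded m σ D fun w => Complex.log (-w) :=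
    b2.of_primitive hm hσ hD hR hDR hδ hDδ isSlitPrimitive_mul_log_sub isSlitPrimitive_log
      isSlitPrimitive_mul_log (fun w _ => rfl) b1
  have b4 : UniformlyBounded m σ D fun _ => 1 :=
    uniformlyBounded_of_growth hσ hD hR zero_le_one hDR
      fun w _ => by
        rw [norm_one, one_mul]
        exact le_add_of_nonneg_right (sq_nonneg _)
  have b5 : UniformlyBounded m σ D fun w => (w ^ 1)⁻¹ :=
    b3.of_primitive hm hσ hD hR hDR hδ hDδ isSlitPrimitive_log
      (isSlitPrimitive_inv_pow 1) (isSlitPrimitive_const 1)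
      (fun w hw => by rw [pow_one, mul_inv_cancel₀ (ne_zero_of_neg_mem_slitPlane hw)]) b4
  have bsucc : ∀ j : ℕ, UniformlyBounded m σ D fun w => (w ^ (j + 1))⁻¹ := by
    intro j
    induction j with
    | zero => exact b5
    | succ j ih =>
      have bφ : UniformlyBounded m σ D fun w => -((j + 1 : ℕ) : ℂ)⁻¹ * (w ^ (j + 1))⁻¹ := by
        obtain ⟨q, hq, hqb⟩ := ih
        refine ⟨_, hq.const_mul (norm_nonneg (-((j + 1 : ℕ) : ℂ)⁻¹)), fun κ hκ f hf => ?_⟩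
        have : shellPairing m σ (fun w => -((j + 1 : ℕ) : ℂ)⁻¹ * (w ^ (j + 1))⁻¹) κ f =
            -((j + 1 : ℕ) : ℂ)⁻¹ * shellPairing m σ (fun w => (w ^ (j + 1))⁻¹) κ f := by
          unfold shellPairing
          rw [← shellIntegral_smul]
          congr 1
          funext l
          ring
        rw [this, norm_mul]
        exact mul_le_mul_of_nonneg_left (hqb κ hκ f hf) (norm_nonneg _)
      refine bφ.of_primitive hm hσ hD hR hDR hδ hDδ
        (isSlitPrimitive_inv_pow_succ (j + 1) (Nat.succ_ne_zero j))
        (isSlitPrimitive_inv_pow (j + 2)) (isSlitPrimitive_inv_pow (j + 1)) (fun w hw => ?_) ih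
      have := ne_zero_of_neg_mem_slitPlane hw
      field_simp
      ring
  cases j with
  | zero => simpa using b4
  | succ j => exact bsucc j

/-! ### The regularised product and its dependence on the momentum -/

lemma integrable_mul_inv_denominator (m σ : ℝ) (j : ℕ) (k : Momentum) {ε : ℝ} (hε : 0 < ε)
    (f : 𝓢(Momentum, ℂ)) : MeasureTheory.Integrable fun p : EuclideanSpace ℝ (Fin 3) =>
      f (onShell m p) * (denominator m σ (complexMomentum k ε) (onShell m p) ^ j)⁻¹ /
        (2 * shellEnergy m p : ℝ) := by
  have hc : Continuous fun p : EuclideanSpace ℝ (Fin 3) =>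
      (denominator m σ (complexMomentum k ε) (onShell m p) ^ j)⁻¹ :=
    (((contDiff_denominator m σ _ (n := 0)).continuous.comp (continuous_onShell m)).pow j).inv₀
      fun p => pow_ne_zero j (denominator_ne_zero m σ k hε _)
  refine ((integrable_shell m f).mul_bdd (c := ((ε ^ 2) ^ j)⁻¹) hc.aestronglyMeasurable
    (.of_forall fun p => ?_)).congr (.of_forall fun p => by simp only; ring)
  rw [norm_inv, norm_pow]
  have := sq_le_norm_denominator m σ k hε (onShell m p)
  gcongr

lemma norm_shellPairing_inv_pow_le (m σ : ℝ) (j : ℕ) (k : Momentum) {ε : ℝ} (hε : 0 < ε)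
    (f : 𝓢(Momentum, ℂ)) :
    ‖shellPairing m σ (fun w => (w ^ j)⁻¹) (complexMomentum k ε) f‖ ≤
      ((ε ^ 2) ^ j)⁻¹ * shellNorm m f := by
  unfold shellNorm
  rw [← MeasureTheory.integral_const_mul]
  refine MeasureTheory.norm_integral_le_of_norm_le ((integrable_shell m f).norm.const_mul _)
    (.of_forall fun p => ?_)
  have := sq_le_norm_denominator m σ k hε (onShell m p)
  rw [norm_div, norm_div, norm_mul, norm_inv, norm_pow, mul_div_assoc', mul_comm ‖f _‖]
  gcongr

/-- A linear functional on Schwartz space dominated by a continuous seminorm, as a tempered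
distribution. -/
def temperedOfBound (T : 𝓢(Momentum, ℂ) →ₗ[ℂ] ℂ) (hT : SeminormBounded fun f => ‖T f‖) :
    TemperedDist where
  toLinearMap := T
  cont := by
    obtain ⟨p, hp, hpT⟩ := hT
    refine continuous_of_continuousAt_zero T ?_
    rw [ContinuousAt, map_zero]
    refine squeeze_zero_norm hpT ?_
    simpa using hp.tendsto 0

/-- The distribution `f ↦ ∫ f h⁻ʲ` on the mass shell, where `h` is the denominator with parameter
`k + iε e₀`, for `ε > 0`; it is set to zero for the remaining `ε`. -/
def regularised (m σ : ℝ) (j : ℕ) (k : Momentum) (ε : ℝ) : TemperedDist :=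
  if hε : 0 < ε then
    temperedOfBound
      { toFun := shellPairing m σ (fun w => (w ^ j)⁻¹) (complexMomentum k ε)
        map_add' := fun f g => by
          unfold shellPairing shellIntegral
          rw [← MeasureTheory.integral_add (integrable_mul_inv_denominator m σ j k hε f)
            (integrable_mul_inv_denominator m σ j k hε g)]
          simp only [add_apply, add_mul, add_div]
        map_smul' := shellPairing_smul m σ _ _ }
      (((seminormBounded_shellNorm m).const_mul (c := ((ε ^ 2) ^ j)⁻¹) (by positivity)).mono
        (norm_shellPairing_inv_pow_le m σ j k hε))
  else 0

lemma regularised_apply (m σ : ℝ) (j : ℕ) (k : Momentum) {ε : ℝ} (hε : 0 < ε)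
    (f : 𝓢(Momentum, ℂ)) : regularised m σ j k ε f =
      shellPairing m σ (fun w => (w ^ j)⁻¹) (complexMomentum k ε) f := by
  rw [regularised, dif_pos hε]
  rfl

lemma norm_complexMomentum_le (k : Momentum) (ε : ℝ) (μ : Fin 4) :
    ‖complexMomentum k ε μ‖ ≤ ‖k‖ + |ε| := by
  unfold complexMomentum
  refine (norm_add_le _ _).trans (add_le_add ?_ ?_)
  · rw [Complex.norm_real]
    exact PiLp.norm_apply_le k μ
  · split_ifs <;> simp

lemma complexMomentum_add_smul (k v : Momentum) (ε τ t : ℝ) (μ : Fin 4) :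
    complexMomentum (k + t • v) (ε + t * τ) μ =
      complexMomentum k ε μ + t * complexMomentum v τ μ := by
  unfold complexMomentum
  split_ifs
  · simp
    ring
  · simp

lemma continuous_gramConstant_complexMomentum (m : ℝ) :
    Continuous fun y : Momentum × ℝ => gramConstant m (complexMomentum y.1 y.2) := by
  have h : ∀ μ, Continuous fun y : Momentum × ℝ => complexMomentum y.1 y.2 μ := by
    intro μ
    unfold complexMomentum
    split_ifs <;> fun_prop
  unfold gramConstant minkowskiProd
  fun_prop

lemma gramConstant_complexMomentum_zero (m : ℝ) (k : Momentum) :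
    gramConstant m (complexMomentum k 0) =
      ((minkowskiSq k * (minkowskiSq k - 4 * m ^ 2) : ℝ) : ℂ) := by
  have h : minkowskiProd (complexMomentum k 0) (complexMomentum k 0) = (minkowskiSq k : ℂ) := by
    unfold minkowskiProd complexMomentum minkowskiSq
    rw [Fin.sum_univ_succ]
    simp [sq]
    ring
  rw [gramConstant, h]
  push_cast
  ring

lemma continuous_minkowskiSq : Continuous minkowskiSq := by
  unfold minkowskiSq
  fun_prop

lemma isOpen_nonexceptionalMomenta (m : ℝ) : IsOpen (nonexceptionalMomenta m) := by
  have h : IsClosed ({0, 4 * m ^ 2} : Set ℝ) := (Set.toFinite _).isClosed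
  exact h.isOpen_compl.preimage continuous_minkowskiSq

/-- Near a nonexceptional momentum the regularised distributions are bounded, uniformly in the
momentum and in `ε`, by a continuous seminorm. -/
lemma exists_regularised_bound {m σ : ℝ} (hm : 0 ≤ m) (hσ : σ ^ 2 = 1) {k₀ : Momentum}
    (hk₀ : k₀ ∈ nonexceptionalMomenta m) : ∃ r : ℝ, 0 < r ∧ ∀ j : ℕ,
      ∃ p : Seminorm ℂ 𝓢(Momentum, ℂ), Continuous p ∧ ∀ k ∈ Metric.ball k₀ r,
        ∀ ε ∈ Set.Ioo 0 r, ∀ f, ‖regularised m σ j k ε f‖ ≤ p f := by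
  have hne : gramConstant m (complexMomentum k₀ 0) ≠ 0 := by
    rw [gramConstant_complexMomentum_zero]
    simp only [nonexceptionalMomenta, Set.mem_ofPred_eq, Set.mem_insert_iff,
      Set.mem_singleton_iff, not_or] at hk₀
    exact_mod_cast mul_ne_zero hk₀.1 (sub_ne_zero.2 hk₀.2)
  set δ := ‖gramConstant m (complexMomentum k₀ 0)‖ / 2 with hδ
  have hδ0 : 0 < δ := half_pos (norm_pos_iff.2 hne)
  have hev : ∀ᶠ y in 𝓝 (k₀, (0 : ℝ)), δ < ‖gramConstant m (complexMomentum y.1 y.2)‖ :=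
    (continuous_gramConstant_complexMomentum m).norm.continuousAt.eventually
      (lt_mem_nhds (half_lt_self (norm_pos_iff.2 hne)))
  obtain ⟨r, hr, hball⟩ := Metric.eventually_nhds_iff_ball.1 hev
  refine ⟨r, hr, fun j => ?_⟩
  set D : Set (Fin 4 → ℂ) :=
    {κ | ∃ k ∈ Metric.ball k₀ r, ∃ ε ∈ Set.Ioo 0 r, κ = complexMomentum k ε} with hD
  have hcut : AvoidsCut m σ D := by
    rintro _ ⟨k, -, ε, hε, rfl⟩ l
    exact neg_denominator_mem_slitPlane m σ k hε.1 l
  have hDR : ∀ κ ∈ D, ∀ μ, ‖κ μ‖ ≤ ‖k₀‖ + r + r := by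
    rintro _ ⟨k, hk, ε, hε, rfl⟩ μ
    refine (norm_complexMomentum_le k ε μ).trans (add_le_add ?_ ?_)
    · have : ‖k - k₀‖ < r := by rwa [← dist_eq_norm]
      have h2 := norm_le_norm_add_norm_sub' k k₀
      linarith
    · rw [abs_of_pos hε.1]
      exact hε.2.le
  have hDδ : ∀ κ ∈ D, δ ≤ ‖gramConstant m κ‖ := by
    rintro _ ⟨k, hk, ε, hε, rfl⟩
    refine (hball (k, ε) ?_).le
    rw [Metric.mem_ball, Prod.dist_eq, max_lt_iff]
    exact ⟨hk, by simpa [abs_of_pos hε.1] using hε.2⟩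
  obtain ⟨q, ⟨p, hp, hqp⟩, hqb⟩ := uniformlyBounded_inv_pow hm hσ hcut (by positivity) hDR hδ0 hDδ j
  refine ⟨p, hp, fun k hk ε hε f => ?_⟩
  obtain ⟨F, hF, hlim⟩ := exists_tendsto_hasCompactSupport f
  have h1 := (((regularised m σ j k ε).continuous.tendsto f).comp hlim).norm
  refine le_of_tendsto_of_tendsto' h1 ((hp.tendsto f).comp hlim) fun n => ?_
  simp only [Function.comp_apply]
  rw [regularised_apply m σ j k hε.1]
  exact (hqb _ ⟨k, hk, ε, hε, rfl⟩ _ (hF n)).trans (hqp _)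

/-- The operator on test functions by which the regularised distribution with `h⁻ʲ⁻¹` yields the
derivative, in the direction `ν`, of the one with `h⁻ʲ`: multiplication by
`-2j ν · (κ + σ l)`, with the Minkowski product. -/
def momentumDerivative (σ : ℝ) (j : ℕ) (ν κ : Fin 4 → ℂ) : 𝓢(Momentum, ℂ) →L[ℂ] 𝓢(Momentum, ℂ) :=
  ∑ μ, (-(2 * j * metricSign μ * ν μ) : ℂ) •
    (κ μ • ContinuousLinearMap.id ℂ 𝓢(Momentum, ℂ) + (σ : ℂ) • coordMul μ)

lemma momentumDerivative_apply (σ : ℝ) (j : ℕ) (ν κ : Fin 4 → ℂ) (f : 𝓢(Momentum, ℂ)) :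
    momentumDerivative σ j ν κ f =
      ∑ μ, (-(2 * j * metricSign μ * ν μ) : ℂ) • (κ μ • f + (σ : ℂ) • coordMul μ f) := by
  simp [momentumDerivative]

/-- Differentiation under the integral sign along a line in the space of pairs `(k, ε)`. -/
lemma hasDerivAt_regularised_zero (m σ : ℝ) (j : ℕ) (k v : Momentum) {ε : ℝ} (hε : 0 < ε)
    (τ : ℝ) (f : 𝓢(Momentum, ℂ)) :
    HasDerivAt (fun t : ℝ => regularised m σ j (k + t • v) (ε + t * τ) f)
      (regularised m σ (j + 1) k ε
        (momentumDerivative σ j (complexMomentum v τ) (complexMomentum k ε) f)) 0 := by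
  -- for `|t| < δ` the regularisation parameter stays above `ε / 2`
  obtain ⟨δ, hδ, hδ1, hδε⟩ : ∃ δ : ℝ, 0 < δ ∧ δ ≤ 1 ∧ δ * |τ| ≤ ε / 2 := by
    refine ⟨min 1 (ε / 2 / (|τ| + 1)), by positivity, min_le_left _ _, ?_⟩
    have h1 : min 1 (ε / 2 / (|τ| + 1)) ≤ ε / 2 / (|τ| + 1) := min_le_right _ _
    have h2 : ε / 2 / (|τ| + 1) * |τ| ≤ ε / 2 := by
      rw [div_mul_eq_mul_div, div_le_iff₀ (by positivity)]
      nlinarith [abs_nonneg τ]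
    exact (mul_le_mul_of_nonneg_right h1 (abs_nonneg _)).trans h2
  have habs : ∀ t ∈ Metric.ball (0 : ℝ) δ, |t| < δ := fun t ht => by simpa using ht
  have hpos : ∀ t ∈ Metric.ball (0 : ℝ) δ, ε / 2 ≤ ε + t * τ := by
    intro t ht
    have h1 : |t * τ| ≤ ε / 2 := by
      rw [abs_mul]
      exact (mul_le_mul_of_nonneg_right (habs t ht).le (abs_nonneg _)).trans hδε
    linarith [(abs_le.1 h1).1]
  have hpos' : ∀ t ∈ Metric.ball (0 : ℝ) δ, 0 < ε + t * τ := fun t ht =>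
    (half_pos hε).trans_le (hpos t ht)
  set κ : ℝ → Fin 4 → ℂ := fun t => complexMomentum (k + t • v) (ε + t * τ) with hκ
  set ν := complexMomentum v τ with hν
  set F : ℝ → EuclideanSpace ℝ (Fin 3) → ℂ := fun t p =>
    f (onShell m p) * (denominator m σ (κ t) (onShell m p) ^ j)⁻¹ / (2 * shellEnergy m p : ℝ)
    with hF
  set F' : ℝ → EuclideanSpace ℝ (Fin 3) → ℂ := fun t p =>
    momentumDerivative σ j ν (κ t) f (onShell m p) *
      (denominator m σ (κ t) (onShell m p) ^ (j + 1))⁻¹ / (2 * shellEnergy m p : ℝ) with hF'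
  set R : ℝ := ‖k‖ + ‖v‖ + (ε + ε) with hR
  have hκR : ∀ t ∈ Metric.ball (0 : ℝ) δ, ∀ μ, ‖κ t μ‖ ≤ R := by
    intro t ht μ
    refine (norm_complexMomentum_le _ _ μ).trans (add_le_add ?_ ?_)
    · refine (norm_add_le _ _).trans (add_le_add le_rfl ?_)
      rw [norm_smul]
      exact mul_le_of_le_one_left (norm_nonneg _) ((habs t ht).le.trans hδ1)
    · have h1 : |t * τ| ≤ ε / 2 := by
        rw [abs_mul]
        exact (mul_le_mul_of_nonneg_right (habs t ht).le (abs_nonneg _)).trans hδε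
      refine (abs_add_le _ _).trans ?_
      rw [abs_of_pos hε]
      linarith
  set B : EuclideanSpace ℝ (Fin 3) → ℝ := fun p => (((ε / 2) ^ 2) ^ (j + 1))⁻¹ *
    ∑ μ, ‖(2 * j * metricSign μ * ν μ : ℂ)‖ *
      (R * ‖f (onShell m p) / (2 * shellEnergy m p : ℝ)‖ +
        |σ| * ‖coordMul μ f (onShell m p) / (2 * shellEnergy m p : ℝ)‖) with hB
  have hkey := hasDerivAt_integral_of_dominated_loc_of_deriv_le (μ := MeasureTheory.volume)
    (F := F) (F' := F') (x₀ := 0) (bound := B) (Metric.ball_mem_nhds (0 : ℝ) hδ) ?_ ?_ ?_ ?_ ?_ ?_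
  · have e1 : (∫ p, F' 0 p) = regularised m σ (j + 1) k ε
        (momentumDerivative σ j ν (complexMomentum k ε) f) := by
      rw [regularised_apply m σ _ k hε, hF', hκ]
      simp only [zero_smul, add_zero, zero_mul]
      rfl
    rw [← e1]
    refine hkey.2.congr_of_eventuallyEq ?_
    filter_upwards [Metric.ball_mem_nhds (0 : ℝ) hδ] with t ht
    rw [regularised_apply m σ j _ (hpos' t ht)]
    rfl
  · filter_upwards [Metric.ball_mem_nhds (0 : ℝ) hδ] with t ht
    exact (integrable_mul_inv_denominator m σ j (k + t • v) (hpos' t ht) f).aestronglyMeasurable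
  · exact integrable_mul_inv_denominator m σ j (k + (0 : ℝ) • v)
      (hpos' 0 (Metric.mem_ball_self hδ)) f
  · exact (integrable_mul_inv_denominator m σ (j + 1) (k + (0 : ℝ) • v)
      (hpos' 0 (Metric.mem_ball_self hδ)) _).aestronglyMeasurable
  · refine .of_forall fun p t ht => ?_
    have h1 := (pow_le_pow_left₀ (half_pos hε).le (hpos t ht) 2).trans
      (sq_le_norm_denominator m σ (k + t • v) (hpos' t ht) (onShell m p))
    have h2 : ‖momentumDerivative σ j ν (κ t) f (onShell m p)‖ ≤
        ∑ μ, ‖(2 * j * metricSign μ * ν μ : ℂ)‖ *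
          (R * ‖f (onShell m p)‖ + |σ| * ‖coordMul μ f (onShell m p)‖) := by
      rw [momentumDerivative_apply, sum_apply]
      refine norm_sum_le_of_le _ fun μ _ => ?_
      rw [smul_apply, norm_smul, norm_neg]
      refine mul_le_mul_of_nonneg_left ?_ (norm_nonneg _)
      rw [add_apply, smul_apply, smul_apply]
      refine (norm_add_le _ _).trans (add_le_add ?_ ?_)
      · rw [norm_smul]
        exact mul_le_mul_of_nonneg_right (hκR t ht μ) (norm_nonneg _)
      · rw [norm_smul, Complex.norm_real, Real.norm_eq_abs]
    have h3 : B p = (∑ μ, ‖(2 * j * metricSign μ * ν μ : ℂ)‖ *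
          (R * ‖f (onShell m p)‖ + |σ| * ‖coordMul μ f (onShell m p)‖)) *
            (((ε / 2) ^ 2) ^ (j + 1))⁻¹ / ‖((2 * shellEnergy m p : ℝ) : ℂ)‖ := by
      rw [hB]
      simp only [norm_div, Finset.mul_sum, Finset.sum_mul, Finset.sum_div]
      refine Finset.sum_congr rfl fun μ _ => ?_
      ring
    rw [h3, hF']
    simp only
    rw [norm_div, norm_mul, norm_inv, norm_pow]
    have : 0 < ((ε / 2) ^ 2) ^ (j + 1) := by positivity
    gcongr
  · refine (MeasureTheory.integrable_finsetSum _ fun μ _ =>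
      (((integrable_shell m f).norm.const_mul R).add
        ((integrable_shell m (coordMul μ f)).norm.const_mul |σ|)).const_mul _).const_mul _
  · refine .of_forall fun p t ht => ?_
    have hne := denominator_ne_zero m σ (k + t • v) (hpos' t ht) (onShell m p)
    have hd : HasDerivAt (fun t => denominator m σ (κ t) (onShell m p))
        (∑ μ, metricSign μ * (2 * (κ t μ + σ * onShell m p μ) * ν μ)) t := by
      unfold denominator
      refine (HasDerivAt.fun_sum fun μ _ => ?_).sub_const _
      have h1 : HasDerivAt (fun t : ℝ => κ t μ) (ν μ) t := by
        have h2 : (fun t : ℝ => κ t μ) = fun t : ℝ => complexMomentum k ε μ + (t : ℂ) * ν μ :=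
          funext fun t => complexMomentum_add_smul k v ε τ t μ
        rw [h2]
        simpa using ((Complex.ofRealCLM.hasDerivAt (x := t)).mul_const (ν μ)).const_add
          (complexMomentum k ε μ)
      simpa using ((h1.add_const ((σ : ℂ) * onShell m p μ)).pow 2).const_mul (metricSign μ : ℂ)
    set S := ∑ μ, (metricSign μ : ℂ) * (2 * (κ t μ + σ * onShell m p μ) * ν μ) with hS
    have h3 := ((hd.pow j).inv (pow_ne_zero j hne)).const_mul (f (onShell m p)) |>.div_const
      ((2 * shellEnergy m p : ℝ) : ℂ)
    refine h3.congr_deriv ?_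
    rw [hF']
    simp only
    congr 1
    rw [momentumDerivative_apply, sum_apply]
    have h4 : (∑ μ, ((-(2 * j * metricSign μ * ν μ) : ℂ) •
        (κ t μ • f + (σ : ℂ) • coordMul μ f)) (onShell m p)) = -j * (f (onShell m p) * S) := by
      rw [hS]
      simp only [smul_apply, add_apply, coordMul_apply, smul_eq_mul]
      rw [Finset.mul_sum, Finset.mul_sum]
      refine Finset.sum_congr rfl fun μ _ => ?_
      ring
    rw [h4]
    rcases j with _ | j
    · simp
    · rw [Nat.add_sub_cancel]
      simp only [Pi.pow_apply]
      change denominator m σ (κ t) (onShell m p) ≠ 0 at hne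
      field_simp
      ring

lemma hasDerivAt_regularised (m σ : ℝ) (j : ℕ) (k v : Momentum) {ε τ t : ℝ}
    (hε : 0 < ε + t * τ) (f : 𝓢(Momentum, ℂ)) :
    HasDerivAt (fun t : ℝ => regularised m σ j (k + t • v) (ε + t * τ) f)
      (regularised m σ (j + 1) (k + t • v) (ε + t * τ)
        (momentumDerivative σ j (complexMomentum v τ)
          (complexMomentum (k + t • v) (ε + t * τ)) f)) t := by
  have h := hasDerivAt_regularised_zero m σ j (k + t • v) v hε τ f
  rw [← sub_self t] at h
  refine (h.comp_sub_const t t).congr_of_eventuallyEq (.of_forall fun s => ?_)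
  simp only
  rw [add_assoc, ← add_smul, add_assoc, ← add_mul, add_sub_cancel]

lemma seminorm_sum_le (p : Seminorm ℂ 𝓢(Momentum, ℂ)) (f : Fin 4 → 𝓢(Momentum, ℂ)) :
    p (∑ μ, f μ) ≤ ∑ μ, p (f μ) :=
  Finset.le_sum_of_subadditive p (map_zero p).le (map_add_le_add p) _ f

lemma seminorm_momentumDerivative_le {σ : ℝ} (hσ : σ ^ 2 = 1) (j : ℕ)
    (p : Seminorm ℂ 𝓢(Momentum, ℂ)) {R b : ℝ} {ν κ : Fin 4 → ℂ} (hb : 0 ≤ b)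
    (hν : ∀ μ, ‖ν μ‖ ≤ b) (hκ : ∀ μ, ‖κ μ‖ ≤ R) (f : 𝓢(Momentum, ℂ)) :
    p (momentumDerivative σ j ν κ f) ≤
      b * ∑ μ, (2 * j) * (R * p f + p (coordMul μ f)) := by
  have hσn := norm_ofReal_of_sq_eq_one hσ
  rw [momentumDerivative_apply, Finset.mul_sum]
  refine (seminorm_sum_le p _).trans (Finset.sum_le_sum fun μ _ => ?_)
  rw [map_smul_eq_mul, norm_neg, norm_mul, norm_mul, norm_metricSign, norm_mul]
  have h1 : p (κ μ • f + (σ : ℂ) • coordMul μ f) ≤ R * p f + p (coordMul μ f) := by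
    refine (map_add_le_add p _ _).trans (add_le_add ?_ ?_)
    · rw [map_smul_eq_mul]
      exact mul_le_mul_of_nonneg_right (hκ μ) (apply_nonneg _ _)
    · rw [map_smul_eq_mul, hσn, one_mul]
  have h2 : 0 ≤ p (κ μ • f + (σ : ℂ) • coordMul μ f) := apply_nonneg _ _
  have h3 := mul_le_mul (hν μ) h1 h2 hb
  have h4 : (0 : ℝ) ≤ 2 * j := by positivity
  calc _ = (2 * j) * (‖ν μ‖ * p (κ μ • f + (σ : ℂ) • coordMul μ f)) := by simp; ring
    _ ≤ (2 * j) * (b * (R * p f + p (coordMul μ f))) := mul_le_mul_of_nonneg_left h3 h4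
    _ = _ := by ring

lemma seminorm_momentumDerivative_sub_le (σ : ℝ) (j : ℕ)
    (p : Seminorm ℂ 𝓢(Momentum, ℂ)) {b c : ℝ} {ν κ κ' : Fin 4 → ℂ} (hb : 0 ≤ b)
    (hν : ∀ μ, ‖ν μ‖ ≤ b) (hκ : ∀ μ, ‖κ' μ - κ μ‖ ≤ c) (f : 𝓢(Momentum, ℂ)) :
    p (momentumDerivative σ j ν κ' f - momentumDerivative σ j ν κ f) ≤
      (b * c) * ((8 * j) * p f) := by
  have h : momentumDerivative σ j ν κ' f - momentumDerivative σ j ν κ f =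
      ∑ μ, (-(2 * j * metricSign μ * ν μ) * (κ' μ - κ μ) : ℂ) • f := by
    rw [momentumDerivative_apply, momentumDerivative_apply, ← Finset.sum_sub_distrib]
    refine Finset.sum_congr rfl fun μ _ => ?_
    rw [← smul_sub, mul_smul, add_sub_add_right_eq_sub, sub_smul]
  have h2 : ∀ μ, p ((-(2 * j * metricSign μ * ν μ) * (κ' μ - κ μ) : ℂ) • f) ≤
      (2 * j) * (b * c) * p f := by
    intro μ
    rw [map_smul_eq_mul, norm_mul, norm_neg, norm_mul, norm_mul, norm_metricSign, norm_mul]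
    refine mul_le_mul_of_nonneg_right ?_ (apply_nonneg _ _)
    have := mul_le_mul (hν μ) (hκ μ) (norm_nonneg _) hb
    calc _ = (2 * j) * (‖ν μ‖ * ‖κ' μ - κ μ‖) := by simp; ring
      _ ≤ _ := by gcongr
  rw [h]
  refine (seminorm_sum_le p _).trans ((Finset.sum_le_sum fun μ _ => h2 μ).trans (le_of_eq ?_))
  simp
  ring

/-- The derivative in `(k, ε)` of the integrals with `h⁻ʲ` is an integral with `h⁻ʲ⁻¹`, so the
uniform bounds for the latter make the former Lipschitz, with a continuous seminorm as constant. -/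
lemma exists_regularised_lipschitz {m σ : ℝ} (hσ : σ ^ 2 = 1) {k₀ : Momentum} {r : ℝ} (hr : 0 < r)
    (hb : ∀ j : ℕ, ∃ p : Seminorm ℂ 𝓢(Momentum, ℂ), Continuous p ∧ ∀ k ∈ Metric.ball k₀ r,
        ∀ ε ∈ Set.Ioo 0 r, ∀ f, ‖regularised m σ j k ε f‖ ≤ p f) (j : ℕ) :
    ∃ p : Seminorm ℂ 𝓢(Momentum, ℂ), Continuous p ∧ ∀ k ∈ Metric.ball k₀ r,
      ∀ k' ∈ Metric.ball k₀ r, ∀ ε ∈ Set.Ioo 0 r, ∀ ε' ∈ Set.Ioo 0 r, ∀ f,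
        ‖regularised m σ j k' ε' f - regularised m σ j k ε f‖ ≤
          (‖k' - k‖ + |ε' - ε|) * p f := by
  obtain ⟨p, hp, hpb⟩ := hb (j + 1)
  set R : ℝ := ‖k₀‖ + r + r with hR
  have hS : SeminormBounded fun f => ∑ μ : Fin 4, (2 * j) * (R * p f + p (coordMul μ f)) := by
    have h0 : SeminormBounded p := ⟨p, hp, fun _ => le_rfl⟩
    exact .sum _ fun μ => ((h0.const_mul (by positivity)).add (h0.comp (coordMul μ))).const_mul
      (by positivity)
  obtain ⟨q, hq, hqS⟩ := hS
  refine ⟨q, hq, fun k hk k' hk' ε hε ε' hε' f => ?_⟩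
  set G : ℝ → ℂ := fun t => regularised m σ j (k + t • (k' - k)) (ε + t * (ε' - ε)) f with hG
  have hmem : ∀ t ∈ Set.Icc (0 : ℝ) 1, k + t • (k' - k) ∈ Metric.ball k₀ r ∧
      ε + t * (ε' - ε) ∈ Set.Ioo 0 r := fun t ht =>
    ⟨(convex_ball k₀ r).add_smul_sub_mem hk hk' ht, by
      simpa using (convex_Ioo 0 r).add_smul_sub_mem hε hε' ht⟩
  have h := norm_image_sub_le_of_norm_deriv_le_segment_01' (f := G)
    (C := (‖k' - k‖ + |ε' - ε|) * q f)
    (fun t ht => (hasDerivAt_regularised m σ j k (k' - k) (hmem t ht).2.1 f).hasDerivWithinAt)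
    fun t ht => ?_
  · simpa [hG] using h
  · obtain ⟨h1, h2⟩ := hmem t ⟨ht.1, ht.2.le⟩
    refine (hpb _ h1 _ h2 _).trans ?_
    refine (seminorm_momentumDerivative_le hσ j p (R := R) (by positivity)
      (norm_complexMomentum_le _ _) (fun μ => ?_) f).trans
        (mul_le_mul_of_nonneg_left (hqS f) (by positivity))
    refine (norm_complexMomentum_le _ _ μ).trans (add_le_add ?_ ?_)
    · have h3 : ‖k + t • (k' - k) - k₀‖ < r := by rwa [← dist_eq_norm]
      have h4 := norm_le_norm_add_norm_sub' (k + t • (k' - k)) k₀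
      linarith
    · rw [abs_of_pos h2.1]
      exact h2.2.le

/-- First order Taylor expansion in the momentum, with a remainder uniform in `ε`. -/
lemma exists_regularised_taylor {m σ : ℝ} (hσ : σ ^ 2 = 1) {k₀ : Momentum} {r : ℝ} (hr : 0 < r)
    (hb : ∀ j : ℕ, ∃ p : Seminorm ℂ 𝓢(Momentum, ℂ), Continuous p ∧ ∀ k ∈ Metric.ball k₀ r,
        ∀ ε ∈ Set.Ioo 0 r, ∀ f, ‖regularised m σ j k ε f‖ ≤ p f) (j : ℕ) :
    ∃ p : Seminorm ℂ 𝓢(Momentum, ℂ), Continuous p ∧ ∀ k ∈ Metric.ball k₀ r,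
      ∀ k' ∈ Metric.ball k₀ r, ∀ ε ∈ Set.Ioo 0 r, ∀ f,
        ‖regularised m σ j k' ε f - regularised m σ j k ε f - regularised m σ (j + 1) k ε
          (momentumDerivative σ j (complexMomentum (k' - k) 0) (complexMomentum k ε) f)‖ ≤
            ‖k' - k‖ ^ 2 * p f := by
  obtain ⟨p, hp, hpb⟩ := hb (j + 1)
  obtain ⟨p', hp', hpb'⟩ := exists_regularised_lipschitz hσ hr hb (j + 1)
  set R : ℝ := ‖k₀‖ + r + r with hR
  have hS : SeminormBounded fun f =>
      (∑ μ : Fin 4, (2 * j) * (R * p' f + p' (coordMul μ f))) + (8 * j) * p f := by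
    have h0 : SeminormBounded p := ⟨p, hp, fun _ => le_rfl⟩
    have h0' : SeminormBounded p' := ⟨p', hp', fun _ => le_rfl⟩
    exact (SeminormBounded.sum _ fun μ => ((h0'.const_mul (by positivity)).add
      (h0'.comp (coordMul μ))).const_mul (by positivity)).add (h0.const_mul (by positivity))
  obtain ⟨q, hq, hqS⟩ := hS
  refine ⟨q, hq, fun k hk k' hk' ε hε f => ?_⟩
  set v := k' - k with hv
  set ν := complexMomentum v 0 with hν
  have hνb : ∀ μ, ‖ν μ‖ ≤ ‖v‖ := fun μ => by simpa using norm_complexMomentum_le v 0 μ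
  set D := regularised m σ (j + 1) k ε (momentumDerivative σ j ν (complexMomentum k ε) f) with hD
  set G : ℝ → ℂ := fun t => regularised m σ j (k + t • v) (ε + t * 0) f - t • D with hG
  have hmem : ∀ t ∈ Set.Icc (0 : ℝ) 1, k + t • v ∈ Metric.ball k₀ r := fun t ht =>
    (convex_ball k₀ r).add_smul_sub_mem hk hk' ht
  have h := norm_image_sub_le_of_norm_deriv_le_segment_01' (f := G)
    (C := ‖v‖ ^ 2 * q f)
    (fun t ht => ((hasDerivAt_regularised m σ j k v (τ := 0) (ε := ε) (t := t)
      (by simpa using hε.1) f).sub ((hasDerivAt_id t).smul_const D)).hasDerivWithinAt)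
    fun t ht => ?_
  · have e : G 1 - G 0 = regularised m σ j k' ε f - regularised m σ j k ε f - D := by
      simp only [hG, hv]
      simp
      ring
    rwa [e] at h
  · have h1 := hmem t ⟨ht.1, ht.2.le⟩
    simp only [mul_zero, add_zero, one_smul]
    set M := momentumDerivative σ j ν (complexMomentum (k + t • v) ε) f with hM
    set M₀ := momentumDerivative σ j ν (complexMomentum k ε) f with hM₀
    have e : regularised m σ (j + 1) (k + t • v) ε M - D =
        (regularised m σ (j + 1) (k + t • v) ε M - regularised m σ (j + 1) k ε M) +
          regularised m σ (j + 1) k ε (M - M₀) := by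
      rw [map_sub, hD]
      ring
    rw [e]
    have ht1 : ‖t • v‖ ≤ ‖v‖ := by
      rw [norm_smul, Real.norm_of_nonneg ht.1]
      exact mul_le_of_le_one_left (norm_nonneg _) ht.2.le
    have b1 : ‖regularised m σ (j + 1) (k + t • v) ε M - regularised m σ (j + 1) k ε M‖ ≤
        ‖v‖ * (‖v‖ * ∑ μ : Fin 4, (2 * j) * (R * p' f + p' (coordMul μ f))) := by
      refine (hpb' _ hk _ h1 _ hε _ hε M).trans ?_
      rw [add_sub_cancel_left, sub_self, abs_zero, add_zero]
      refine mul_le_mul ht1 ?_ (apply_nonneg _ _) (norm_nonneg _)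
      refine seminorm_momentumDerivative_le hσ j p' (norm_nonneg _) hνb (fun μ => ?_) f
      refine (norm_complexMomentum_le _ _ μ).trans (add_le_add ?_ ?_)
      · have h3 : ‖k + t • v - k₀‖ < r := by rwa [← dist_eq_norm]
        have h4 := norm_le_norm_add_norm_sub' (k + t • v) k₀
        linarith
      · rw [abs_of_pos hε.1]
        exact hε.2.le
    have b2 : ‖regularised m σ (j + 1) k ε (M - M₀)‖ ≤ (‖v‖ * ‖v‖) * ((8 * j) * p f) := by
      refine (hpb _ hk _ hε _).trans
        (seminorm_momentumDerivative_sub_le σ j p (norm_nonneg _) hνb (fun μ => ?_) f)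
      have := complexMomentum_add_smul k v ε 0 t μ
      rw [mul_zero, add_zero] at this
      rw [this, add_sub_cancel_left, norm_mul, Complex.norm_real, Real.norm_of_nonneg ht.1]
      exact (mul_le_of_le_one_left (norm_nonneg _) ht.2.le).trans (hνb μ)
    refine (norm_add_le _ _).trans ((add_le_add b1 b2).trans ?_)
    refine le_trans (le_of_eq ?_) (mul_le_mul_of_nonneg_left (hqS f) (sq_nonneg ‖v‖))
    ring

/-- The limit of the regularised distributions as `ε ↓ 0`; zero if it does not exist. -/
def resolvedShell (m σ : ℝ) (j : ℕ) (k : Momentum) : TemperedDist :=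
  open Classical in
  if h : ∃ T : TemperedDist, ∀ f, Filter.Tendsto (fun ε => regularised m σ j k ε f) (𝓝[>] 0)
    (𝓝 (T f)) then h.choose else 0

/-- On the nonexceptional momenta the limit exists: the regularised distributions are Lipschitz in
`ε` up to `ε = 0`. -/
lemma tendsto_resolvedShell {m σ : ℝ} (hm : 0 ≤ m) (hσ : σ ^ 2 = 1) (j : ℕ) {k : Momentum}
    (hk : k ∈ nonexceptionalMomenta m) (f : 𝓢(Momentum, ℂ)) :
    Filter.Tendsto (fun ε => regularised m σ j k ε f) (𝓝[>] 0) (𝓝 (resolvedShell m σ j k f)) := by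
  suffices h : ∃ T : TemperedDist, ∀ f,
      Filter.Tendsto (fun ε => regularised m σ j k ε f) (𝓝[>] 0) (𝓝 (T f)) by
    rw [resolvedShell, dif_pos h]
    exact h.choose_spec f
  obtain ⟨r, hr, hb⟩ := exists_regularised_bound hm hσ hk
  obtain ⟨p, hp, hpb⟩ := hb j
  obtain ⟨q, hq, hqb⟩ := exists_regularised_lipschitz hσ hr hb j
  have hkr : k ∈ Metric.ball k r := Metric.mem_ball_self hr
  have hIoo : Set.Ioo 0 r ∈ 𝓝[>] (0 : ℝ) := Ioo_mem_nhdsGT hr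
  have hlim : ∀ f, ∃ c, Filter.Tendsto (fun ε => regularised m σ j k ε f) (𝓝[>] 0) (𝓝 c) := by
    intro f
    refine cauchy_map_iff_exists_tendsto.1 ?_
    refine Cauchy.map_of_le (s := Set.Ioo 0 r) (cauchy_nhds.mono nhdsWithin_le_nhds) ?_
      (Filter.le_principal_iff.2 hIoo)
    refine LipschitzOnWith.uniformContinuousOn (K := (q f).toNNReal) ?_
    refine LipschitzOnWith.of_dist_le_mul fun ε hε ε' hε' => ?_
    rw [dist_eq_norm, Real.coe_toNNReal _ (apply_nonneg _ _), Real.dist_eq, mul_comm]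
    simpa using hqb k hkr k hkr ε' hε' ε hε f
  choose c hc using hlim
  refine ⟨temperedOfBound
    { toFun := c
      map_add' := fun f g => tendsto_nhds_unique (hc (f + g))
        (((hc f).add (hc g)).congr fun ε => (map_add _ f g).symm)
      map_smul' := fun a f => tendsto_nhds_unique (hc (a • f))
        (((hc f).const_smul a).congr fun ε => (map_smul _ a f).symm) } ⟨p, hp, fun f => ?_⟩, hc⟩
  refine le_of_tendsto (hc f).norm ?_
  filter_upwards [hIoo] with ε hε using hpb k hkr ε hε f

lemma tendsto_momentumDerivative (σ : ℝ) (j : ℕ) (v k : Momentum) (T : ℝ → TemperedDist)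
    (T₀ : TemperedDist) (hT : ∀ f, Filter.Tendsto (fun ε => T ε f) (𝓝[>] 0) (𝓝 (T₀ f)))
    (f : 𝓢(Momentum, ℂ)) :
    Filter.Tendsto (fun ε => T ε (momentumDerivative σ j (complexMomentum v 0)
      (complexMomentum k ε) f)) (𝓝[>] 0)
      (𝓝 (T₀ (momentumDerivative σ j (complexMomentum v 0) (complexMomentum k 0) f))) := by
  simp only [momentumDerivative_apply, map_sum, map_smul, map_add]
  refine tendsto_finsetSum _ fun μ _ => ((Filter.Tendsto.smul ?_ (hT f)).add
    ((hT _).const_smul _)).const_smul _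
  have h : Continuous fun ε : ℝ => complexMomentum k ε μ := by
    unfold complexMomentum
    split_ifs <;> fun_prop
  exact (h.tendsto 0).mono_left nhdsWithin_le_nhds

/-- The derivative of `resolvedShell` composed with an operator on test functions. -/
lemma momentumDerivative_comp_eq (m σ : ℝ) (j : ℕ) (v k : Momentum)
    (A : 𝓢(Momentum, ℂ) →L[ℂ] 𝓢(Momentum, ℂ)) (f : 𝓢(Momentum, ℂ)) :
    resolvedShell m σ (j + 1) k
      (momentumDerivative σ j (complexMomentum v 0) (complexMomentum k 0) (A f)) =
    (∑ μ, (-(2 * j * metricSign μ * v μ) : ℝ) • (k μ • (resolvedShell m σ (j + 1) k ∘L A) +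
      σ • (resolvedShell m σ (j + 1) k ∘L (coordMul μ ∘L A)))) f := by
  rw [momentumDerivative_apply, map_sum, sum_apply]
  refine Finset.sum_congr rfl fun μ _ => ?_
  simp only [complexMomentum_zero, map_smul, map_add, smul_apply, add_apply,
    ContinuousLinearMap.comp_apply,
    smul_eq_mul, Complex.real_smul]
  push_cast
  ring

/-- The limit depends smoothly on the momentum, in the strong topology. -/
lemma isContDiffOn_resolvedShell {m σ : ℝ} (hm : 0 ≤ m) (hσ : σ ^ 2 = 1) (n j : ℕ)
    (A : 𝓢(Momentum, ℂ) →L[ℂ] 𝓢(Momentum, ℂ)) :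
    IsContDiffOn n (fun k => resolvedShell m σ j k ∘L A) (nonexceptionalMomenta m) := by
  have hcont : ∀ j (A : 𝓢(Momentum, ℂ) →L[ℂ] 𝓢(Momentum, ℂ)),
      ContinuousOn (fun k => resolvedShell m σ j k ∘L A) (nonexceptionalMomenta m) := by
    intro j A k hk
    obtain ⟨r, hr, hb⟩ := exists_regularised_bound hm hσ hk
    obtain ⟨q, hq, hqb⟩ := exists_regularised_lipschitz hσ hr hb j
    refine tendsto_temperedDist_of_norm_le (p := q.comp A.toLinearMap) (hq.comp A.continuous)
      (δ := fun k' => ‖k' - k‖) ?_ ?_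
    · have : Continuous fun k' : Momentum => ‖k' - k‖ := by fun_prop
      simpa using (this.tendsto k).mono_left (nhdsWithin_le_nhds (s := nonexceptionalMomenta m))
    · filter_upwards [self_mem_nhdsWithin, mem_nhdsWithin_of_mem_nhds (Metric.ball_mem_nhds k hr)]
        with k' hk' hk'r f
      refine le_of_tendsto ((tendsto_resolvedShell hm hσ j hk' (A f)).sub
        (tendsto_resolvedShell hm hσ j hk (A f))).norm ?_
      filter_upwards [Ioo_mem_nhdsGT hr] with ε hε
      simpa using hqb k (Metric.mem_ball_self hr) k' hk'r ε hε ε hε (A f)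
  induction n generalizing j A with
  | zero => exact hcont j A
  | succ n ih =>
    refine ⟨hcont j A, fun v => ⟨fun k => ∑ μ, (-(2 * j * metricSign μ * v μ) : ℝ) •
      (k μ • (resolvedShell m σ (j + 1) k ∘L A) +
        σ • (resolvedShell m σ (j + 1) k ∘L (coordMul μ ∘L A))), fun k hk => ?_, ?_⟩⟩
    · obtain ⟨r, hr, hb⟩ := exists_regularised_bound hm hσ hk
      obtain ⟨q, hq, hqb⟩ := exists_regularised_taylor hσ hr hb j
      refine tendsto_temperedDist_of_norm_le (p := q.comp A.toLinearMap) (hq.comp A.continuous)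
        (δ := fun t : ℝ => |t| * ‖v‖ ^ 2) ?_ ?_
      · have : Continuous fun t : ℝ => |t| * ‖v‖ ^ 2 := by fun_prop
        simpa using (this.tendsto 0).mono_left (nhdsWithin_le_nhds (s := {0}ᶜ))
      · have hline : Filter.Tendsto (fun t : ℝ => k + t • v) (𝓝[≠] 0) (𝓝 k) := by
          have : Continuous fun t : ℝ => k + t • v := by fun_prop
          simpa using (this.tendsto 0).mono_left (nhdsWithin_le_nhds (s := {0}ᶜ))
        filter_upwards [self_mem_nhdsWithin, hline.eventually (Metric.ball_mem_nhds k hr),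
          hline.eventually ((isOpen_nonexceptionalMomenta m).mem_nhds hk)] with t ht hkr hkU f
        have ht : t ≠ 0 := ht
        rw [← momentumDerivative_comp_eq]
        have hlin : ∀ κ, momentumDerivative σ j (complexMomentum (t • v) 0) κ (A f) =
            (t : ℂ) • momentumDerivative σ j (complexMomentum v 0) κ (A f) := by
          intro κ
          rw [momentumDerivative_apply, momentumDerivative_apply, Finset.smul_sum]
          refine Finset.sum_congr rfl fun μ _ => ?_
          have : complexMomentum (t • v) 0 μ = t * complexMomentum v 0 μ := by
            simp [complexMomentum_zero]
          rw [this, smul_smul]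
          congr 1
          ring
        have key : ‖resolvedShell m σ j (k + t • v) (A f) - resolvedShell m σ j k (A f) -
            t * resolvedShell m σ (j + 1) k
              (momentumDerivative σ j (complexMomentum v 0) (complexMomentum k 0) (A f))‖ ≤
            ‖t • v‖ ^ 2 * q (A f) := by
          refine le_of_tendsto (((tendsto_resolvedShell hm hσ j hkU (A f)).sub
            (tendsto_resolvedShell hm hσ j hk (A f))).sub ((tendsto_momentumDerivative σ j v k _ _
              (tendsto_resolvedShell hm hσ (j + 1) hk) (A f)).const_mul (t : ℂ))).norm ?_
          filter_upwards [Ioo_mem_nhdsGT hr] with ε hε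
          have := hqb k (Metric.mem_ball_self hr) (k + t • v) hkr ε hε (A f)
          rw [add_sub_cancel_left, hlin, map_smul, smul_eq_mul] at this
          exact this
        have htc : (t : ℂ) ≠ 0 := by exact_mod_cast ht
        have e : (t⁻¹ • (resolvedShell m σ j (k + t • v) ∘L A - resolvedShell m σ j k ∘L A)) f -
            resolvedShell m σ (j + 1) k
              (momentumDerivative σ j (complexMomentum v 0) (complexMomentum k 0) (A f)) =
            (t : ℂ)⁻¹ * (resolvedShell m σ j (k + t • v) (A f) - resolvedShell m σ j k (A f) -
            t * resolvedShell m σ (j + 1) k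
              (momentumDerivative σ j (complexMomentum v 0) (complexMomentum k 0) (A f))) := by
          simp only [smul_apply, sub_apply, ContinuousLinearMap.comp_apply, Complex.real_smul]
          push_cast
          field_simp
        rw [e, norm_mul, norm_inv, Complex.norm_real, Real.norm_eq_abs,
          inv_mul_le_iff₀ (abs_pos.2 ht)]
        refine key.trans (le_of_eq ?_)
        rw [norm_smul, Real.norm_eq_abs]
        change _ = |t| * (|t| * ‖v‖ ^ 2 * q (A f))
        ring
    · exact .sum _ Finset.univ_nonempty fun μ _ =>
        ((IsContDiffOn.coord_smul μ (isOpen_nonexceptionalMomenta m) (ih (j + 1) A)).add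
          ((ih (j + 1) (coordMul μ ∘L A)).const_smul σ)).const_smul _

/-! ### Families of smooth functions with uniformly bounded derivatives -/

/-- The partial derivative of an arbitrary function on momentum space; `partialD` is its analogue
for bundled Schwartz functions. -/
def pd (μ : Fin 4) (F : Momentum → ℂ) (l : Momentum) : ℂ :=
  fderiv ℝ F l (EuclideanSpace.single μ (1 : ℝ))

/-- A family of functions that are smooth on `V` and whose iterated partial derivatives up to order
`n` are bounded on `V`, uniformly in the family. -/
def BoundedFamily {I : Type*} (V : Set Momentum) : ℕ → (I → Momentum → ℂ) → Prop
  | 0, φ => (∀ i, ContDiffOn ℝ (⊤ : ℕ∞) (φ i) V) ∧ ∃ C, ∀ i, ∀ l ∈ V, ‖φ i l‖ ≤ C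
  | n + 1, φ => ((∀ i, ContDiffOn ℝ (⊤ : ℕ∞) (φ i) V) ∧ ∃ C, ∀ i, ∀ l ∈ V, ‖φ i l‖ ≤ C) ∧
      ∀ μ, BoundedFamily V n fun i => pd μ (φ i)

lemma ContDiff.pd {F : Momentum → ℂ} (hF : ContDiff ℝ (⊤ : ℕ∞) F) (μ : Fin 4) :
    ContDiff ℝ (⊤ : ℕ∞) (pd μ F) :=
  (hF.fderiv_right (m := (⊤ : ℕ∞)) (by exact_mod_cast le_top)).clm_apply contDiff_const

lemma pd_mul {F G : Momentum → ℂ} {l : Momentum} (hF : DifferentiableAt ℝ F l)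
    (hG : DifferentiableAt ℝ G l) (μ : Fin 4) :
    pd μ (fun l => F l * G l) l = pd μ F l * G l + F l * pd μ G l := by
  unfold pd
  rw [(hF.hasFDerivAt.fun_mul hG.hasFDerivAt).fderiv]
  simp only [add_apply, FunLike.coe_smul, Pi.smul_apply, smul_eq_mul]
  ring

lemma tsupport_pd_subset (μ : Fin 4) (F : Momentum → ℂ) : tsupport (pd μ F) ⊆ tsupport F :=
  tsupport_fderiv_apply_subset ℝ _

lemma pd_coord (μ ν : Fin 4) (l : Momentum) :
    pd μ (fun l => ((l ν : ℝ) : ℂ)) l = if μ = ν then 1 else 0 := by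
  unfold pd
  rw [(hasFDerivAt_coord ν l).fderiv]
  by_cases h : μ = ν
  · simp [h]
  · simp [h, Ne.symm h]

namespace BoundedFamily

variable {I : Type*} {V : Set Momentum} {φ ψ : I → Momentum → ℂ} {n : ℕ}

lemma level_zero (h : BoundedFamily V n φ) : BoundedFamily V 0 φ := by
  cases n with
  | zero => exact h
  | succ n => exact h.1

lemma contDiffOn (h : BoundedFamily V n φ) (i : I) : ContDiffOn ℝ (⊤ : ℕ∞) (φ i) V :=
  h.level_zero.1 i

lemma differentiableAt (h : BoundedFamily V n φ) (hV : IsOpen V) (i : I) {l : Momentum}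
    (hl : l ∈ V) : DifferentiableAt ℝ (φ i) l :=
  ((h.contDiffOn i).contDiffAt (hV.mem_nhds hl)).differentiableAt (by simp)

lemma of_succ (h : BoundedFamily V (n + 1) φ) : BoundedFamily V n φ := by
  induction n generalizing φ with
  | zero => exact h.1
  | succ n ih => exact ⟨h.1, fun μ => ih (h.2 μ)⟩

lemma congr (hV : IsOpen V) (h : BoundedFamily V n φ) (hφψ : ∀ i, ∀ l ∈ V, ψ i l = φ i l) :
    BoundedFamily V n ψ := by
  have h0 : ∀ {φ ψ : I → Momentum → ℂ}, BoundedFamily V 0 φ →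
      (∀ i, ∀ l ∈ V, ψ i l = φ i l) → BoundedFamily V 0 ψ := by
    rintro φ ψ ⟨h1, C, hC⟩ hφψ
    exact ⟨fun i => (h1 i).congr (hφψ i), C, fun i l hl => by rw [hφψ i l hl]; exact hC i l hl⟩
  induction n generalizing φ ψ with
  | zero => exact h0 h hφψ
  | succ n ih =>
    refine ⟨h0 h.1 hφψ, fun μ => ih (h.2 μ) fun i l hl => ?_⟩
    have : ψ i =ᶠ[𝓝 l] φ i := Filter.eventually_of_mem (hV.mem_nhds hl) (hφψ i)
    unfold pd
    rw [this.fderiv_eq]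

lemma reindex {J : Type*} (e : J → I) (h : BoundedFamily V n φ) :
    BoundedFamily V n fun j => φ (e j) := by
  induction n generalizing φ with
  | zero =>
    obtain ⟨h1, C, hC⟩ := h
    exact ⟨fun j => h1 (e j), C, fun j => hC (e j)⟩
  | succ n ih =>
    obtain ⟨⟨h1, C, hC⟩, h2⟩ := h
    exact ⟨⟨fun j => h1 (e j), C, fun j => hC (e j)⟩, fun μ => ih (h2 μ)⟩

lemma mono {W : Set Momentum} (hW : W ⊆ V) (h : BoundedFamily V n φ) : BoundedFamily W n φ := by
  induction n generalizing φ with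
  | zero =>
    obtain ⟨h1, C, hC⟩ := h
    exact ⟨fun i => (h1 i).mono hW, C, fun i l hl => hC i l (hW hl)⟩
  | succ n ih =>
    obtain ⟨⟨h1, C, hC⟩, h2⟩ := h
    exact ⟨⟨fun i => (h1 i).mono hW, C, fun i l hl => hC i l (hW hl)⟩, fun μ => ih (h2 μ)⟩

lemma const {c : I → ℂ} {C : ℝ} (hc : ∀ i, ‖c i‖ ≤ C) : BoundedFamily V n fun i _ => c i := by
  have hpd : ∀ μ, (fun i => pd μ fun _ => c i) = fun (_ : I) (_ : Momentum) => (0 : ℂ) := by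
    intro μ
    funext i l
    simp [pd]
  induction n generalizing c C with
  | zero => exact ⟨fun i => contDiffOn_const, C, fun i l _ => hc i⟩
  | succ n ih =>
    refine ⟨⟨fun i => contDiffOn_const, C, fun i l _ => hc i⟩, fun μ => ?_⟩
    rw [hpd μ]
    refine ih (C := 0) (by simp) fun μ => ?_
    funext i l
    simp [pd]

lemma add (hV : IsOpen V) (hφ : BoundedFamily V n φ) (hψ : BoundedFamily V n ψ) :
    BoundedFamily V n fun i l => φ i l + ψ i l := by
  have h0 : ∀ {φ ψ : I → Momentum → ℂ}, BoundedFamily V 0 φ → BoundedFamily V 0 ψ →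
      BoundedFamily V 0 fun i l => φ i l + ψ i l := by
    rintro φ ψ ⟨h1, C, hC⟩ ⟨h2, D, hD⟩
    exact ⟨fun i => (h1 i).add (h2 i), C + D,
      fun i l hl => (norm_add_le _ _).trans (add_le_add (hC i l hl) (hD i l hl))⟩
  induction n generalizing φ ψ with
  | zero => exact h0 hφ hψ
  | succ n ih =>
    refine ⟨h0 hφ.1 hψ.1, fun μ => (ih (hφ.2 μ) (hψ.2 μ)).congr hV fun i l hl => ?_⟩
    unfold pd
    rw [fderiv_fun_add (hφ.differentiableAt hV i hl) (hψ.differentiableAt hV i hl)]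
    rfl

lemma mul (hV : IsOpen V) (hφ : BoundedFamily V n φ) (hψ : BoundedFamily V n ψ) :
    BoundedFamily V n fun i l => φ i l * ψ i l := by
  have h0 : ∀ {φ ψ : I → Momentum → ℂ}, BoundedFamily V 0 φ → BoundedFamily V 0 ψ →
      BoundedFamily V 0 fun i l => φ i l * ψ i l := by
    rintro φ ψ ⟨h1, C, hC⟩ ⟨h2, D, hD⟩
    refine ⟨fun i => (h1 i).mul (h2 i), C * D, fun i l hl => ?_⟩
    rw [norm_mul]
    exact mul_le_mul (hC i l hl) (hD i l hl) (norm_nonneg _)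
      ((norm_nonneg _).trans (hC i l hl))
  induction n generalizing φ ψ with
  | zero => exact h0 hφ hψ
  | succ n ih =>
    refine ⟨h0 hφ.1 hψ.1, fun μ => ((ih (hφ.2 μ) hψ.of_succ).add hV
      (ih hφ.of_succ (hψ.2 μ))).congr hV fun i l hl => ?_⟩
    exact pd_mul (hφ.differentiableAt hV i hl) (hψ.differentiableAt hV i hl) μ

lemma sum (hV : IsOpen V) {φ : Fin 4 → I → Momentum → ℂ}
    (hφ : ∀ μ, BoundedFamily V n (φ μ)) : BoundedFamily V n fun i l => ∑ μ, φ μ i l := by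
  simp only [Fin.sum_univ_four]
  exact (((hφ 0).add hV (hφ 1)).add hV (hφ 2)).add hV (hφ 3)

lemma inv (hV : IsOpen V) {δ : ℝ} (hδ : 0 < δ) (hφ : ∀ n, BoundedFamily V n φ)
    (h : ∀ i, ∀ l ∈ V, δ ≤ ‖φ i l‖) : BoundedFamily V n fun i l => (φ i l)⁻¹ := by
  have hne : ∀ i, ∀ l ∈ V, φ i l ≠ 0 := fun i l hl => norm_pos_iff.1 (hδ.trans_le (h i l hl))
  have h0 : BoundedFamily V 0 fun i l => (φ i l)⁻¹ := by
    refine ⟨fun i => ((hφ 0).1 i).inv (hne i), δ⁻¹, fun i l hl => ?_⟩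
    rw [norm_inv]
    exact inv_anti₀ hδ (h i l hl)
  induction n with
  | zero => exact h0
  | succ n ih =>
    refine ⟨h0, fun μ => (((const (c := fun _ : I => (-1 : ℂ)) (fun _ => le_rfl)).mul hV
      (ih.mul hV ih)).mul hV ((hφ (n + 1)).2 μ)).congr hV fun i l hl => ?_⟩
    have hd := ((hφ 0).differentiableAt hV i hl).hasFDerivAt
    have h2 := (hasDerivAt_inv (hne i l hl)).comp_hasFDerivAt l hd
    change fderiv ℝ (Inv.inv ∘ φ i) l _ = _
    rw [h2.fderiv]
    simp only [pd, smul_apply, smul_eq_mul, sq, mul_inv]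
    ring

lemma coord (hV : Bornology.IsBounded V) (ν : Fin 4) :
    BoundedFamily V n fun (_ : I) l => ((l ν : ℝ) : ℂ) := by
  obtain ⟨C, hC⟩ := hV.exists_norm_le
  have h0 : BoundedFamily V 0 fun (_ : I) l => ((l ν : ℝ) : ℂ) := by
    refine ⟨fun _ => (Complex.ofRealCLM.comp
      (EuclideanSpace.proj ν : Momentum →L[ℝ] ℝ)).contDiff.contDiffOn, C, fun _ l hl => ?_⟩
    rw [Complex.norm_real]
    exact (PiLp.norm_apply_le l ν).trans (hC l hl)
  cases n with
  | zero => exact h0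
  | succ n =>
    refine ⟨h0, fun μ => ?_⟩
    have : (fun (_ : I) => pd μ fun l => ((l ν : ℝ) : ℂ)) =
        fun (_ : I) _ => if μ = ν then 1 else 0 := by
      funext _ l
      exact pd_coord μ ν l
    rw [this]
    exact const (C := 1) fun _ => by split_ifs <;> simp

end BoundedFamily

/-! ### Decay of oscillatory pairings -/

/-- The oscillating factor `e^{-2πi⟨l, η⟩}`. -/
def osc (η l : Momentum) : ℂ := (𝐞 (-inner ℝ l η) : ℂ)

lemma osc_eq (η : Momentum) :
    osc η = fun l => Complex.exp (-(2 * Real.pi * Complex.I) * ∑ μ, (l μ : ℂ) * η μ) := by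
  funext l
  unfold osc
  rw [Real.fourierChar_apply, PiLp.inner_apply]
  congr 1
  simp only [RCLike.inner_apply, conj_trivial]
  push_cast
  simp only [mul_comm (η _ : ℂ)]
  ring

lemma norm_osc (η l : Momentum) : ‖osc η l‖ = 1 := Circle.norm_coe _

lemma contDiff_osc (η : Momentum) : ContDiff ℝ (⊤ : ℕ∞) (osc η) :=
  (hasTemperateGrowth_char η).1

lemma pd_osc (η : Momentum) (μ : Fin 4) (l : Momentum) :
    pd μ (osc η) l = -(2 * Real.pi * Complex.I) * η μ * osc η l := by
  have h1 : HasFDerivAt (fun l : Momentum => ∑ μ, (l μ : ℂ) * η μ) (∑ μ, (η μ : ℂ) •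
      (Complex.ofRealCLM.comp (EuclideanSpace.proj μ : Momentum →L[ℝ] ℝ))) l :=
    HasFDerivAt.fun_sum fun μ _ => (hasFDerivAt_coord μ l).mul_const (η μ : ℂ)
  have h2 := (h1.const_mul (-(2 * Real.pi * Complex.I))).cexp
  unfold pd
  rw [osc_eq, h2.fderiv]
  simp only [smul_apply, sum_apply, ContinuousLinearMap.comp_apply,
    Complex.ofRealCLM_apply, PiLp.proj_apply, smul_eq_mul]
  have hsum : ∑ ν, (η ν : ℂ) *
      (((EuclideanSpace.single μ (1 : ℝ) : Momentum) ν : ℝ) : ℂ) = η μ := by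
    rw [Finset.sum_eq_single μ]
    · simp
    · intro ν _ hν
      simp [hν]
    · simp
  rw [hsum]
  ring

/-- The functionals `T ε` are rapidly decreasing at `x` in the direction `ζ`, uniformly in small
`ε > 0`: for all test functions `χ` supported near `x`, the pairings with `e^{-2πi⟨·, η⟩} χ` are
rapidly decreasing for `η` in an open cone containing `ζ`. -/
def RapidDecay (T : ℝ → (Momentum → ℂ) → ℂ) (x ζ : Momentum) : Prop :=
  ∃ V ∈ 𝓝 x, ∃ ε₀ > 0, ∃ Γ : Set Momentum, IsOpen Γ ∧ ζ ∈ Γ ∧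
    (∀ t : ℝ, 0 < t → ∀ η ∈ Γ, t • η ∈ Γ) ∧
    ∀ χ : 𝓢(Momentum, ℂ), HasCompactSupport χ → tsupport χ ⊆ V → ∀ N : ℕ, ∃ C : ℝ,
      ∀ ε ∈ Set.Ioo 0 ε₀, ∀ η ∈ Γ, (1 + ‖η‖) ^ N * ‖T ε fun l => osc η l * χ l‖ ≤ C

lemma pd_osc_mul (η : Momentum) {F : Momentum → ℂ} {l : Momentum} (hF : DifferentiableAt ℝ F l)
    (μ : Fin 4) : pd μ (fun l => osc η l * F l) l =
      osc η l * (pd μ F l + -(2 * Real.pi * Complex.I) * η μ * F l) := by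
  rw [pd_mul ((contDiff_osc η).differentiable (by simp) l) hF, pd_osc]
  ring

lemma pd_eq_zero_of_notMem {F : Momentum → ℂ} {l : Momentum} (hl : l ∉ tsupport F) (μ : Fin 4) :
    pd μ F l = 0 :=
  image_eq_zero_of_notMem_tsupport fun h => hl (tsupport_pd_subset μ F h)

lemma BoundedFamily.contDiff {I : Type*} {V : Set Momentum} {n : ℕ} {φ : I → Momentum → ℂ}
    (h : BoundedFamily V n φ) (hV : IsOpen V) {i : I} (hi : tsupport (φ i) ⊆ V) :
    ContDiff ℝ (⊤ : ℕ∞) (φ i) := by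
  refine contDiff_iff_contDiffAt.2 fun l => ?_
  by_cases hl : l ∈ tsupport (φ i)
  · exact (h.contDiffOn i).contDiffAt (hV.mem_nhds (hi hl))
  · exact contDiffAt_const.congr_of_eventuallyEq (notMem_tsupport_iff_eventuallyEq.1 hl)

/-- Three energy derivatives of `e^{-2πi⟨·, η⟩} g` cost at most a factor `(1 + ‖η‖)³`. -/
lemma exists_bound_osc_mul {I : Type*} {V K : Set Momentum} (hV : IsOpen V) (hKV : K ⊆ V)
    {η : I → Momentum} {g : I → Momentum → ℂ} (hg : ∀ n, BoundedFamily V n g)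
    (hgK : ∀ i, tsupport (g i) ⊆ K) : ∃ A : ℝ, ∀ i l,
      ‖osc (η i) l * g i l‖ ≤ A * (1 + ‖η i‖) ^ 3 ∧
      ‖pd 0 (pd 0 (pd 0 fun l => osc (η i) l * g i l)) l‖ ≤ A * (1 + ‖η i‖) ^ 3 := by
  have hstep : ∀ g : I → Momentum → ℂ, (∀ n, BoundedFamily V n g) → (∀ i, tsupport (g i) ⊆ K) →
      ∃ g' : I → Momentum → ℂ, (∀ n, BoundedFamily V n g') ∧ (∀ i, tsupport (g' i) ⊆ K) ∧
        ∀ i (c : ℂ), (pd 0 fun l => c * (osc (η i) l * g i l)) =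
          fun l => (c * (1 + ‖η i‖ : ℝ)) * (osc (η i) l * g' i l) := by
    intro g hg hgK
    have hc1 : ∀ i, ‖(((1 + ‖η i‖)⁻¹ : ℝ) : ℂ)‖ ≤ 1 := fun i => by
      rw [Complex.norm_real, Real.norm_of_nonneg (by positivity)]
      exact inv_le_one_of_one_le₀ (by linarith [norm_nonneg (η i)])
    have hc2 : ∀ i, ‖(((1 + ‖η i‖)⁻¹ : ℝ) : ℂ) * (-(2 * Real.pi * Complex.I) * η i 0)‖ ≤
        2 * Real.pi := fun i => by
      rw [norm_mul, norm_mul, norm_neg, Complex.norm_real, Complex.norm_real,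
        Real.norm_of_nonneg (by positivity : (0 : ℝ) ≤ (1 + ‖η i‖)⁻¹)]
      have h1 : ‖(2 * Real.pi * Complex.I : ℂ)‖ = 2 * Real.pi := by
        simp [abs_of_pos Real.pi_pos]
      have h2 : ‖η i 0‖ ≤ 1 + ‖η i‖ := (PiLp.norm_apply_le (η i) 0).trans (by linarith)
      rw [h1, inv_mul_le_iff₀ (by positivity), mul_comm]
      exact mul_le_mul_of_nonneg_right h2 (by positivity)
    refine ⟨fun i l => ((1 + ‖η i‖)⁻¹ : ℝ) * pd 0 (g i) l +
      (((1 + ‖η i‖)⁻¹ : ℝ) * (-(2 * Real.pi * Complex.I) * η i 0)) * g i l, fun n => ?_,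
      fun i => ?_, fun i c => ?_⟩
    · exact ((BoundedFamily.const hc1).mul hV ((hg (n + 1)).2 0)).add hV
        ((BoundedFamily.const hc2).mul hV (hg n))
    · refine closure_minimal (fun l hl => ?_) (isClosed_tsupport _) |>.trans (hgK i)
      by_contra h
      refine hl ?_
      simp only
      rw [pd_eq_zero_of_notMem h, image_eq_zero_of_notMem_tsupport h, mul_zero, mul_zero, add_zero]
    · funext l
      have hd : DifferentiableAt ℝ (g i) l :=
        ((hg 0).contDiff hV ((hgK i).trans hKV)).differentiable (by simp) l
      have h1 : pd 0 (fun l => c * (osc (η i) l * g i l)) l =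
          c * pd 0 (fun l => osc (η i) l * g i l) l := by
        rw [pd_mul (F := fun _ => c) (G := fun l => osc (η i) l * g i l) (differentiableAt_const c)
          (((contDiff_osc _).differentiable (by simp) l).mul hd)]
        simp [pd]
      have h2 : ((1 + ‖η i‖ : ℝ) : ℂ) ≠ 0 := by
        exact_mod_cast (by positivity : (0 : ℝ) < 1 + ‖η i‖).ne'
      rw [h1, pd_osc_mul _ hd]
      push_cast at h2 ⊢
      field_simp
  obtain ⟨g1, b1, s1, e1⟩ := hstep g hg hgK
  obtain ⟨g2, b2, s2, e2⟩ := hstep g1 b1 s1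
  obtain ⟨g3, b3, s3, e3⟩ := hstep g2 b2 s2
  obtain ⟨A, hA⟩ := (hg 0).2
  obtain ⟨B, hB⟩ := (b3 0).2
  have hglob : ∀ (g : I → Momentum → ℂ), (∀ i, tsupport (g i) ⊆ K) → ∀ A,
      (∀ i, ∀ l ∈ V, ‖g i l‖ ≤ A) → ∀ i l, ‖g i l‖ ≤ |A| := by
    intro g hgK A hA i l
    by_cases hl : l ∈ V
    · exact (hA i l hl).trans (le_abs_self A)
    · rw [image_eq_zero_of_notMem_tsupport fun h => hl (hKV (hgK i h)), norm_zero]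
      exact abs_nonneg A
  refine ⟨|A| + |B|, fun i l => ⟨?_, ?_⟩⟩
  · rw [norm_mul, norm_osc, one_mul]
    have h1 : (1 : ℝ) ≤ (1 + ‖η i‖) ^ 3 := one_le_pow₀ (by linarith [norm_nonneg (η i)])
    have h2 := hglob g hgK A hA i l
    nlinarith [abs_nonneg A, abs_nonneg B]
  · have h0 : (fun l => osc (η i) l * g i l) = fun l => 1 * (osc (η i) l * g i l) := by
      simp only [one_mul]
    rw [h0, e1, e2, e3, norm_mul, norm_mul, norm_mul, one_mul, norm_mul, norm_osc, one_mul,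
      Complex.norm_real, Real.norm_of_nonneg (by positivity)]
    have h2 := hglob g3 s3 B hB i l
    have h3 : 0 ≤ (1 + ‖η i‖) ^ 3 := by positivity
    nlinarith [abs_nonneg A, abs_nonneg B]

/-- Repeated integration by parts. The fields `X` annihilate the functionals, so dividing by the
symbol `∑ X_μ η_μ` and moving the field to the amplitude gains one power of `‖η‖`. The functionals
are bounded by the supremum norms of the argument and of its third energy derivative, which costs
the factor `(1 + ‖η‖)³`. -/
lemma exists_decay_osc_mul {I : Type*} {V K : Set Momentum} (hV : IsOpen V) (hK : IsCompact K)
    (hKV : K ⊆ V) {η : I → Momentum} (hη : ∀ i, η i ≠ 0) {T : I → (Momentum → ℂ) → ℂ}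
    (hlin : ∀ i (F G : Momentum → ℂ), ContDiff ℝ (⊤ : ℕ∞) F → HasCompactSupport F →
      ContDiff ℝ (⊤ : ℕ∞) G → HasCompactSupport G → ∀ c : ℂ,
        T i (fun l => F l + c * G l) = T i F + c * T i G)
    {C₀ : ℝ} (hC₀ : 0 ≤ C₀) (hbd : ∀ i (F : Momentum → ℂ), ContDiff ℝ (⊤ : ℕ∞) F →
      tsupport F ⊆ K → ∀ A, (∀ l, ‖F l‖ ≤ A) → (∀ l, ‖pd 0 (pd 0 (pd 0 F)) l‖ ≤ A) →
        ‖T i F‖ ≤ C₀ * A)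
    {X : Fin 4 → I → Momentum → ℂ} (hX : ∀ μ n, BoundedFamily V n (X μ))
    (hkill : ∀ i (F : Momentum → ℂ), ContDiff ℝ (⊤ : ℕ∞) F → HasCompactSupport F →
      T i (fun l => ∑ μ, X μ i l * pd μ F l) = 0)
    {δ : ℝ} (hδ : 0 < δ) (hsymb : ∀ i, ∀ l ∈ V, δ * ‖η i‖ ≤ ‖∑ μ, X μ i l * η i μ‖)
    (N : ℕ) {g : I → Momentum → ℂ} (hg : ∀ n, BoundedFamily V n g)
    (hgK : ∀ i, tsupport (g i) ⊆ K) :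
    ∃ C : ℝ, 0 ≤ C ∧ ∀ i, ‖η i‖ ^ N * ‖T i fun l => osc (η i) l * g i l‖ ≤
      C * (1 + ‖η i‖) ^ 3 := by
  have hosc : ∀ (i) (F : Momentum → ℂ), tsupport (fun l => osc (η i) l * F l) ⊆ tsupport F :=
    fun i F => tsupport_mul_subset_right
  have hcomp : ∀ (F : Momentum → ℂ), tsupport F ⊆ K → HasCompactSupport F := fun F hF =>
    hK.of_isClosed_subset (isClosed_tsupport _) hF
  induction N generalizing g with
  | zero =>
    obtain ⟨A, hA⟩ := exists_bound_osc_mul (η := η) hV hKV hg hgK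
    refine ⟨C₀ * |A|, by positivity, fun i => ?_⟩
    have h := hbd i (fun l => osc (η i) l * g i l)
      ((contDiff_osc _).mul ((hg 0).contDiff hV ((hgK i).trans hKV)))
      ((hosc i _).trans (hgK i)) _ (fun l => (hA i l).1) (fun l => (hA i l).2)
    rw [pow_zero, one_mul]
    refine h.trans ?_
    rw [mul_assoc]
    gcongr
    exact le_abs_self A
  | succ N ih =>
    set s : I → Momentum → ℂ := fun i l => ∑ μ, X μ i l * ((η i μ / ‖η i‖ : ℝ) : ℂ) with hs
    have hηpos : ∀ i, 0 < ‖η i‖ := fun i => norm_pos_iff.2 (hη i)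
    have hsη : ∀ i l, ∑ μ, X μ i l * η i μ = ‖η i‖ * s i l := by
      intro i l
      rw [hs, Finset.mul_sum]
      refine Finset.sum_congr rfl fun μ _ => ?_
      have : (‖η i‖ : ℂ) ≠ 0 := by exact_mod_cast (hηpos i).ne'
      push_cast
      field_simp
    have hsb : ∀ n, BoundedFamily V n s := fun n => .sum hV fun μ =>
      (hX μ n).mul hV (BoundedFamily.const (C := 1) fun i => by
        rw [Complex.norm_real, norm_div, norm_norm, div_le_one (hηpos i)]
        exact PiLp.norm_apply_le (η i) μ)
    have hsδ : ∀ i, ∀ l ∈ V, δ ≤ ‖s i l‖ := by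
      intro i l hl
      have h1 := hsymb i l hl
      rw [hsη, norm_mul, Complex.norm_real, norm_norm, mul_comm] at h1
      exact le_of_mul_le_mul_left h1 (hηpos i)
    have hρ : ∀ n, BoundedFamily V n fun i l => (s i l)⁻¹ * g i l := fun n =>
      (BoundedFamily.inv hV hδ hsb hsδ).mul hV (hg n)
    have hρK : ∀ i, tsupport (fun l => (s i l)⁻¹ * g i l) ⊆ tsupport (g i) := fun i =>
      tsupport_mul_subset_right
    set g' : I → Momentum → ℂ := fun i l =>
      ∑ μ, X μ i l * pd μ (fun l => (s i l)⁻¹ * g i l) l with hg'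
    have hg'b : ∀ n, BoundedFamily V n g' := fun n => .sum hV fun μ =>
      (hX μ n).mul hV ((hρ (n + 1)).2 μ)
    have hg'K : ∀ i, tsupport (g' i) ⊆ tsupport (g i) := fun i => by
      refine closure_minimal (fun l hl => ?_) (isClosed_tsupport _)
      by_contra h
      refine hl (Finset.sum_eq_zero fun μ _ => ?_)
      rw [pd_eq_zero_of_notMem fun h' => h (hρK i h'), mul_zero]
    obtain ⟨C, hC, hb⟩ := ih hg'b fun i => (hg'K i).trans (hgK i)
    refine ⟨C, hC, fun i => ?_⟩
    have cρ := (hρ 0).contDiff hV (((hρK i).trans (hgK i)).trans hKV)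
    have cg := (hg 0).contDiff hV ((hgK i).trans hKV)
    have cg' := (hg'b 0).contDiff hV (((hg'K i).trans (hgK i)).trans hKV)
    set a : ℂ := -(2 * Real.pi * Complex.I) * ‖η i‖ with ha
    have hid : (fun l => ∑ μ, X μ i l * pd μ (fun l => osc (η i) l * ((s i l)⁻¹ * g i l)) l) =
        fun l => osc (η i) l * g' i l + a * (osc (η i) l * g i l) := by
      funext l
      have h1 : (∑ μ, X μ i l * pd μ (fun l => osc (η i) l * ((s i l)⁻¹ * g i l)) l) =
          osc (η i) l * g' i l + -(2 * Real.pi * Complex.I) * (osc (η i) l *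
            ((∑ μ, X μ i l * η i μ) * ((s i l)⁻¹ * g i l))) := by
        rw [hg', Finset.sum_mul, Finset.mul_sum, Finset.mul_sum, Finset.mul_sum,
          ← Finset.sum_add_distrib]
        refine Finset.sum_congr rfl fun μ _ => ?_
        rw [pd_osc_mul _ (cρ.differentiable (by simp) l)]
        ring
      rw [h1, hsη, ha]
      by_cases hl : l ∈ tsupport (g i)
      · have hne : s i l ≠ 0 :=
          norm_pos_iff.1 (hδ.trans_le (hsδ i l (hKV (hgK i hl))))
        field_simp
      · rw [image_eq_zero_of_notMem_tsupport hl]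
        ring
    have h0 := hkill i _ ((contDiff_osc (η i)).mul cρ)
      (hcomp _ (((hosc i _).trans (hρK i)).trans (hgK i)))
    rw [hid, hlin i _ _ ((contDiff_osc _).mul cg')
      (hcomp _ (((hosc i _).trans (hg'K i)).trans (hgK i))) ((contDiff_osc _).mul cg)
      (hcomp _ ((hosc i _).trans (hgK i)))] at h0
    have hnorm : ‖a‖ * ‖T i fun l => osc (η i) l * g i l‖ =
        ‖T i fun l => osc (η i) l * g' i l‖ := by
      rw [← norm_mul, ← norm_neg (a * _), ← eq_neg_of_add_eq_zero_left h0]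
    have ha1 : ‖η i‖ ≤ ‖a‖ := by
      rw [ha, norm_mul, norm_neg, Complex.norm_real, norm_norm]
      refine le_mul_of_one_le_left (norm_nonneg _) ?_
      have : ‖(2 * Real.pi * Complex.I : ℂ)‖ = 2 * Real.pi := by
        simp [abs_of_pos Real.pi_pos]
      rw [this]
      linarith [Real.pi_gt_three]
    refine le_trans ?_ (hb i)
    rw [pow_succ, mul_assoc, ← hnorm]
    gcongr

lemma BoundedFamily.schwartz {I : Type*} (V : Set Momentum) (n : ℕ) (f : 𝓢(Momentum, ℂ)) :
    BoundedFamily V n fun _ : I => ⇑f := by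
  have h0 : ∀ f : 𝓢(Momentum, ℂ), BoundedFamily V 0 fun _ : I => ⇑f := fun f =>
    ⟨fun _ => (f.smooth ⊤).contDiffOn, SchwartzMap.seminorm ℂ 0 0 f, fun _ l _ =>
      SchwartzMap.norm_le_seminorm ℂ f l⟩
  induction n generalizing f with
  | zero => exact h0 f
  | succ n ih =>
    refine ⟨h0 f, fun μ => ?_⟩
    have : (fun _ : I => pd μ f) = fun _ : I => ⇑(partialD μ f) := by
      funext _ l
      exact (partialD_apply μ f l).symm
    rw [this]
    exact ih _

/-- Non-stationary phase: the functionals decay rapidly in every direction in which a field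
annihilating them has nonvanishing symbol. -/
lemma rapidDecay_of_symbol {T : ℝ → (Momentum → ℂ) → ℂ} {X : Fin 4 → ℝ → Momentum → ℂ}
    {x ζ : Momentum}
    (hlin : ∀ ε ∈ Set.Ioo (0 : ℝ) 1, ∀ F G : Momentum → ℂ, ContDiff ℝ (⊤ : ℕ∞) F →
      HasCompactSupport F → ContDiff ℝ (⊤ : ℕ∞) G → HasCompactSupport G → ∀ c : ℂ,
        T ε (fun l => F l + c * G l) = T ε F + c * T ε G)
    (hbd : ∀ K : Set Momentum, IsCompact K → ∃ C₀ : ℝ, 0 ≤ C₀ ∧ ∀ ε ∈ Set.Ioo (0 : ℝ) 1,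
      ∀ F : Momentum → ℂ, ContDiff ℝ (⊤ : ℕ∞) F → tsupport F ⊆ K → ∀ A, (∀ l, ‖F l‖ ≤ A) →
        (∀ l, ‖pd 0 (pd 0 (pd 0 F)) l‖ ≤ A) → ‖T ε F‖ ≤ C₀ * A)
    (hX : ∀ μ n, BoundedFamily (Metric.ball x 1) n fun ε : Set.Ioo (0 : ℝ) 1 => X μ ε)
    (hXc : ∀ μ, ContinuousAt (fun y : ℝ × Momentum => X μ y.1 y.2) (0, x))
    (hkill : ∀ ε ∈ Set.Ioo (0 : ℝ) 1, ∀ F : Momentum → ℂ, ContDiff ℝ (⊤ : ℕ∞) F →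
      HasCompactSupport F → T ε (fun l => ∑ μ, X μ ε l * pd μ F l) = 0)
    (hσ : ∑ μ, X μ 0 x * ζ μ ≠ 0) : RapidDecay T x ζ := by
  -- the symbol at `ε = 0` and `x`; the cone consists of the directions in which it exceeds `δ`,
  -- half of its modulus at `ζ`
  set S : Momentum → ℂ := fun η => ∑ μ, X μ 0 x * η μ with hS
  have hζ : 0 < ‖ζ‖ := by
    rw [norm_pos_iff]
    rintro rfl
    simp at hσ
  set δ : ℝ := ‖S ζ‖ / (2 * ‖ζ‖) with hδ
  have hδ0 : 0 < δ := div_pos (norm_pos_iff.2 hσ) (by positivity)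
  have hSc : Continuous S := by
    have : ∀ μ, Continuous fun η : Momentum => ((η μ : ℝ) : ℂ) := fun μ => by fun_prop
    fun_prop
  have hev : ∀ᶠ y in 𝓝 ((0 : ℝ), x), ∀ μ, ‖X μ y.1 y.2 - X μ 0 x‖ < δ / 8 := by
    refine Filter.eventually_all.2 fun μ => ?_
    have := (hXc μ).eventually (Metric.ball_mem_nhds _ (by positivity : 0 < δ / 8))
    simpa only [Metric.mem_ball, dist_eq_norm] using this
  obtain ⟨r, hr, hball⟩ := Metric.eventually_nhds_iff_ball.1 hev
  set ρ := min r 1 with hρ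
  have hρ0 : 0 < ρ := lt_min hr one_pos
  have hscale : ∀ (t : ℝ) (η : Momentum), S (t • η) = t * S η := by
    intro t η
    rw [hS, Finset.mul_sum]
    refine Finset.sum_congr rfl fun μ _ => ?_
    simp
    ring
  refine ⟨Metric.ball x ρ, Metric.ball_mem_nhds x hρ0, ρ, hρ0, {η | δ * ‖η‖ < ‖S η‖},
    isOpen_lt (by fun_prop) hSc.norm, ?_, ?_, ?_⟩
  · rw [Set.mem_ofPred_eq, hδ, div_mul_eq_mul_div, div_lt_iff₀ (by positivity)]
    have := mul_pos (norm_pos_iff.2 hσ) hζ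
    linarith
  · intro t ht η hη
    rw [Set.mem_ofPred_eq] at hη ⊢
    rw [hscale, norm_smul, norm_mul, Complex.norm_real, Real.norm_of_nonneg ht.le]
    nlinarith
  · intro χ hχ hχV N
    obtain ⟨C₀, hC₀, hb⟩ := hbd (tsupport χ) hχ
    set I := {i : ℝ × Momentum // i.1 ∈ Set.Ioo 0 ρ ∧ δ * ‖i.2‖ < ‖S i.2‖} with hI
    have hmem : ∀ i : I, i.1.1 ∈ Set.Ioo (0 : ℝ) 1 := fun i =>
      ⟨i.2.1.1, i.2.1.2.trans_le (min_le_right _ _)⟩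
    have hne : ∀ i : I, i.1.2 ≠ 0 := by
      intro i h
      have := i.2.2
      rw [h, hS] at this
      simp at this
    have hdec := fun N => exists_decay_osc_mul (I := I) (V := Metric.ball x ρ) (K := tsupport χ)
      (η := fun i => i.1.2) (T := fun i => T i.1.1) (X := fun μ i => X μ i.1.1) (g := fun _ => χ)
      Metric.isOpen_ball hχ hχV hne (fun i => hlin _ (hmem i)) hC₀ (fun i => hb _ (hmem i))
      (fun μ n => ((hX μ n).mono (Metric.ball_subset_ball (min_le_right _ _))).reindex
        fun i : I => ⟨i.1.1, hmem i⟩) (fun i => hkill _ (hmem i)) (half_pos hδ0)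
      (fun i l hl => ?_) N (fun n => BoundedFamily.schwartz _ n χ) fun _ => subset_rfl
    · obtain ⟨C, hC, hC'⟩ := hdec 0
      obtain ⟨D, hD, hD'⟩ := hdec (N + 3)
      refine ⟨2 ^ (N + 2) * (C + D), fun ε hε η hη => ?_⟩
      have h1 := hC' ⟨(ε, η), hε, hη⟩
      have h2 := hD' ⟨(ε, η), hε, hη⟩
      simp only [pow_zero, one_mul] at h1 h2
      set t := ‖T ε fun l => osc η l * χ l‖ with ht
      have h3 : (1 + ‖η‖) ^ (N + 3) ≤ 2 ^ (N + 2) * (1 + ‖η‖ ^ (N + 3)) := by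
        simpa using add_pow_le zero_le_one (norm_nonneg η) (N + 3)
      have h4 : (1 + ‖η‖) ^ (N + 3) * t ≤ 2 ^ (N + 2) * ((C + D) * (1 + ‖η‖) ^ 3) := by
        refine (mul_le_mul_of_nonneg_right h3 (norm_nonneg _)).trans ?_
        rw [mul_assoc]
        refine mul_le_mul_of_nonneg_left ?_ (by positivity)
        linarith
      have h5 : 0 < (1 + ‖η‖) ^ 3 := by positivity
      refine le_of_mul_le_mul_right ?_ h5
      calc _ = (1 + ‖η‖) ^ (N + 3) * t := by rw [pow_add]; ring
        _ ≤ _ := h4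
        _ = _ := by ring
    · have hmem' : (i.1.1, l) ∈ Metric.ball ((0 : ℝ), x) r := by
        rw [Metric.mem_ball, Prod.dist_eq, max_lt_iff]
        refine ⟨?_, (Metric.mem_ball.1 hl).trans_le (min_le_left _ _)⟩
        rw [Real.dist_eq, sub_zero, abs_of_pos i.2.1.1]
        exact i.2.1.2.trans_le (min_le_left _ _)
      have h1 := hball _ hmem'
      have h2 : ‖(∑ μ, X μ i.1.1 l * i.1.2 μ) - S i.1.2‖ ≤ ∑ _μ : Fin 4, δ / 8 * ‖i.1.2‖ := by
        change ‖_ - ∑ μ, X μ 0 x * i.1.2 μ‖ ≤ _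
        rw [← Finset.sum_sub_distrib]
        refine norm_sum_le_of_le _ fun μ _ => ?_
        rw [← sub_mul, norm_mul, Complex.norm_real]
        exact mul_le_mul (h1 μ).le (PiLp.norm_apply_le _ μ) (norm_nonneg _) (by positivity)
      have h3 := i.2.2
      have h4 := norm_sub_norm_le (S i.1.2) (S i.1.2 - ∑ μ, X μ i.1.1 l * i.1.2 μ)
      rw [sub_sub_cancel] at h4
      rw [norm_sub_rev] at h2
      simp only [Finset.sum_const, Finset.card_univ, Fintype.card_fin, nsmul_eq_mul] at h2
      push_cast at h2
      nlinarith

/-- The coefficients of the boost `q_i ∂₀ + q₀ ∂_i`. -/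
def boostCoeff (i : Fin 3) (q : Fin 4 → ℂ) (μ : Fin 4) : ℂ :=
  if μ = 0 then q i.succ else if μ = i.succ then q 0 else 0

lemma sum_boostCoeff (i : Fin 3) (q a : Fin 4 → ℂ) :
    ∑ μ, boostCoeff i q μ * a μ = q i.succ * a 0 + q 0 * a i.succ := by
  rw [Fin.sum_univ_succ]
  simp [boostCoeff, Fin.succ_ne_zero]

lemma boundedFamily_boostCoeff {I : Type*} {V : Set Momentum} {n : ℕ} (i : Fin 3)
    {q : Fin 4 → I → Momentum → ℂ} (hq : ∀ μ, BoundedFamily V n (q μ)) (μ : Fin 4) :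
    BoundedFamily V n fun j l => boostCoeff i (fun ν => q ν j l) μ := by
  unfold boostCoeff
  split_ifs
  · exact hq _
  · exact hq _
  · exact BoundedFamily.const (C := 0) (by simp)

lemma exists_schwartz_eq {F : Momentum → ℂ} (hF : ContDiff ℝ (⊤ : ℕ∞) F)
    (hF' : HasCompactSupport F) : ∃ f : 𝓢(Momentum, ℂ), ⇑f = F :=
  ⟨hF'.toSchwartzMap hF, rfl⟩

/-- The boosts annihilate the integral over the mass shell. -/
lemma rapidDecay_shell {m : ℝ} (hm : 0 ≤ m) {x ζ : Momentum} (i : Fin 3)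
    (h : x 0 * ζ i.succ + x i.succ * ζ 0 ≠ 0) :
    RapidDecay (fun _ F => shellIntegral m F) x ζ := by
  refine rapidDecay_of_symbol (X := fun μ _ l => boostCoeff i (fun ν => (l ν : ℂ)) μ)
    ?_ ?_ ?_ ?_ ?_ ?_
  · intro ε _ F G hF hF' hG hG' c
    obtain ⟨f, rfl⟩ := exists_schwartz_eq hF hF'
    obtain ⟨g, rfl⟩ := exists_schwartz_eq hG hG'
    have h1 := shellIntegral_add m f (c • g)
    have h2 : (fun l => f l + c * g l) = ⇑(f + c • g) := by ext l; simp
    have h3 : ⇑(c • g) = fun l => c * g l := by ext l; simp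
    rw [h2, h1, h3, shellIntegral_smul]
  · intro K hK
    obtain ⟨R, hR⟩ := hK.isBounded.exists_norm_le
    set B : ContDiffBump (0 : Momentum) := ⟨|R| + 1, |R| + 2, by positivity, by linarith⟩ with hB
    have hb : ∀ l ∈ K, bumpSchwartz B l = 1 := by
      intro l hl
      rw [bumpSchwartz_apply, B.one_of_mem_closedBall]
      · simp
      · rw [mem_closedBall_zero_iff]
        exact (hR l hl).trans ((le_abs_self R).trans (by simp [hB]))
    refine ⟨shellNorm m (bumpSchwartz B), MeasureTheory.integral_nonneg fun _ => norm_nonneg _,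
      fun ε _ F _ hFK A hA _ => ?_⟩
    have hA0 : 0 ≤ A := (norm_nonneg _).trans (hA 0)
    unfold shellNorm
    rw [mul_comm, ← MeasureTheory.integral_const_mul]
    refine MeasureTheory.norm_integral_le_of_norm_le
      ((integrable_shell m (bumpSchwartz B)).norm.const_mul A) (.of_forall fun p => ?_)
    by_cases hp : onShell m p ∈ K
    · rw [hb _ hp, norm_div, norm_div, norm_one, mul_one_div]
      exact div_le_div_of_nonneg_right (hA _) (norm_nonneg _)
    · rw [image_eq_zero_of_notMem_tsupport fun h => hp (hFK h), zero_div, norm_zero]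
      positivity
  · exact fun μ n => boundedFamily_boostCoeff i
      (fun ν => BoundedFamily.coord Metric.isBounded_ball ν) μ
  · intro μ
    refine Continuous.continuousAt ?_
    have hc : ∀ ν, Continuous fun y : ℝ × Momentum => ((y.2 ν : ℝ) : ℂ) := fun ν => by fun_prop
    unfold boostCoeff
    split_ifs
    · exact hc _
    · exact hc _
    · exact continuous_const
  · intro ε _ F hF hF'
    obtain ⟨f, rfl⟩ := exists_schwartz_eq hF hF'
    rw [← shellIntegral_boost hm i f]
    congr 1
    funext l
    rw [sum_boostCoeff i (fun ν => (l ν : ℂ)) fun μ => pd μ f l]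
    simp only [add_apply, coordMul_apply, partialD_apply, pd]
    ring
  · rw [sum_boostCoeff i (fun ν => (x ν : ℂ)) fun μ => (ζ μ : ℂ)]
    have e : (x i.succ : ℂ) * ζ 0 + x 0 * ζ i.succ =
        ((x 0 * ζ i.succ + x i.succ * ζ 0 : ℝ) : ℂ) := by
      push_cast
      ring
    rw [e]
    exact Complex.ofReal_ne_zero.2 h

/-- The mass shell is closed, so the integral vanishes on functions supported near a point outside.
-/
lemma rapidDecay_shell_of_notMem {m : ℝ} {x : Momentum} (ζ : Momentum)
    (h : x ∉ Set.range (onShell m)) : RapidDecay (fun _ F => shellIntegral m F) x ζ := by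
  have hcl : IsClosed (Set.range (onShell m)) := by
    have : Set.range (onShell m) = {l | l 0 = shellEnergy m (spatialPart l)} := by
      ext l
      constructor
      · rintro ⟨p, rfl⟩
        rfl
      · intro hl
        refine ⟨spatialPart l, ?_⟩
        ext μ
        refine Fin.cases ?_ (fun j => rfl) μ
        exact hl.symm
    rw [this]
    exact isClosed_eq (by fun_prop) ((continuous_shellEnergy m).comp continuous_spatialPart)
  refine ⟨(Set.range (onShell m))ᶜ, hcl.isOpen_compl.mem_nhds h, 1, one_pos, Set.univ, isOpen_univ,
    Set.mem_univ _, fun _ _ _ _ => Set.mem_univ _, fun χ _ hχ N => ⟨0, fun ε _ η _ => ?_⟩⟩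
  have : (shellIntegral m fun l => osc η l * χ l) = 0 := by
    unfold shellIntegral
    refine (MeasureTheory.integral_congr_ae (.of_forall fun p => ?_)).trans
      (MeasureTheory.integral_zero _ _)
    simp only
    rw [image_eq_zero_of_notMem_tsupport (f := χ) fun h => hχ h ⟨p, rfl⟩, mul_zero, zero_div]
  change _ * ‖shellIntegral m fun l => osc η l * χ l‖ ≤ 0
  rw [this, norm_zero, mul_zero]

/-! ### The retarded propagator along a signed shift -/

/-- The integral of `F / h`, with `h` the denominator of the regularised retarded propagator. -/
def denominatorPairing (m σ : ℝ) (k : Momentum) (ε : ℝ) (F : Momentum → ℂ) : ℂ :=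
  ∫ l, F l * (denominator m σ (complexMomentum k ε) l)⁻¹

lemma contDiff_inv_denominator (m σ : ℝ) (k : Momentum) {ε : ℝ} (hε : 0 < ε) :
    ContDiff ℝ (⊤ : ℕ∞) fun l => (denominator m σ (complexMomentum k ε) l)⁻¹ :=
  (contDiff_denominator m σ _).inv fun l => denominator_ne_zero m σ k hε l

lemma denominatorPairing_add_mul (m σ : ℝ) (k : Momentum) {ε : ℝ} (hε : 0 < ε)
    {F G : Momentum → ℂ} (hF : Continuous F) (hF' : HasCompactSupport F) (hG : Continuous G)
    (hG' : HasCompactSupport G) (c : ℂ) :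
    denominatorPairing m σ k ε (fun l => F l + c * G l) =
      denominatorPairing m σ k ε F + c * denominatorPairing m σ k ε G := by
  have hc := (contDiff_inv_denominator m σ k hε).continuous
  have h1 : MeasureTheory.Integrable fun l =>
      F l * (denominator m σ (complexMomentum k ε) l)⁻¹ :=
    (hF.mul hc).integrable_of_hasCompactSupport hF'.mul_right
  have h2 : MeasureTheory.Integrable fun l =>
      G l * (denominator m σ (complexMomentum k ε) l)⁻¹ :=
    (hG.mul hc).integrable_of_hasCompactSupport hG'.mul_right
  unfold denominatorPairing
  rw [← MeasureTheory.integral_const_mul, ← MeasureTheory.integral_add h1 (h2.const_mul c)]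
  congr 1
  funext l
  ring

lemma integral_pd_eq_zero {F : Momentum → ℂ} (hF : ContDiff ℝ (⊤ : ℕ∞) F)
    (hF' : HasCompactSupport F) (μ : Fin 4) : ∫ l, pd μ F l = 0 := by
  have h1 : MeasureTheory.Integrable (pd μ F) :=
    (hF.pd μ).continuous.integrable_of_hasCompactSupport
      (hF'.of_isClosed_subset (isClosed_tsupport _) (tsupport_pd_subset μ F))
  have h2 : MeasureTheory.Integrable F := hF.continuous.integrable_of_hasCompactSupport hF'
  have h := integral_smul_fderiv_eq_neg_fderiv_smul_of_integrable (𝕜 := ℝ)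
    (μ := MeasureTheory.volume) (f := fun _ : Momentum => (1 : ℝ)) (g := F)
    (v := EuclideanSpace.single μ (1 : ℝ)) (by simp) (by simpa [pd] using! h1) (by simpa using h2)
    (by fun_prop) (fun l _ => hF.differentiable (by simp) l)
  simpa [pd] using h

lemma boundedFamily_shift {x k : Momentum} {σ : ℝ} (n : ℕ) (ν : Fin 4) :
    BoundedFamily (Metric.ball x 1) n fun (ε : Set.Ioo (0 : ℝ) 1) l =>
      complexMomentum k ε ν + σ * l ν := by
  refine (BoundedFamily.const (C := ‖k‖ + 1) fun ε => ?_).add Metric.isOpen_ball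
    ((BoundedFamily.const (C := |σ|) (c := fun _ => (σ : ℂ)) fun _ => ?_).mul Metric.isOpen_ball
      (BoundedFamily.coord Metric.isBounded_ball ν))
  · refine (norm_complexMomentum_le k _ ν).trans (add_le_add le_rfl ?_)
    rw [abs_of_pos ε.2.1]
    exact ε.2.2.le
  · simp

lemma boundedFamily_denominator {m σ : ℝ} {x k : Momentum} (n : ℕ) :
    BoundedFamily (Metric.ball x 1) n fun (ε : Set.Ioo (0 : ℝ) 1) l =>
      denominator m σ (complexMomentum k ε) l := by
  have hV := Metric.isOpen_ball (x := x) (ε := 1)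
  refine ((BoundedFamily.sum hV (φ := fun μ (ε : Set.Ioo (0 : ℝ) 1) l => (metricSign μ : ℂ) *
    ((complexMomentum k ε μ + σ * l μ) * (complexMomentum k ε μ + σ * l μ))) fun μ => ?_).add hV
      (BoundedFamily.const (C := ‖(m : ℂ) ^ 2‖) (c := fun _ => -(m : ℂ) ^ 2) fun _ => ?_)).congr hV
        fun ε l _ => ?_
  · exact (BoundedFamily.const (C := 1) (c := fun _ => (metricSign μ : ℂ)) fun _ =>
      (norm_metricSign μ).le).mul hV ((boundedFamily_shift n μ).mul hV (boundedFamily_shift n μ))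
  · rw [norm_neg]
  · unfold denominator
    rw [sub_eq_add_neg]
    simp only [sq]

lemma pd_add_mul_coord (κ : ℂ) (σ : ℝ) (μ ν : Fin 4) (l : Momentum) :
    pd μ (fun l => κ + σ * l ν) l = if μ = ν then (σ : ℂ) else 0 := by
  have h := pd_coord μ ν l
  unfold pd at h ⊢
  have h1 : fderiv ℝ (fun l : Momentum => κ + σ * (l ν : ℂ)) l =
      (σ : ℂ) • fderiv ℝ (fun l : Momentum => ((l ν : ℝ) : ℂ)) l := by
    rw [fderiv_const_add, fderiv_const_mul (hasFDerivAt_coord ν l).differentiableAt]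
  rw [h1, smul_apply, h]
  split_ifs <;> simp

lemma pd_inv_denominator (m σ : ℝ) (k : Momentum) {ε : ℝ} (hε : 0 < ε) (μ : Fin 4)
    (l : Momentum) : pd μ (fun l => (denominator m σ (complexMomentum k ε) l)⁻¹) l =
      -((denominator m σ (complexMomentum k ε) l)⁻¹ ^ 2) *
        (2 * σ * metricSign μ * (complexMomentum k ε μ + σ * l μ)) := by
  have hne := denominator_ne_zero m σ k hε l
  have hd : HasFDerivAt (denominator m σ (complexMomentum k ε))
      (fderiv ℝ (denominator m σ (complexMomentum k ε)) l) l :=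
    ((contDiff_denominator m σ _ (n := 1)).differentiable (by simp) l).hasFDerivAt
  have h := (hasDerivAt_inv hne).comp_hasFDerivAt l hd
  change fderiv ℝ (Inv.inv ∘ denominator m σ (complexMomentum k ε)) l _ = _
  rw [h.fderiv, smul_apply, fderiv_denominator, inv_pow, smul_eq_mul]

/-- The boosts around `-σ k - σ iε e₀` preserve the denominator and have no divergence, so they
annihilate the integral against its inverse. -/
lemma denominatorPairing_boost (m σ : ℝ) (k : Momentum) {ε : ℝ} (hε : 0 < ε) (i : Fin 3)
    {F : Momentum → ℂ} (hF : ContDiff ℝ (⊤ : ℕ∞) F) (hF' : HasCompactSupport F) :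
    denominatorPairing m σ k ε (fun l => ∑ μ,
      boostCoeff i (fun ν => complexMomentum k ε ν + σ * l ν) μ * pd μ F l) = 0 := by
  set κ := complexMomentum k ε with hκ
  set H : Momentum → ℂ := fun l => (denominator m σ κ l)⁻¹ with hH
  have cH : ContDiff ℝ (⊤ : ℕ∞) H := contDiff_inv_denominator m σ k hε
  have cq : ∀ ν, ContDiff ℝ (⊤ : ℕ∞) fun l : Momentum => κ ν + σ * (l ν : ℂ) := fun ν =>
    contDiff_const.add (contDiff_const.mul (Complex.ofRealCLM.comp
      (EuclideanSpace.proj ν : Momentum →L[ℝ] ℝ)).contDiff)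
  have dif : ∀ {G : Momentum → ℂ}, ContDiff ℝ (⊤ : ℕ∞) G → ∀ l, DifferentiableAt ℝ G l :=
    fun hG l => hG.differentiable (by simp) l
  have hpd : ∀ μ ν l, pd μ (fun l => (κ ν + σ * l ν) * (F l * H l)) l =
      (if μ = ν then (σ : ℂ) else 0) * (F l * H l) + (κ ν + σ * l ν) * (pd μ F l * H l + F l *
        (-(H l ^ 2) * (2 * σ * metricSign μ * (κ μ + σ * l μ)))) := by
    intro μ ν l
    rw [pd_mul (dif (cq ν) l) (dif (hF.mul cH) l), pd_mul (dif hF l) (dif cH l),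
      pd_add_mul_coord, pd_inv_denominator m σ k hε]
  have hi : (0 : Fin 4) ≠ i.succ := (Fin.succ_ne_zero i).symm
  have hid : ∀ l, (∑ μ, boostCoeff i (fun ν => κ ν + σ * l ν) μ * pd μ F l) * H l =
      pd 0 (fun l => (κ i.succ + σ * l i.succ) * (F l * H l)) l +
        pd i.succ (fun l => (κ 0 + σ * l 0) * (F l * H l)) l := by
    intro l
    rw [sum_boostCoeff i (fun ν => κ ν + σ * (l ν : ℂ)) fun μ => pd μ F l, hpd, hpd, if_neg hi,
      if_neg hi.symm, metricSign_zero, metricSign_succ]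
    push_cast
    ring
  have c1 := fun ν => (cq ν).mul (hF.mul cH)
  have s1 : ∀ ν, HasCompactSupport fun l : Momentum => (κ ν + σ * (l ν : ℂ)) * (F l * H l) :=
    fun ν => (hF'.mul_right).mul_left
  have int : ∀ μ ν, MeasureTheory.Integrable
      (pd μ fun l => (κ ν + σ * (l ν : ℂ)) * (F l * H l)) := fun μ ν =>
    ((c1 ν).pd μ).continuous.integrable_of_hasCompactSupport
      ((s1 ν).of_isClosed_subset (isClosed_tsupport _) (tsupport_pd_subset μ _))
  unfold denominatorPairing
  rw [MeasureTheory.integral_congr_ae (.of_forall hid), MeasureTheory.integral_add (int _ _)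
    (int _ _), integral_pd_eq_zero (c1 _) (s1 _), integral_pd_eq_zero (c1 _) (s1 _), add_zero]

/-- The field `h ∂_ν` annihilates the integral against `1 / h`. -/
lemma denominatorPairing_mul_pd (m σ : ℝ) (k : Momentum) {ε : ℝ} (hε : 0 < ε) (ν : Fin 4)
    {F : Momentum → ℂ} (hF : ContDiff ℝ (⊤ : ℕ∞) F) (hF' : HasCompactSupport F) :
    denominatorPairing m σ k ε (fun l => ∑ μ,
      (if μ = ν then denominator m σ (complexMomentum k ε) l else 0) * pd μ F l) = 0 := by
  refine Eq.trans ?_ (integral_pd_eq_zero hF hF' ν)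
  unfold denominatorPairing
  congr 1
  funext l
  have := denominator_ne_zero m σ k hε l
  simp only [ite_mul, zero_mul, Finset.sum_ite_eq', Finset.mem_univ, if_true]
  field_simp

/-- The sign of a unit of `ℤ` as a real number. -/
def realSign (s : ℤˣ) : ℝ := ((s : ℤ) : ℝ)

lemma realSign_sq (s : ℤˣ) : realSign s ^ 2 = 1 := by
  rcases Int.units_eq_one_or s with rfl | rfl <;> simp [realSign]

lemma measurePreserving_signed (s : ℤˣ) (k : Momentum) :
    MeasureTheory.MeasurePreserving (fun l : Momentum => k + realSign s • l) := by
  rcases Int.units_eq_one_or s with rfl | rfl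
  · simpa [realSign] using MeasureTheory.measurePreserving_add_left MeasureTheory.volume k
  · simpa [realSign, ← sub_eq_add_neg] using
      MeasureTheory.Measure.measurePreserving_sub_left MeasureTheory.volume k

lemma integral_signed {E : Type*} [NormedAddCommGroup E] [NormedSpace ℝ E] (s : ℤˣ) (k : Momentum)
    (G : Momentum → E) : ∫ l, G (k + realSign s • l) = ∫ l, G l := by
  rcases Int.units_eq_one_or s with rfl | rfl
  · simpa [realSign] using MeasureTheory.integral_add_left_eq_self G k
  · simpa [realSign, ← sub_eq_add_neg] using
      MeasureTheory.integral_sub_left_eq_self G MeasureTheory.volume k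

/-- The operator `f ↦ f (s (· - k))` on Schwartz functions; `signedShift s k` is its transpose. -/
def signedPullback (s : ℤˣ) (k : Momentum) : 𝓢(Momentum, ℂ) →L[ℂ] 𝓢(Momentum, ℂ) :=
  SchwartzMap.compCLMOfAntilipschitz ℂ (hasTemperateGrowth_signedShift s k)
    (antilipschitz_signedShift s k)

lemma signedPullback_apply (s : ℤˣ) (k : Momentum) (f : 𝓢(Momentum, ℂ)) (q : Momentum) :
    signedPullback s k f q = f (realSign s • (q - k)) := rfl

lemma signedPullback_apply_add (s : ℤˣ) (k : Momentum) (f : 𝓢(Momentum, ℂ)) (l : Momentum) :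
    signedPullback s k f (k + realSign s • l) = f l := by
  rw [signedPullback_apply, add_sub_cancel_left, smul_smul, ← sq, realSign_sq, one_smul]

lemma partialD_signedPullback (s : ℤˣ) (k : Momentum) (f : 𝓢(Momentum, ℂ)) (μ : Fin 4) :
    partialD μ (signedPullback s k f) = (realSign s : ℂ) • signedPullback s k (partialD μ f) := by
  ext q
  have h1 : HasFDerivAt (fun q : Momentum => realSign s • (q - k))
      (realSign s • ContinuousLinearMap.id ℝ Momentum) q :=
    ((hasFDerivAt_id q).sub_const k).const_smul (realSign s)
  have h2 := (f.hasFDerivAt (realSign s • (q - k))).comp q h1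
  have h3 : ⇑(signedPullback s k f) = f ∘ fun q : Momentum => realSign s • (q - k) := rfl
  rw [partialD_apply, h3, h2.fderiv, smul_apply, signedPullback_apply, partialD_apply]
  simp

lemma retardedBound_signedPullback (s : ℤˣ) (k : Momentum) (f : 𝓢(Momentum, ℂ)) :
    retardedBound (signedPullback s k f) = retardedBound f := by
  have h : ∀ g : 𝓢(Momentum, ℂ), ∫ q, ‖signedPullback s k g q‖ = ∫ q, ‖g q‖ := by
    intro g
    rw [← integral_signed s k]
    simp only [signedPullback_apply_add]
  have hn : ‖(realSign s : ℂ)‖ = 1 := by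
    rcases Int.units_eq_one_or s with rfl | rfl <;> simp [realSign]
  have h3 : partialD 0 (partialD 0 (partialD 0 (signedPullback s k f))) =
      ((realSign s : ℂ) * (realSign s * realSign s)) •
        signedPullback s k (partialD 0 (partialD 0 (partialD 0 f))) := by
    simp only [partialD_signedPullback, map_smul, smul_smul, mul_assoc]
  change (∫ q, ‖signedPullback s k f q‖) +
    (∫ q, ‖partialD 0 (partialD 0 (partialD 0 (signedPullback s k f))) q‖) =
    (∫ q, ‖f q‖) + ∫ q, ‖partialD 0 (partialD 0 (partialD 0 f)) q‖
  rw [h3, h f, ← h (partialD 0 (partialD 0 (partialD 0 f)))]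
  simp only [smul_apply, norm_smul, norm_mul, hn, one_mul]

lemma retardedKernel_eq (m : ℝ) (s : ℤˣ) (k : Momentum) {ε : ℝ} (hε : 0 < ε) {l : Momentum}
    (hl : shellEnergy m (spatialPart (k + realSign s • l)) ≠ 0) :
    retardedKernel m ε (k + realSign s • l) = -((2 * Real.pi : ℂ)⁻¹ ^ 2) *
      (denominator m (realSign s) (complexMomentum k ε) l)⁻¹ := by
  have hne := denominator_ne_zero m (realSign s) k hε l
  rw [denominator_complexMomentum_eq_mul] at hne ⊢
  unfold retardedKernel
  have hω : ((shellEnergy m (spatialPart (k + realSign s • l)) : ℝ) : ℂ) ≠ 0 := by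
    exact_mod_cast hl
  obtain ⟨h1, h2⟩ := mul_ne_zero_iff.1 hne
  set ω := ((shellEnergy m (spatialPart (k + realSign s • l)) : ℝ) : ℂ)
  rw [neg_mul, ← mul_neg]
  congr 1
  field_simp
  ring

lemma integral_signedPullback_mul_retardedKernel (m : ℝ) (s : ℤˣ) (k : Momentum) {ε : ℝ}
    (hε : 0 < ε) (f : 𝓢(Momentum, ℂ)) :
    ∫ q, signedPullback s k f q * retardedKernel m ε q =
      -((2 * Real.pi : ℂ)⁻¹ ^ 2) * denominatorPairing m (realSign s) k ε f := by
  rw [← integral_signed s k, denominatorPairing, ← MeasureTheory.integral_const_mul]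
  refine MeasureTheory.integral_congr_ae ?_
  filter_upwards [(measurePreserving_signed s k).quasiMeasurePreserving.ae
    (ae_shellEnergy_ne_zero m)] with l hl
  rw [signedPullback_apply_add, retardedKernel_eq m s k hε hl]
  ring

/-- Up to a constant, the shifted retarded propagator is the limit of the integrals against `1 / h`.
-/
lemma tendsto_denominatorPairing (m : ℝ) (s : ℤˣ) (k : Momentum) (f : 𝓢(Momentum, ℂ)) :
    Filter.Tendsto (fun ε => -((2 * Real.pi : ℂ)⁻¹ ^ 2) * denominatorPairing m (realSign s) k ε f)
      (𝓝[>] 0) (𝓝 (signedShift s k (retardedHat m) f)) := by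
  refine (tendsto_retardedHat m (signedPullback s k f)).congr' ?_
  filter_upwards [self_mem_nhdsWithin] with ε hε
  exact integral_signedPullback_mul_retardedKernel m s k hε f

/-- Uniformly in `ε`, the integrals against `1 / h` are distributions of order three. -/
lemma exists_norm_denominatorPairing_le (m : ℝ) (s : ℤˣ) (k : Momentum) : ∃ C : ℝ, 0 ≤ C ∧
    ∀ ε > 0, ∀ f : 𝓢(Momentum, ℂ),
      ‖denominatorPairing m (realSign s) k ε f‖ ≤ C * retardedBound f := by
  refine ⟨2 * ∫ t in Set.Ioi (0 : ℝ), (1 + t ^ 2)⁻¹, mul_nonneg zero_le_two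
    (MeasureTheory.integral_nonneg fun t => by positivity), fun ε hε f => ?_⟩
  have h := integral_signedPullback_mul_retardedKernel m s k hε f
  rw [integral_mul_retardedKernel m _ hε] at h
  have hpi : (2 * Real.pi : ℂ)⁻¹ ^ 2 ≠ 0 :=
    pow_ne_zero _ (inv_ne_zero (by exact_mod_cast (mul_pos two_pos Real.pi_pos).ne'))
  rw [neg_mul, ← mul_neg] at h
  have h1 := mul_left_cancel₀ hpi h
  rw [← norm_neg, ← h1]
  refine (MeasureTheory.norm_integral_le_of_norm_le
    (μ := MeasureTheory.volume.restrict (Set.Ioi (0 : ℝ)))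
    (g := fun t => 2 * retardedBound f * (1 + t ^ 2)⁻¹)
    (integrable_inv_one_add_sq.const_mul _).integrableOn ?_).trans (le_of_eq ?_)
  · refine (MeasureTheory.ae_restrict_iff' measurableSet_Ioi).2 (.of_forall fun t ht => ?_)
    have ht : 0 < t := ht
    rw [norm_mul, Complex.norm_real, Real.norm_of_nonneg (Real.exp_pos _).le,
      ← retardedBound_signedPullback s k f]
    refine (mul_le_of_le_one_left (norm_nonneg _) ?_).trans
      (norm_retardedProfile_le_inv m _ ht.le)
    rw [Real.exp_le_one_iff]
    nlinarith
  · rw [MeasureTheory.integral_const_mul]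
    ring

/-! ### Directions of rapid decay -/

lemma exists_denominatorPairing_bound (m : ℝ) (s : ℤˣ) (k : Momentum) {K : Set Momentum}
    (hK : IsCompact K) : ∃ C₀ : ℝ, 0 ≤ C₀ ∧ ∀ ε ∈ Set.Ioo (0 : ℝ) 1,
      ∀ F : Momentum → ℂ, ContDiff ℝ (⊤ : ℕ∞) F → tsupport F ⊆ K → ∀ A, (∀ l, ‖F l‖ ≤ A) →
        (∀ l, ‖pd 0 (pd 0 (pd 0 F)) l‖ ≤ A) →
          ‖denominatorPairing m (realSign s) k ε F‖ ≤ C₀ * A := by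
  obtain ⟨C, hC, hb⟩ := exists_norm_denominatorPairing_le m s k
  refine ⟨C * (2 * MeasureTheory.volume.real K), by positivity,
    fun ε hε F hF hFK A hA hA' => ?_⟩
  obtain ⟨f, rfl⟩ := exists_schwartz_eq hF (hK.of_isClosed_subset (isClosed_tsupport _) hFK)
  refine (hb ε hε.1 f).trans ?_
  rw [mul_assoc]
  refine mul_le_mul_of_nonneg_left ?_ hC
  have h : ∀ g : 𝓢(Momentum, ℂ), tsupport g ⊆ K → (∀ l, ‖g l‖ ≤ A) →
      ∫ l, ‖g l‖ ≤ MeasureTheory.volume.real K * A := by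
    intro g hg hgA
    rw [← MeasureTheory.setIntegral_eq_integral_of_forall_compl_eq_zero (s := K)
      fun l hl => by rw [image_eq_zero_of_notMem_tsupport fun h => hl (hg h), norm_zero]]
    refine (MeasureTheory.setIntegral_mono g.integrable.norm.integrableOn
      (MeasureTheory.integrableOn_const hK.measure_lt_top.ne) hgA).trans (le_of_eq ?_)
    rw [MeasureTheory.setIntegral_const, smul_eq_mul]
  have hpd : ∀ g : 𝓢(Momentum, ℂ), ⇑(partialD 0 g) = pd 0 g := fun g =>
    funext fun l => partialD_apply 0 g l
  have h3 : ⇑(partialD 0 (partialD 0 (partialD 0 f))) = pd 0 (pd 0 (pd 0 f)) := by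
    rw [hpd, hpd, hpd]
  have h1 := h f hFK hA
  have h2 := h (partialD 0 (partialD 0 (partialD 0 f)))
    (by
      rw [h3]
      exact ((tsupport_pd_subset 0 _).trans ((tsupport_pd_subset 0 _).trans
        (tsupport_pd_subset 0 _))).trans hFK)
    (by rwa [h3])
  change (∫ q, ‖f q‖) + (∫ q, ‖partialD 0 (partialD 0 (partialD 0 f)) q‖) ≤ _
  linarith

lemma continuous_shift_complexMomentum (k : Momentum) (σ : ℝ) (ν : Fin 4) :
    Continuous fun y : ℝ × Momentum => complexMomentum k y.1 ν + σ * y.2 ν := by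
  unfold complexMomentum
  split_ifs <;> fun_prop

/-- Decay in the directions not annihilated by the symbol of a boost around `-σ k`. -/
lemma rapidDecay_denominator_boost (m : ℝ) (s : ℤˣ) (k : Momentum) {x ζ : Momentum} (i : Fin 3)
    (h : (k + realSign s • x) i.succ * ζ 0 + (k + realSign s • x) 0 * ζ i.succ ≠ 0) :
    RapidDecay (denominatorPairing m (realSign s) k) x ζ := by
  refine rapidDecay_of_symbol (X := fun μ ε l =>
    boostCoeff i (fun ν => complexMomentum k ε ν + realSign s * l ν) μ)
    (fun ε hε F G hF hF' hG hG' c => denominatorPairing_add_mul m _ k hε.1 hF.continuous hF'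
      hG.continuous hG' c) (fun K hK => exists_denominatorPairing_bound m s k hK)
    (fun μ n => boundedFamily_boostCoeff i (fun ν => boundedFamily_shift n ν) μ) (fun μ => ?_)
    (fun ε hε F hF hF' => denominatorPairing_boost m _ k hε.1 i hF hF') ?_
  · refine Continuous.continuousAt ?_
    have hc := continuous_shift_complexMomentum k (realSign s)
    unfold boostCoeff
    split_ifs
    · exact hc _
    · exact hc _
    · exact continuous_const
  · rw [sum_boostCoeff i (fun ν => complexMomentum k 0 ν + realSign s * (x ν : ℂ))
      fun μ => (ζ μ : ℂ), complexMomentum_zero, complexMomentum_zero]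
    have e : ((k i.succ : ℂ) + realSign s * x i.succ) * ζ 0 +
        ((k 0 : ℂ) + realSign s * x 0) * ζ i.succ =
        (((k + realSign s • x) i.succ * ζ 0 + (k + realSign s • x) 0 * ζ i.succ : ℝ) : ℂ) := by
      simp
    rw [e]
    exact Complex.ofReal_ne_zero.2 h

lemma denominator_complexMomentum_zero (m σ : ℝ) (k l : Momentum) :
    denominator m σ (complexMomentum k 0) l = ((minkowskiSq (k + σ • l) - m ^ 2 : ℝ) : ℂ) := by
  unfold denominator minkowskiSq
  simp only [complexMomentum_zero]
  rw [Fin.sum_univ_succ]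
  simp
  ring

/-- Where `(k + σ l)² ≠ m²` the denominator `h` does not vanish, so that one of the fields `h ∂_ν`
yields decay in any given direction. -/
lemma rapidDecay_denominator_of_ne (m : ℝ) (s : ℤˣ) (k : Momentum) {x ζ : Momentum} (hζ : ζ ≠ 0)
    (h : minkowskiSq (k + realSign s • x) ≠ m ^ 2) :
    RapidDecay (denominatorPairing m (realSign s) k) x ζ := by
  obtain ⟨ν, hν⟩ : ∃ ν, ζ ν ≠ 0 := by
    by_contra! hall
    exact hζ (PiLp.ext hall)
  refine rapidDecay_of_symbol (X := fun μ ε l =>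
    if μ = ν then denominator m (realSign s) (complexMomentum k ε) l else 0)
    (fun ε hε F G hF hF' hG hG' c => denominatorPairing_add_mul m _ k hε.1 hF.continuous hF'
      hG.continuous hG' c) (fun K hK => exists_denominatorPairing_bound m s k hK)
    (fun μ n => ?_) (fun μ => ?_)
    (fun ε hε F hF hF' => denominatorPairing_mul_pd m _ k hε.1 ν hF hF') ?_
  · split_ifs
    · exact boundedFamily_denominator n
    · exact BoundedFamily.const (C := 0) (by simp)
  · refine Continuous.continuousAt ?_
    have hc := continuous_shift_complexMomentum k (realSign s)
    unfold denominator
    split_ifs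
    · fun_prop
    · exact continuous_const
  · simp only [ite_mul, zero_mul, Finset.sum_ite_eq', Finset.mem_univ, if_true]
    rw [denominator_complexMomentum_zero, ← Complex.ofReal_mul]
    exact Complex.ofReal_ne_zero.2 (mul_ne_zero (sub_ne_zero.2 h) hν)

/-- The bilinear form polarising the Minkowski square. -/
def minkowskiBilin (x y : Momentum) : ℝ := x 0 * y 0 - ∑ i : Fin 3, x i.succ * y i.succ

lemma minkowskiSq_sub_smul {σ : ℝ} (hσ : σ ^ 2 = 1) (q x : Momentum) :
    minkowskiSq (q - σ • x) = minkowskiSq q + minkowskiSq x - 2 * σ * minkowskiBilin q x := by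
  unfold minkowskiSq minkowskiBilin
  simp only [Fin.sum_univ_three, PiLp.sub_apply, PiLp.smul_apply, smul_eq_mul]
  linear_combination (x 0 ^ 2 - x (Fin.succ 0) ^ 2 - x (Fin.succ 1) ^ 2 - x (Fin.succ 2) ^ 2) * hσ

/-- Two points of the mass hyperboloid at which `ζ` is annihilated by the symbols of all boosts are
both proportional to the vector with components `ζ₀, -ζ₁, -ζ₂, -ζ₃`, unless `x` is zero; hence the
square of their Minkowski product is the product of their Minkowski squares. -/
lemma minkowskiBilin_sq_eq {m : ℝ} {x q ζ : Momentum} (hζ : ζ ≠ 0) (hx : minkowskiSq x = m ^ 2)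
    (hx0 : m ^ 2 + ∑ i : Fin 3, x i.succ ^ 2 = x 0 ^ 2) (hq : minkowskiSq q = m ^ 2)
    (h1 : ∀ i : Fin 3, x 0 * ζ i.succ + x i.succ * ζ 0 = 0)
    (h2 : ∀ i : Fin 3, q i.succ * ζ 0 + q 0 * ζ i.succ = 0) :
    minkowskiBilin q x ^ 2 = (m ^ 2) ^ 2 := by
  by_cases h0 : ζ 0 = 0
  · obtain ⟨i, hi⟩ : ∃ i : Fin 3, ζ i.succ ≠ 0 := by
      by_contra! hall
      exact hζ (PiLp.ext (Fin.cases h0 hall))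
    have hx00 : x 0 = 0 := by simpa [h0, hi] using h1 i
    have hm0 : m ^ 2 = 0 := by
      have : 0 ≤ ∑ i : Fin 3, x i.succ ^ 2 := Finset.sum_nonneg fun i _ => sq_nonneg _
      rw [hx00] at hx0
      nlinarith [sq_nonneg m]
    have hxi : ∀ i : Fin 3, x i.succ = 0 := by
      intro i
      have hs : ∑ i : Fin 3, x i.succ ^ 2 = 0 := by
        rw [hx00, hm0] at hx0
        linarith
      have := (Finset.sum_eq_zero_iff_of_nonneg fun i _ => sq_nonneg _).1 hs i (Finset.mem_univ i)
      exact pow_eq_zero_iff (two_ne_zero) |>.1 this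
    unfold minkowskiBilin
    rw [hm0, hx00]
    simp [hxi]
  · set r : Fin 3 → ℝ := fun i => -ζ i.succ / ζ 0 with hr
    have e1 : ∀ i, x i.succ = x 0 * r i := by
      intro i
      rw [hr]
      field_simp
      linarith [h1 i]
    have e2 : ∀ i, q i.succ = q 0 * r i := by
      intro i
      rw [hr]
      field_simp
      linarith [h2 i]
    unfold minkowskiSq at hx hq
    unfold minkowskiBilin
    simp only [e1, e2, Fin.sum_univ_three] at hx hq ⊢
    nth_rewrite 1 [sq (m ^ 2)]
    nth_rewrite 1 [← hx]
    rw [← hq]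
    ring

/-- Over each point one of the two factors decays in a given direction, and otherwise the other
one decays in the opposite direction: if all symbols vanish then `k + s x` and `x` are linearly
dependent points of the mass hyperboloid, and then `k²` is `0` or `4m²`. -/
lemma rapidDecay_or {m : ℝ} (hm : 0 ≤ m) (s : ℤˣ) {k : Momentum}
    (hk : k ∈ nonexceptionalMomenta m) (x : Momentum) {ζ : Momentum} (hζ : ζ ≠ 0) :
    RapidDecay (fun _ F => shellIntegral m F) x ζ ∨
      RapidDecay (denominatorPairing m (realSign s) k) x (-ζ) := by
  by_contra! hcon
  obtain ⟨hu, hv⟩ := hcon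
  have hσ := realSign_sq s
  set q := k + realSign s • x with hq
  have hxs : x ∈ Set.range (onShell m) := by
    by_contra h
    exact hu (rapidDecay_shell_of_notMem ζ h)
  have hqs : minkowskiSq q = m ^ 2 := by
    by_contra h
    exact hv (rapidDecay_denominator_of_ne m s k (neg_ne_zero.2 hζ) h)
  have h1 : ∀ i : Fin 3, x 0 * ζ i.succ + x i.succ * ζ 0 = 0 := by
    intro i
    by_contra h
    exact hu (rapidDecay_shell hm i h)
  have h2 : ∀ i : Fin 3, q i.succ * ζ 0 + q 0 * ζ i.succ = 0 := by
    intro i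
    by_contra h
    refine hv (rapidDecay_denominator_boost m s k i fun h' => h ?_)
    simp only [PiLp.neg_apply] at h'
    linarith
  obtain ⟨p, rfl⟩ := hxs
  have hx0 : m ^ 2 + ∑ i : Fin 3, (onShell m p) i.succ ^ 2 = (onShell m p) 0 ^ 2 := by
    rw [onShell_zero, shellEnergy, Real.sq_sqrt (by positivity), EuclideanSpace.norm_sq_eq]
    simp only [Real.norm_eq_abs, sq_abs, onShell_succ]
    ring
  have hx : minkowskiSq (onShell m p) = m ^ 2 := by
    unfold minkowskiSq
    linarith
  have hb := minkowskiBilin_sq_eq hζ hx hx0 hqs h1 h2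
  have hkq : k = q - realSign s • onShell m p := by rw [hq, add_sub_cancel_right]
  have hk2 := minkowskiSq_sub_smul hσ q (onShell m p)
  rw [← hkq, hqs, hx] at hk2
  have hprod : minkowskiSq k * (minkowskiSq k - 4 * m ^ 2) = 0 := by
    rw [hk2]
    linear_combination 4 * minkowskiBilin q (onShell m p) ^ 2 * hσ + 4 * hb
  refine hk ?_
  rcases mul_eq_zero.1 hprod with h | h
  · exact Set.mem_insert_iff.2 (.inl h)
  · exact Set.mem_insert_iff.2 (.inr (sub_eq_zero.1 h))

/-! ### Wave front sets and the convolution of the localised Fourier transforms -/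

lemma modulate_eq (η : Momentum) (χ : 𝓢(Momentum, ℂ)) :
    ⇑(modulate η χ) = fun l => osc η l * χ l :=
  funext fun l => modulate_apply η χ l

lemma localFourier_twoPointHat (m : ℝ) (χ : 𝓢(Momentum, ℂ)) (η : Momentum) :
    localFourier (twoPointHat m) χ η =
      (2 * Real.pi : ℂ)⁻¹ * shellIntegral m fun l => osc η l * χ l := by
  rw [localFourier, twoPointHat_apply, modulate_eq]

lemma tendsto_localFourier_signedShift (m : ℝ) (s : ℤˣ) (k : Momentum) (χ : 𝓢(Momentum, ℂ))
    (η : Momentum) : Filter.Tendsto (fun ε => -((2 * Real.pi : ℂ)⁻¹ ^ 2) *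
      denominatorPairing m (realSign s) k ε fun l => osc η l * χ l) (𝓝[>] 0)
      (𝓝 (localFourier (signedShift s k (retardedHat m)) χ η)) := by
  have h := tendsto_denominatorPairing m s k (modulate η χ)
  rwa [modulate_eq] at h

/-- Rapid decay of approximating functionals bounds the wave front set of the limit. -/
lemma RapidDecay.notMem_waveFrontSet {T : ℝ → (Momentum → ℂ) → ℂ} {x ζ : Momentum}
    (h : RapidDecay T x ζ) {u : TemperedDist} (c : ℂ)
    (hu : ∀ χ η, Filter.Tendsto (fun ε => c * T ε fun l => osc η l * χ l) (𝓝[>] 0)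
      (𝓝 (localFourier u χ η))) : (x, ζ) ∉ waveFrontSet u := by
  obtain ⟨V, hV, ε₀, hε₀, Γ, hΓ, hζ, hcone, hdec⟩ := h
  rintro ⟨-, hnot⟩
  refine hnot ?_
  obtain ⟨r, hr, hball⟩ := Metric.mem_nhds_iff.1 hV
  set B : ContDiffBump x := ⟨r / 4, r / 2, by positivity, by linarith⟩ with hB
  have hBV : tsupport (bumpSchwartz B) ⊆ V := (tsupport_bumpSchwartz_subset B).trans
    ((Metric.closedBall_subset_ball (half_lt_self hr)).trans hball)
  refine ⟨bumpSchwartz B, hasCompactSupport_bumpSchwartz B, ?_, Γ, hΓ, hζ, hcone, fun N => ?_⟩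
  · rw [bumpSchwartz_apply, B.one_of_mem_closedBall (Metric.mem_closedBall_self (by positivity))]
    simp
  · obtain ⟨C, hC⟩ := hdec _ (hasCompactSupport_bumpSchwartz B) hBV N
    refine ⟨‖c‖ * C, fun η hη => ?_⟩
    refine le_of_tendsto ((hu (bumpSchwartz B) η).norm.const_mul ((1 + ‖η‖) ^ N)) ?_
    filter_upwards [Ioo_mem_nhdsGT hε₀] with ε hε
    rw [norm_mul, mul_left_comm]
    exact mul_le_mul_of_nonneg_left (hC ε hε η hη) (norm_nonneg _)

lemma waveFrontSet_disjoint {m : ℝ} (hm : 0 ≤ m) (s : ℤˣ) {k : Momentum}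
    (hk : k ∈ nonexceptionalMomenta m) (x ζ : Momentum)
    (hu : (x, ζ) ∈ waveFrontSet (twoPointHat m)) :
    (x, -ζ) ∉ waveFrontSet (signedShift s k (retardedHat m)) := by
  have hζ : ζ ≠ 0 := hu.1
  rcases rapidDecay_or hm s hk x hζ with h | h
  · refine absurd hu (h.notMem_waveFrontSet (2 * Real.pi : ℂ)⁻¹ fun χ η => ?_)
    rw [localFourier_twoPointHat]
    exact tendsto_const_nhds
  · exact h.notMem_waveFrontSet _ (tendsto_localFourier_signedShift m s k)

lemma norm_shellIntegral_osc_le (m : ℝ) (χ : 𝓢(Momentum, ℂ)) (η : Momentum) :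
    ‖shellIntegral m fun l => osc η l * χ l‖ ≤ shellNorm m χ :=
  norm_shellIntegral_le fun p => by rw [norm_mul, norm_osc, one_mul]

/-- The localised Fourier transforms of the regularised propagators grow at most polynomially,
uniformly in `ε`. -/
lemma exists_denominatorPairing_osc_le (m : ℝ) (s : ℤˣ) (k : Momentum) {χ : 𝓢(Momentum, ℂ)}
    (hχ : HasCompactSupport χ) : ∃ B : ℝ, 0 ≤ B ∧ ∀ ε ∈ Set.Ioo (0 : ℝ) 1, ∀ η,
      ‖denominatorPairing m (realSign s) k ε fun l => osc η l * χ l‖ ≤ B * (1 + ‖η‖) ^ 3 := by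
  obtain ⟨C, hC, hb⟩ := exists_denominatorPairing_bound m s k hχ
  obtain ⟨A, hA⟩ := exists_bound_osc_mul (I := Momentum) (V := Set.univ) (K := tsupport χ)
    (η := id) (g := fun _ => χ) isOpen_univ (Set.subset_univ _)
    (fun n => BoundedFamily.schwartz _ n χ) fun _ => subset_rfl
  refine ⟨C * |A|, by positivity, fun ε hε η => ?_⟩
  refine (hb ε hε _ ((contDiff_osc η).mul (χ.smooth ⊤)) tsupport_mul_subset_right _
    (fun l => (hA η l).1) fun l => (hA η l).2).trans ?_
  rw [mul_assoc]
  simp only [id]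
  gcongr
  exact le_abs_self A

/-- Near each point the product of the two localised Fourier transforms is integrable, uniformly
in `ε`: in each direction one of the factors decays rapidly and the other one grows at most
polynomially; finitely many cones cover all directions. -/
lemma exists_convolution_bound {m : ℝ} (hm : 0 ≤ m) (s : ℤˣ) {k : Momentum}
    (hk : k ∈ nonexceptionalMomenta m) (x : Momentum) :
    ∃ V ∈ 𝓝 x, ∃ ε₀ > 0, ∀ χ : 𝓢(Momentum, ℂ), HasCompactSupport χ → tsupport χ ⊆ V →
      ∀ ξ, ∃ C : ℝ, ∀ ε ∈ Set.Ioo 0 ε₀, ∀ η : Momentum,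
        (1 + ‖η‖) ^ 5 * (‖shellIntegral m fun l => osc η l * χ l‖ *
          ‖denominatorPairing m (realSign s) k ε fun l => osc (ξ - η) l * χ l‖) ≤ C := by
  set p : Set Momentum → Prop := fun S => ∃ V ∈ 𝓝 x, ∃ ε₀ > 0, ∀ χ : 𝓢(Momentum, ℂ),
    HasCompactSupport χ → tsupport χ ⊆ V → ∀ ξ, ∃ C : ℝ, ∀ ε ∈ Set.Ioo 0 ε₀, ∀ η : Momentum,
      ‖η‖⁻¹ • η ∈ S → (1 + ‖η‖) ^ 5 * (‖shellIntegral m fun l => osc η l * χ l‖ *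
          ‖denominatorPairing m (realSign s) k ε fun l => osc (ξ - η) l * χ l‖) ≤ C with hp
  have hmono : ∀ {S S' : Set Momentum}, S ⊆ S' → p S' → p S := by
    rintro S S' hSS ⟨V, hV, ε₀, hε₀, h⟩
    refine ⟨V, hV, ε₀, hε₀, fun χ hχ hχV ξ => ?_⟩
    obtain ⟨C, hC⟩ := h χ hχ hχV ξ
    exact ⟨C, fun ε hε η hη => hC ε hε η (hSS hη)⟩
  have hunion : ∀ {S S' : Set Momentum}, p S → p S' → p (S ∪ S') := by
    rintro S S' ⟨V, hV, ε₀, hε₀, h⟩ ⟨V', hV', ε₀', hε₀', h'⟩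
    refine ⟨V ∩ V', Filter.inter_mem hV hV', min ε₀ ε₀', lt_min hε₀ hε₀', fun χ hχ hχV ξ => ?_⟩
    obtain ⟨C, hC⟩ := h χ hχ (hχV.trans Set.inter_subset_left) ξ
    obtain ⟨C', hC'⟩ := h' χ hχ (hχV.trans Set.inter_subset_right) ξ
    refine ⟨max C C', fun ε hε η hη => ?_⟩
    rcases hη with hη | hη
    · exact (hC ε ⟨hε.1, hε.2.trans_le (min_le_left _ _)⟩ η hη).trans (le_max_left _ _)
    · exact (hC' ε ⟨hε.1, hε.2.trans_le (min_le_right _ _)⟩ η hη).trans (le_max_right _ _)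
  have hadd : ∀ ξ η : Momentum, 1 + ‖ξ - η‖ ≤ (1 + ‖ξ‖) * (1 + ‖η‖) := fun ξ η => by
    have := norm_sub_le ξ η
    nlinarith [mul_nonneg (norm_nonneg ξ) (norm_nonneg η)]
  have hball : ∀ R : ℝ, 0 ≤ R → ∀ χ : 𝓢(Momentum, ℂ), HasCompactSupport χ → ∀ ξ, ∃ C : ℝ,
      ∀ ε ∈ Set.Ioo (0 : ℝ) 1, ∀ η : Momentum, ‖η‖ ≤ R →
        (1 + ‖η‖) ^ 5 * (‖shellIntegral m fun l => osc η l * χ l‖ *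
          ‖denominatorPairing m (realSign s) k ε fun l => osc (ξ - η) l * χ l‖) ≤ C := by
    intro R hR χ hχ ξ
    obtain ⟨B, hB, hb⟩ := exists_denominatorPairing_osc_le m s k hχ
    have hA : 0 ≤ shellNorm m χ := MeasureTheory.integral_nonneg fun _ => norm_nonneg _
    refine ⟨(1 + R) ^ 5 * (shellNorm m χ * (B * ((1 + ‖ξ‖) * (1 + R)) ^ 3)),
      fun ε hε η hη => ?_⟩
    have h1 : 1 + ‖η‖ ≤ 1 + R := by linarith
    have h2 : ‖denominatorPairing m (realSign s) k ε fun l => osc (ξ - η) l * χ l‖ ≤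
        B * ((1 + ‖ξ‖) * (1 + R)) ^ 3 := by
      refine (hb ε hε _).trans ?_
      have := (hadd ξ η).trans (mul_le_mul_of_nonneg_left h1 (by positivity))
      gcongr
    have h3 := norm_shellIntegral_osc_le m χ η
    gcongr
  have hloc : ∀ ζ ∈ Metric.sphere (0 : Momentum) 1,
      ∃ S ∈ 𝓝[Metric.sphere (0 : Momentum) 1] ζ, p S := by
    intro ζ hζ
    have hζ1 : ‖ζ‖ = 1 := by simpa using hζ
    have hζ0 : ζ ≠ 0 := by
      rintro rfl
      simp at hζ1
    rcases rapidDecay_or hm s hk x hζ0 with ⟨V, hV, ε₀, hε₀, Γ, hΓ, hζΓ, hcone, hdec⟩ |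
      ⟨V, hV, ε₀, hε₀, Γ, hΓ, hζΓ, hcone, hdec⟩
    · -- the decay of order `8` makes up for the growth of order `3` and leaves order `5`, which
      -- suffices for integrability in dimension four
      refine ⟨Γ, mem_nhdsWithin_of_mem_nhds (hΓ.mem_nhds hζΓ), V, hV, min ε₀ 1,
        lt_min hε₀ one_pos, fun χ hχ hχV ξ => ?_⟩
      obtain ⟨C, hC⟩ := hdec χ hχ hχV 8
      obtain ⟨B, hB, hb⟩ := exists_denominatorPairing_osc_le m s k hχ
      refine ⟨C * (B * (1 + ‖ξ‖) ^ 3), fun ε hε η hη => ?_⟩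
      have hηΓ : η ∈ Γ := by
        by_cases h0 : η = 0
        · simpa [h0] using hη
        · have := hcone ‖η‖ (norm_pos_iff.2 h0) _ hη
          rwa [smul_inv_smul₀ (norm_ne_zero_iff.2 h0)] at this
      have h1 := hC ε ⟨hε.1, hε.2.trans_le (min_le_left _ _)⟩ η hηΓ
      have h2 : ‖denominatorPairing m (realSign s) k ε fun l => osc (ξ - η) l * χ l‖ ≤
          B * ((1 + ‖ξ‖) * (1 + ‖η‖)) ^ 3 := by
        refine (hb ε ⟨hε.1, hε.2.trans_le (min_le_right _ _)⟩ _).trans ?_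
        have := hadd ξ η
        gcongr
      set a := ‖shellIntegral m fun l => osc η l * χ l‖
      calc _ ≤ (1 + ‖η‖) ^ 5 * (a * (B * ((1 + ‖ξ‖) * (1 + ‖η‖)) ^ 3)) := by gcongr
        _ = ((1 + ‖η‖) ^ 8 * a) * (B * (1 + ‖ξ‖) ^ 3) := by ring
        _ ≤ _ := mul_le_mul_of_nonneg_right h1 (by positivity)
    · obtain ⟨r, hr, hrΓ⟩ := Metric.isOpen_iff.1 hΓ _ hζΓ
      refine ⟨Metric.ball ζ (r / 2), mem_nhdsWithin_of_mem_nhds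
        (Metric.ball_mem_nhds _ (half_pos hr)), V, hV, min ε₀ 1,
        lt_min hε₀ one_pos, fun χ hχ hχV ξ => ?_⟩
      obtain ⟨C, hC⟩ := hdec χ hχ hχV 5
      -- beyond this radius the direction of `ξ - η` differs little from that of `-η`
      obtain ⟨D, hD⟩ := hball (2 * ‖ξ‖ / r) (by positivity) χ hχ ξ
      refine ⟨max D (shellNorm m χ * ((1 + ‖ξ‖) ^ 5 * C)), fun ε hε η hη => ?_⟩
      by_cases hsmall : ‖η‖ ≤ 2 * ‖ξ‖ / r
      · exact (hD ε ⟨hε.1, hε.2.trans_le (min_le_right _ _)⟩ η hsmall).trans (le_max_left _ _)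
      · refine le_trans ?_ (le_max_right _ _)
        rw [not_le] at hsmall
        have hη0 : 0 < ‖η‖ := lt_of_le_of_lt (by positivity) hsmall
        have hmem : ξ - η ∈ Γ := by
          have h1 : ‖η‖⁻¹ • (ξ - η) ∈ Γ := by
            refine hrΓ ?_
            rw [Metric.mem_ball, dist_eq_norm]
            have e : ‖η‖⁻¹ • (ξ - η) - -ζ = ‖η‖⁻¹ • ξ - (‖η‖⁻¹ • η - ζ) := by
              rw [smul_sub]
              abel
            rw [e]
            refine (norm_sub_le _ _).trans_lt ?_
            have h2 : ‖‖η‖⁻¹ • ξ‖ < r / 2 := by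
              rw [norm_smul, norm_inv, norm_norm, inv_mul_lt_iff₀ hη0]
              rw [div_lt_iff₀ hr] at hsmall
              linarith
            have h3 : ‖‖η‖⁻¹ • η - ζ‖ < r / 2 := by
              rw [← dist_eq_norm]
              exact hη
            linarith
          have := hcone ‖η‖ hη0 _ h1
          rwa [smul_inv_smul₀ hη0.ne'] at this
        have h1 := hC ε ⟨hε.1, hε.2.trans_le (min_le_left _ _)⟩ _ hmem
        have h2 := norm_shellIntegral_osc_le m χ η
        have h3 : 1 + ‖η‖ ≤ (1 + ‖ξ‖) * (1 + ‖ξ - η‖) := by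
          simpa using hadd ξ (ξ - η)
        set b := ‖denominatorPairing m (realSign s) k ε fun l => osc (ξ - η) l * χ l‖
        have hA : 0 ≤ shellNorm m χ := MeasureTheory.integral_nonneg fun _ => norm_nonneg _
        calc _ ≤ ((1 + ‖ξ‖) * (1 + ‖ξ - η‖)) ^ 5 * (shellNorm m χ * b) := by gcongr
          _ = shellNorm m χ * ((1 + ‖ξ‖) ^ 5 * ((1 + ‖ξ - η‖) ^ 5 * b)) := by ring
          _ ≤ _ := by gcongr
  obtain ⟨V, hV, ε₀, hε₀, h⟩ := (isCompact_sphere (0 : Momentum) 1).induction_on (p := p)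
    ⟨Set.univ, Filter.univ_mem, 1, one_pos, fun χ _ _ ξ => ⟨0, fun ε _ η hη => hη.elim⟩⟩
    (fun _ _ => hmono) (fun _ _ => hunion) hloc
  refine ⟨V, hV, min ε₀ 1, lt_min hε₀ one_pos, fun χ hχ hχV ξ => ?_⟩
  obtain ⟨C, hC⟩ := h χ hχ hχV ξ
  obtain ⟨D, hD⟩ := hball 0 le_rfl χ hχ ξ
  refine ⟨max C D, fun ε hε η => ?_⟩
  by_cases h0 : η = 0
  · exact (hD ε ⟨hε.1, hε.2.trans_le (min_le_right _ _)⟩ η (by simp [h0])).trans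
      (le_max_right _ _)
  · refine (hC ε ⟨hε.1, hε.2.trans_le (min_le_left _ _)⟩ η ?_).trans (le_max_left _ _)
    rw [mem_sphere_zero_iff_norm, norm_smul, norm_inv, norm_norm,
      inv_mul_cancel₀ (norm_ne_zero_iff.2 h0)]

/-! ### The convolution formula for the product -/

lemma continuous_osc_uncurry : Continuous fun y : Momentum × Momentum => osc y.1 y.2 := by
  have : ∀ μ, Continuous fun y : Momentum × Momentum => ((y.2 μ : ℝ) : ℂ) * (y.1 μ : ℂ) :=
    fun μ => by fun_prop
  simp only [osc_eq]
  fun_prop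

lemma osc_sub (ξ η l : Momentum) : osc (ξ - η) l = osc ξ l * (𝐞 (inner ℝ η l) : ℂ) := by
  unfold osc
  rw [← Circle.coe_mul, ← AddChar.map_add_eq_mul, inner_sub_right, real_inner_comm l η]
  congr 2
  ring

/-- Fourier inversion in the form of a convolution with a translated phase. -/
lemma integral_osc_mul_fourier (v : 𝓢(Momentum, ℂ)) (ξ l : Momentum) :
    ∫ η, osc η l * 𝓕 (v : Momentum → ℂ) (ξ - η) = osc ξ l * v l := by
  have h1 := MeasureTheory.integral_sub_left_eq_self
    (fun η => osc (ξ - η) l * 𝓕 (v : Momentum → ℂ) η) MeasureTheory.volume ξ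
  simp only [sub_sub_cancel] at h1
  rw [h1]
  have h2 : 𝓕⁻ (𝓕 (v : Momentum → ℂ)) = v :=
    v.continuous.fourierInv_fourier_eq v.integrable (𝓕 v : 𝓢(Momentum, ℂ)).integrable
  have h3 := congrFun h2 l
  rw [Real.fourierInv_eq] at h3
  rw [← h3, ← MeasureTheory.integral_const_mul]
  refine MeasureTheory.integral_congr_ae (.of_forall fun η => ?_)
  simp only [osc_sub, Circle.smul_def, smul_eq_mul, mul_assoc]

/-- The convolution theorem for the product of the shell measure with a test function, by Fubini and
Fourier inversion. -/
lemma integral_shellIntegral_osc_mul_fourier (m : ℝ) (χ v : 𝓢(Momentum, ℂ)) (ξ : Momentum) :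
    ∫ η, (shellIntegral m fun l => osc η l * χ l) * 𝓕 (v : Momentum → ℂ) (ξ - η) =
      shellIntegral m fun l => osc ξ l * (χ l * v l) := by
  have hv : MeasureTheory.Integrable fun η => 𝓕 (v : Momentum → ℂ) (ξ - η) :=
    (𝓕 v : 𝓢(Momentum, ℂ)).integrable.comp_sub_left ξ
  have hint : MeasureTheory.Integrable (Function.uncurry fun (η : Momentum)
      (p : EuclideanSpace ℝ (Fin 3)) => osc η (onShell m p) * (𝓕 (v : Momentum → ℂ) (ξ - η) *
        (χ (onShell m p) / (2 * shellEnergy m p : ℝ)))) := by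
    refine (hv.mul_prod (integrable_shell m χ)).bdd_mul (c := 1) ?_ (.of_forall fun y => ?_)
    · exact (continuous_osc_uncurry.comp (continuous_fst.prodMk
        ((continuous_onShell m).comp continuous_snd))).aestronglyMeasurable
    · exact (norm_osc _ _).le
  have hswap := MeasureTheory.integral_integral_swap hint
  have hL : ∀ η, (shellIntegral m fun l => osc η l * χ l) * 𝓕 (v : Momentum → ℂ) (ξ - η) =
      ∫ p : EuclideanSpace ℝ (Fin 3), osc η (onShell m p) * (𝓕 (v : Momentum → ℂ) (ξ - η) *
        (χ (onShell m p) / (2 * shellEnergy m p : ℝ))) := by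
    intro η
    rw [shellIntegral, ← MeasureTheory.integral_mul_const]
    congr 1
    funext p
    ring
  simp only [hL]
  rw [hswap, shellIntegral]
  congr 1
  funext p
  have h := integral_osc_mul_fourier v ξ (onShell m p)
  calc _ = ∫ η, (osc η (onShell m p) * 𝓕 (v : Momentum → ℂ) (ξ - η)) *
        (χ (onShell m p) / (2 * shellEnergy m p : ℝ)) := by
        congr 1
        funext η
        ring
    _ = _ := by
        rw [MeasureTheory.integral_mul_const, h]
        ring

/-- For `ε > 0` the convolution theorem holds for the regularised propagator. -/
lemma integral_convolution_regularised (m : ℝ) (s : ℤˣ) (k : Momentum) {ε : ℝ} (hε : 0 < ε)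
    {χ : 𝓢(Momentum, ℂ)} (hχ : HasCompactSupport χ) (ξ : Momentum) :
    (∫ η, (shellIntegral m fun l => osc η l * χ l) *
      denominatorPairing m (realSign s) k ε fun l => osc (ξ - η) l * χ l) =
      regularised m (realSign s) 1 k ε (modulate ξ (SchwartzMap.smulLeftCLM ℂ χ χ)) ∧
    Continuous fun ζ => denominatorPairing m (realSign s) k ε fun l => osc ζ l * χ l := by
  set v := mulSmooth χ hχ _ (contDiff_inv_denominator m (realSign s) k hε) with hv
  have hF : (fun ζ => denominatorPairing m (realSign s) k ε fun l => osc ζ l * χ l) =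
      𝓕 (v : Momentum → ℂ) := by
    funext ζ
    rw [Real.fourier_eq, denominatorPairing]
    congr 1
    funext l
    rw [hv, mulSmooth_apply, Circle.smul_def, smul_eq_mul, osc]
    ring
  refine ⟨?_, ?_⟩
  · have h := integral_shellIntegral_osc_mul_fourier m χ v ξ
    rw [← hF] at h
    refine h.trans ?_
    rw [regularised_apply m _ 1 k hε, shellPairing]
    congr 1
    funext l
    rw [modulate_apply, smulLeftCLM_schwartz_apply, hv, mulSmooth_apply, pow_one, osc]
    ring
  · rw [hF]
    exact (𝓕 v : 𝓢(Momentum, ℂ)).continuous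

lemma continuous_shellIntegral_osc (m : ℝ) (χ : 𝓢(Momentum, ℂ)) :
    Continuous fun η => shellIntegral m fun l => osc η l * χ l := by
  have hc : ∀ p, Continuous fun η : Momentum =>
      osc η (onShell m p) * χ (onShell m p) / (2 * shellEnergy m p : ℝ) := by
    intro p
    have h : Continuous fun η : Momentum => osc η (onShell m p) :=
      continuous_osc_uncurry.comp (g := fun y : Momentum × Momentum => osc y.1 y.2)
        (f := fun η => (η, onShell m p)) (by fun_prop)
    exact (h.mul continuous_const).div_const _
  have hm : ∀ η, MeasureTheory.AEStronglyMeasurable (fun p : EuclideanSpace ℝ (Fin 3) =>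
      osc η (onShell m p) * χ (onShell m p) / (2 * shellEnergy m p : ℝ)) := by
    intro η
    have h := (integrable_shell m (modulate η χ)).aestronglyMeasurable
    rwa [modulate_eq] at h
  have hb : ∀ η, ∀ p : EuclideanSpace ℝ (Fin 3),
      ‖osc η (onShell m p) * χ (onShell m p) / (2 * shellEnergy m p : ℝ)‖ ≤
        ‖χ (onShell m p) / (2 * shellEnergy m p : ℝ)‖ := fun η p => by
    rw [mul_div_assoc, norm_mul, norm_osc, one_mul]
  exact MeasureTheory.continuous_of_dominated hm (fun η => .of_forall (hb η))
    (integrable_shell m χ).norm (.of_forall hc)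

/-- The product of the two distributions, as a multiple of the boundary value of `1 / h` on the
mass shell. -/
def shellProduct (m : ℝ) (s : ℤˣ) (k : Momentum) : TemperedDist :=
  (-((2 * Real.pi)⁻¹ * (2 * Real.pi)⁻¹ ^ 2) : ℝ) • resolvedShell m (realSign s) 1 k

/-- The convolution formula holds for the regularised propagators, and the bound of
`exists_convolution_bound` allows passing to the limit under the integral sign. -/
lemma isHormanderProduct_shellProduct {m : ℝ} (hm : 0 ≤ m) (s : ℤˣ) {k : Momentum}
    (hk : k ∈ nonexceptionalMomenta m) :
    IsHormanderProduct (twoPointHat m) (signedShift s k (retardedHat m)) (shellProduct m s k) := by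
  refine ⟨fun x ζ => waveFrontSet_disjoint hm s hk x ζ, fun x => ?_⟩
  obtain ⟨V, hV, ε₀, hε₀, hbound⟩ := exists_convolution_bound hm s hk x
  refine ⟨V, hV, fun χ hχ hχV ξ => ?_⟩
  obtain ⟨C, hC⟩ := hbound χ hχ hχV ξ
  set c₁ : ℂ := (2 * Real.pi : ℂ)⁻¹ with hc₁
  set c₂ : ℂ := -((2 * Real.pi : ℂ)⁻¹ ^ 2) with hc₂
  set a : Momentum → ℂ := fun η => shellIntegral m fun l => osc η l * χ l with ha
  set b : ℝ → Momentum → ℂ := fun ε ζ =>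
    denominatorPairing m (realSign s) k ε fun l => osc ζ l * χ l with hb
  set F : ℝ → Momentum → ℂ := fun ε η => (c₁ * a η) * (c₂ * b ε (ξ - η)) with hF
  set F₀ : Momentum → ℂ := fun η => localFourier (twoPointHat m) χ η *
    localFourier (signedShift s k (retardedHat m)) χ (ξ - η) with hF₀
  have hpt : ∀ η, Filter.Tendsto (fun ε => F ε η) (𝓝[>] 0) (𝓝 (F₀ η)) := by
    intro η
    rw [hF₀, hF]
    simp only [localFourier_twoPointHat]
    exact (tendsto_localFourier_signedShift m s k χ (ξ - η)).const_mul _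
  have hmeas : ∀ ε ∈ Set.Ioi (0 : ℝ),
      MeasureTheory.AEStronglyMeasurable (F ε) MeasureTheory.volume := by
    intro ε hε
    have h2 := (integral_convolution_regularised m s k hε hχ ξ).2
    exact ((continuous_const.mul (continuous_shellIntegral_osc m χ)).mul
      (continuous_const.mul (h2.comp (continuous_const.sub continuous_id)))).aestronglyMeasurable
  set G : Momentum → ℝ := fun η => ‖c₁‖ * ‖c₂‖ * C * (1 + ‖η‖) ^ (-(5 : ℝ)) with hG
  have hGint : MeasureTheory.Integrable G :=
    (integrable_one_add_norm (by simp; norm_num)).const_mul _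
  have hFG : ∀ ε ∈ Set.Ioo 0 ε₀, ∀ η, ‖F ε η‖ ≤ G η := by
    intro ε hε η
    have h := hC ε hε η
    have e : (1 + ‖η‖) ^ (-(5 : ℝ)) = ((1 + ‖η‖) ^ 5)⁻¹ := by
      rw [Real.rpow_neg (by positivity)]
      norm_cast
    rw [hF, hG]
    simp only [norm_mul]
    rw [e, ← div_eq_mul_inv, le_div_iff₀ (by positivity)]
    calc _ = ‖c₁‖ * ‖c₂‖ * ((1 + ‖η‖) ^ 5 * (‖a η‖ * ‖b ε (ξ - η)‖)) := by ring
      _ ≤ _ := mul_le_mul_of_nonneg_left h (by positivity)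
  have hIoo : Set.Ioo 0 ε₀ ∈ 𝓝[>] (0 : ℝ) := Ioo_mem_nhdsGT hε₀
  have hF₀meas : MeasureTheory.AEStronglyMeasurable F₀ MeasureTheory.volume := by
    set u : ℕ → ℝ := fun n => 1 / ((n : ℝ) + 1) with hu
    have hu0 : ∀ n, u n ∈ Set.Ioi (0 : ℝ) := fun n => by
      rw [Set.mem_Ioi]
      positivity
    have hulim : Filter.Tendsto u Filter.atTop (𝓝[>] 0) :=
      tendsto_nhdsWithin_iff.2 ⟨tendsto_one_div_add_atTop_nhds_zero_nat, .of_forall hu0⟩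
    exact aestronglyMeasurable_of_tendsto_ae Filter.atTop (fun n => hmeas (u n) (hu0 n))
      (.of_forall fun η => (hpt η).comp hulim)
  have hint : MeasureTheory.Integrable F₀ := by
    refine hGint.mono' hF₀meas (.of_forall fun η => ?_)
    refine le_of_tendsto (hpt η).norm ?_
    filter_upwards [hIoo] with ε hε using hFG ε hε η
  refine ⟨hint, ?_⟩
  have hlim : Filter.Tendsto (fun ε => ∫ η, F ε η) (𝓝[>] 0) (𝓝 (∫ η, F₀ η)) := by
    refine MeasureTheory.tendsto_integral_filter_of_dominated_convergence G ?_ ?_ hGint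
      (.of_forall hpt)
    · filter_upwards [self_mem_nhdsWithin] with ε hε using hmeas ε hε
    · filter_upwards [hIoo] with ε hε using .of_forall (hFG ε hε)
  have hlim' : Filter.Tendsto (fun ε => ∫ η, F ε η) (𝓝[>] 0)
      (𝓝 (localFourier (shellProduct m s k) (SchwartzMap.smulLeftCLM ℂ χ χ) ξ)) := by
    have h := (tendsto_resolvedShell hm (realSign_sq s) 1 hk
      (modulate ξ (SchwartzMap.smulLeftCLM ℂ χ χ))).const_mul (c₁ * c₂)
    have e : localFourier (shellProduct m s k) (SchwartzMap.smulLeftCLM ℂ χ χ) ξ =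
        c₁ * c₂ * resolvedShell m (realSign s) 1 k
          (modulate ξ (SchwartzMap.smulLeftCLM ℂ χ χ)) := by
      simp only [localFourier, shellProduct, smul_apply, Complex.real_smul, hc₁, hc₂]
      push_cast
      ring
    rw [e]
    refine h.congr' ?_
    filter_upwards [self_mem_nhdsWithin] with ε hε
    rw [← (integral_convolution_regularised m s k hε hχ ξ).1,
      ← MeasureTheory.integral_const_mul]
    congr 1
    funext η
    simp only [hF, ha, hb]
    ring
  exact tendsto_nhds_unique hlim' hlim

end

theorem mainTheorem3 (m : ℝ) (hm : 0 ≤ m) (s : ℤˣ) :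
    (∀ k ∈ nonexceptionalMomenta m, ∃! w : TemperedDist,
      IsHormanderProduct (twoPointHat m) (signedShift s k (retardedHat m)) w) ∧
    ∃ P : Momentum → TemperedDist,
      (∀ k ∈ nonexceptionalMomenta m,
        IsHormanderProduct (twoPointHat m) (signedShift s k (retardedHat m)) (P k)) ∧
      ∀ n : ℕ, IsContDiffOn n P (nonexceptionalMomenta m) := by
  refine ⟨fun k hk => ⟨shellProduct m s k, isHormanderProduct_shellProduct hm s hk,
    fun w hw => hw.unique (isHormanderProduct_shellProduct hm s hk)⟩, shellProduct m s,
    fun k hk => isHormanderProduct_shellProduct hm s hk, fun n => ?_⟩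
  have h := (isContDiffOn_resolvedShell hm (realSign_sq s) n 1
    (ContinuousLinearMap.id ℂ 𝓢(Momentum, ℂ))).const_smul
      (-((2 * Real.pi)⁻¹ * (2 * Real.pi)⁻¹ ^ 2))
  simp only [ContinuousLinearMap.comp_id] at h
  exact h
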